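/- **Theorem.** Let $d\in\{2,3\}$ and $\mu>0$, let $V:[0,\infty)\to[0,\infty)$ be measurable with essentially compact support, and for a ball $B_R(o)$ in hyperbolic space $\mathbb H^d$ and complex-valued $\phi\in H^1(B_R(o))$ put $$\mathcal E_R(\phi)=\int_{B_R(o)}\Big(\mu|\nabla\phi(z)|^2+\tfrac12V(d(o,z))|\phi(z)|^2\Big)\,dz\in[0,\infty].$$ Let $R_0>0$ be any number with $V=0$ a.e. on $(R_0,\infty)$, let $R>R_0$ and $o\in\mathbb H^d$. 1. In the class of $\phi\in H^1(B_R(o))$ with boundary value $1$ on $\partial B_R(o)$ (i.e. $\phi-1\in H^1_0(B_R(o))$) the functional $\mathcal E_R$ has a minimizer $\phi_R$, unique up to equality a.e. It is not the zero function and it is radial: $\phi_R(z)=f_R(d(o,z))$ for a.e. $z\in B_R(o)$, with a function $f_R$ that is non-negative and non-decreasing on $[0,R]$ and does not depend on $o$ or $R_0$. It solves the Euler–Lagrange equation $-\mu\Delta\phi+\tfrac12V(d(o,\cdot))\phi=0$ weakly in $B_R(o)$, that is, $$\mu\int_{B_R(o)}\langle\nabla\phi_R,\nabla\psi\rangle\,dz+\tfrac12\int_{B_R(o)}V(d(o,z))\,\phi_R\,\psi\,dz=0$$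 for every real $\psi\in C_c^\infty(B_R(o))$ with $\int V(d(o,z))\psi^2\,dz<\infty$ (for every $\psi\in C_c^\infty(B_R(o))$ if $V(d(o,\cdot))$ is locally integrable, e.g. if $V$ is bounded), both integrals being absolutely convergent. 2. Suppose moreover that $V$ is not a.e. zero. Then there is a unique number $a>0$ (the hyperbolic scattering length of $V$), not depending on $R$, $R_0$ and $o$, such that for all $R_0,R,o$ as above $a\le R_0$ and, with $$f_\infty(r)=\begin{cases}\ln\dfrac{\tanh(r/2)}{\tanh(a/2)},&d=2,\\[2mm]1-\dfrac{\tanh a}{\tanh r},&d=3,\end{cases}$$ one has $f_R(r)=f_\infty(r)/f_\infty(R)$ for $R_0<r\le R$, $f_R(r)\ge f_\infty(r)/f_\infty(R)$ for $a\le r\le R$, and $$\mathcal E_R(\phi_R)=\frac{\mu\,f_\infty'(R)\,\sinh^{d-1}(R)\,\mathrm{vol}(\mathbb S^{d-1})}{f_\infty(R)}=\begin{cases}\dfrac{2\pi\mu}{\ln\big(\tanh(R/2)/\tanh(a/2)\big)},&d=2,\\[3mm]\dfrac{4\pi\mu\tanh a}{1-\tanh a/\tanh R},&d=3.\end{cases}$$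 -/

import Mathlib

open MeasureTheory Filter Topology Set
open scoped ENNReal ContDiff

noncomputable section

namespace HypScattering

/-- The coordinate space `ℝ^d`, with its Euclidean norm. Hyperbolic space `ℍ^d` is realised as the
Poincaré ball: the open unit ball of this space with the Riemannian metric
`(2 / (1 - ‖x‖²))² ⟨·, ·⟩`. -/
abbrev Coord (d : ℕ) : Type := EuclideanSpace ℝ (Fin d)

/-- The underlying set of the Poincaré ball model of `ℍ^d`. -/
def poincareBall (d : ℕ) : Set (Coord d) := Metric.ball 0 1

/-- The conformal factor `2 / (1 - ‖x‖²)` of the hyperbolic metric. -/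
def conf {d : ℕ} (x : Coord d) : ℝ := 2 / (1 - ‖x‖ ^ 2)

/-- The hyperbolic distance: `sinh (d(x,y)/2) = ‖x - y‖ / √((1 - ‖x‖²) (1 - ‖y‖²))`. -/
def hdist {d : ℕ} (x y : Coord d) : ℝ :=
  2 * Real.arsinh (‖x - y‖ / Real.sqrt ((1 - ‖x‖ ^ 2) * (1 - ‖y‖ ^ 2)))

/-- The Riemannian volume of `ℍ^d`: density `(2 / (1 - ‖x‖²))^d` with respect to Lebesgue measure
on the unit ball. -/
def hvol (d : ℕ) : Measure (Coord d) :=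
  (volume.restrict (poincareBall d)).withDensity (fun x => ENNReal.ofReal (conf x ^ d))

/-- The open geodesic ball `B_R(o)` in `ℍ^d`. -/
def hball {d : ℕ} (o : Coord d) (R : ℝ) : Set (Coord d) :=
  {x | x ∈ poincareBall d ∧ hdist o x < R}

/-- `ψ` is smooth with compact support contained in `U`. -/
def IsTestFunction {d : ℕ} {F : Type*} [NormedAddCommGroup F] [NormedSpace ℝ F]
    (U : Set (Coord d)) (ψ : Coord d → F) : Prop :=
  ContDiff ℝ ∞ ψ ∧ HasCompactSupport ψ ∧ tsupport ψ ⊆ U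

/-- The classical partial derivative `∂_i ψ`. -/
def pderiv {d : ℕ} {F : Type*} [NormedAddCommGroup F] [NormedSpace ℝ F]
    (i : Fin d) (ψ : Coord d → F) (x : Coord d) : F :=
  fderiv ℝ ψ x (EuclideanSpace.single i 1)

/-- `G = (∂_1 u, …, ∂_d u)` in the weak sense on `U`: the components of the weak differential of `u`
in the Poincaré ball coordinates. -/
def IsWeakDifferential {d : ℕ} (U : Set (Coord d)) (u : Coord d → ℂ)
    (G : Coord d → EuclideanSpace ℂ (Fin d)) : Prop :=
  LocallyIntegrableOn u U volume ∧ LocallyIntegrableOn G U volume ∧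
    ∀ ψ : Coord d → ℝ, IsTestFunction U ψ → ∀ i : Fin d,
      ∫ x in U, ((pderiv i ψ x : ℝ) : ℂ) * u x = - ∫ x in U, (ψ x : ℂ) * G x i

open Classical in
/-- The weak differential of `u` on `U` (unique almost everywhere on an open set `U` when it
exists, and `0` by convention when it does not exist). -/
def weakDifferential {d : ℕ} (U : Set (Coord d)) (u : Coord d → ℂ) :
    Coord d → EuclideanSpace ℂ (Fin d) :=
  if h : ∃ G, IsWeakDifferential U u G then Classical.choose h else 0

/-- The squared length `|∇u|²` of the Riemannian gradient in the hyperbolic metric (the squared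
length of a covector is rescaled by the inverse square of the conformal factor). -/
def gradSq {d : ℕ} (U : Set (Coord d)) (u : Coord d → ℂ) (x : Coord d) : ℝ :=
  ‖weakDifferential U u x‖ ^ 2 / conf x ^ 2

/-- The Riemannian inner product `⟨∇u, ∇ψ⟩` of the gradient of `u` with that of a real smooth
function `ψ`. -/
def gradInner {d : ℕ} (U : Set (Coord d)) (u : Coord d → ℂ) (ψ : Coord d → ℝ) (x : Coord d) : ℂ :=
  (∑ i : Fin d, weakDifferential U u x i * ((pderiv i ψ x : ℝ) : ℂ)) / ((conf x : ℂ) ^ 2)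

/-- The squared `H¹(U)` norm `∫_U (|∇u|² + |u|²)`, with values in `[0, ∞]`. -/
def h1NormSq {d : ℕ} (U : Set (Coord d)) (u : Coord d → ℂ) : ℝ≥0∞ :=
  ∫⁻ x in U, ENNReal.ofReal (gradSq U u x + ‖u x‖ ^ 2) ∂(hvol d)

/-- `u ∈ H¹(U)`. -/
def MemH1 {d : ℕ} (U : Set (Coord d)) (u : Coord d → ℂ) : Prop :=
  AEStronglyMeasurable u ((hvol d).restrict U) ∧ (∃ G, IsWeakDifferential U u G) ∧
    h1NormSq U u < ⊤

/-- `u ∈ H¹₀(U)`: the closure of the test functions in `H¹(U)`. -/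
def MemH1Zero {d : ℕ} (U : Set (Coord d)) (u : Coord d → ℂ) : Prop :=
  MemH1 U u ∧ ∃ ψ : ℕ → Coord d → ℂ, (∀ n, IsTestFunction U (ψ n)) ∧
    Tendsto (fun n => h1NormSq U (fun x => u x - ψ n x)) atTop (𝓝 0)

/-- The admissible class: `φ ∈ H¹(B_R(o))` with boundary value `1` on `∂B_R(o)`. -/
def Admissible {d : ℕ} (o : Coord d) (R : ℝ) (φ : Coord d → ℂ) : Prop :=
  MemH1 (hball o R) φ ∧ MemH1Zero (hball o R) (fun x => φ x - 1)

/-- The energy `∫_{B_R(o)} (μ |∇φ|² + ½ V(d(o,z)) |φ|²) dz`, with values in `[0, ∞]`. -/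
def energy {d : ℕ} (μ : ℝ) (V : ℝ → ℝ) (o : Coord d) (R : ℝ) (φ : Coord d → ℂ) : ℝ≥0∞ :=
  ∫⁻ x in hball o R,
    ENNReal.ofReal (μ * gradSq (hball o R) φ x + 1 / 2 * V (hdist o x) * ‖φ x‖ ^ 2) ∂(hvol d)

/-- `φ` minimises the energy in the admissible class. -/
def IsMinimizer {d : ℕ} (μ : ℝ) (V : ℝ → ℝ) (o : Coord d) (R : ℝ) (φ : Coord d → ℂ) : Prop :=
  Admissible o R φ ∧ ∀ χ : Coord d → ℂ, Admissible o R χ → energy μ V o R φ ≤ energy μ V o R χ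

/-- `φ` is a weak solution of `-μ Δφ + ½ V φ = 0` on `B_R(o)`, tested against all
`ψ ∈ C_c^∞(B_R(o))` of finite potential energy `∫ V ψ² < ∞`. If `V(d(o,·))` is locally integrable,
as for bounded `V`, then these are all `ψ ∈ C_c^∞(B_R(o))`. -/
def SolvesEulerLagrange {d : ℕ} (μ : ℝ) (V : ℝ → ℝ) (o : Coord d) (R : ℝ)
    (φ : Coord d → ℂ) : Prop :=
  ∀ ψ : Coord d → ℝ, IsTestFunction (hball o R) ψ →
    IntegrableOn (fun x => V (hdist o x) * ψ x ^ 2) (hball o R) (hvol d) →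
    IntegrableOn (fun x => gradInner (hball o R) φ ψ x) (hball o R) (hvol d) ∧
    IntegrableOn (fun x => (V (hdist o x) : ℂ) * φ x * (ψ x : ℂ)) (hball o R) (hvol d) ∧
    (μ : ℂ) * (∫ x in hball o R, gradInner (hball o R) φ ψ x ∂(hvol d)) +
      1 / 2 * (∫ x in hball o R, (V (hdist o x) : ℂ) * φ x * (ψ x : ℂ) ∂(hvol d)) = 0

/-- The function on `B_R(o)` (in fact on `ℍ^d`) with radial profile `f` around `o`. -/
def radial {d : ℕ} (o : Coord d) (f : ℝ → ℝ) (x : Coord d) : ℂ := (f (hdist o x) : ℂ)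

/-- The essential support of `V : [0,∞) → [0,∞)` lies in `[0, R₀]`. -/
def EssSupportedIn (V : ℝ → ℝ) (R₀ : ℝ) : Prop := ∀ᵐ r ∂(volume.restrict (Ioi R₀)), V r = 0

/-- The zero-energy solution `f_∞` with scattering length `a`, in dimensions `2` and `3`. -/
def fInf (d : ℕ) (a r : ℝ) : ℝ :=
  if d = 2 then Real.log (Real.tanh (r / 2) / Real.tanh (a / 2))
  else 1 - Real.tanh a / Real.tanh r

/-- The surface area of the Euclidean unit sphere of `ℝ^d`. -/
def sphereArea (d : ℕ) : ℝ := ((volume : Measure (Coord d)).toSphere).real univ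

end HypScattering

end

noncomputable section

namespace HypScattering

/-! The energy is bounded below ray by ray. In geodesic polar coordinates around `o` the hyperbolic
volume is sinhⁿ r dr times the sphere measure, with n = d - 1, and the radial derivative of a
function is at most the length of its gradient. It therefore suffices to minimise ∫ (μ u'² + ½ V u²)
sinhⁿ over profiles with u(R) = 1. For a bounded potential q = V / (2μ), let g solve (sinhⁿ g')' = q
sinhⁿ g with g(0) = 1. Testing this equation with a competitor and completing the square shows that
g / g(R) is optimal, with value μ m, where m = sinhⁿ(R) g'(R) / g(R) is `fluxRatio`
(`IsBddPotential.ofReal_flux_div_le`, `Admissible.le_quadE`).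

A general V is measurable and possibly unbounded, so it is truncated at height k. A Wronskian
comparison shows that the flux ratios increase with k and that the normalised solutions decrease
(`flux_mul_prof_le`, `prof_div_le`). The energy identity bounds the squared L² distance between
derivatives by the increment of the flux ratios (`integral_sq_sub_le`). These ratios stay bounded,
because outside the support g is affine in a primitive G of 1 / sinhⁿ and is positive at R₀
(`tendsto_fluxRatio`). So the truncated minimisers converge in H¹. By Fatou the energy of the limit
is at most the limit of the truncated minima, which is also a lower bound for every admissible
function (`admissible_minProfile`).

Uniqueness is the parallelogram identity together with the fact that an H¹₀ function with vanishing
differential is zero (`MemH1Zero.ae_eq_zero`). The Euler–Lagrange equation is the first variation in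
complex directions.

For the scattering length let m(R) be the limit of the flux ratios. Beyond R₀ the flux is constant,
so the profile equals 1 - m(R) (G(R) - G(r)) there. Convexity in the variable G puts the profile
above this affine function at all smaller radii. The number G(R) - 1 / m(R) does not depend on R
(`limRatio_inv_sub`), and since G increases from -∞ at 0 it equals G(a) for exactly one a > 0. The
affine function is then `fInf` at r divided by `fInf` at R, and the minimal energy is the sphere
area times μ m(R). -/

/-! ### The radial equation with a bounded potential. -/

/-- The Volterra operator `g ↦ 1 + ∫₀ʳ sinh⁻ⁿ ∫₀ᵗ q sinhⁿ g` of the radial equation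
`(sinhⁿ g')' = q sinhⁿ g` with `g 0 = 1`, on `[0, ∞]`-valued functions. -/
def volterra (n : ℕ) (q : ℝ → ℝ) : (ℝ → ℝ≥0∞) →o (ℝ → ℝ≥0∞) where
  toFun g r := 1 + ∫⁻ t in Ioc 0 r, ENNReal.ofReal ((Real.sinh t ^ n)⁻¹) *
    ∫⁻ τ in Ioc 0 t, ENNReal.ofReal (q τ * Real.sinh τ ^ n) * g τ
  monotone' g₁ g₂ h r := by
    dsimp only
    gcongr with t τ
    exact h τ

/-- The least solution of the radial equation, with values in `[0, ∞]`. -/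
def profE (n : ℕ) (q : ℝ → ℝ) : ℝ → ℝ≥0∞ := (volterra n q).lfp

/-- The solution of the radial equation `(sinhⁿ g')' = q sinhⁿ g` with `g 0 = 1`. -/
def prof (n : ℕ) (q : ℝ → ℝ) (r : ℝ) : ℝ := (profE n q r).toReal

/-- The flux `sinhⁿ g'` of the solution `g` of the radial equation. -/
def flux (n : ℕ) (q : ℝ → ℝ) (r : ℝ) : ℝ :=
  ∫ τ in (0 : ℝ)..r, q τ * Real.sinh τ ^ n * prof n q τ

theorem profE_eq (n : ℕ) (q : ℝ → ℝ) (r : ℝ) :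
    profE n q r = 1 + ∫⁻ t in Ioc 0 r, ENNReal.ofReal ((Real.sinh t ^ n)⁻¹) *
      ∫⁻ τ in Ioc 0 t, ENNReal.ofReal (q τ * Real.sinh τ ^ n) * profE n q τ :=
  (congrFun (volterra n q).map_lfp r).symm

theorem profE_mono (n : ℕ) (q : ℝ → ℝ) : Monotone (profE n q) := by
  intro a b hab
  rw [profE_eq, profE_eq n q b]
  gcongr

theorem one_le_profE (n : ℕ) (q : ℝ → ℝ) (r : ℝ) : 1 ≤ profE n q r := by
  rw [profE_eq]
  exact le_self_add

theorem sinh_pow_pos (n : ℕ) {t : ℝ} (ht : 0 < t) : 0 < Real.sinh t ^ n :=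
  pow_pos (Real.sinh_pos_iff.2 ht) n

theorem sinh_pow_le (n : ℕ) {s t : ℝ} (hs : 0 ≤ s) (h : s ≤ t) :
    Real.sinh s ^ n ≤ Real.sinh t ^ n :=
  pow_le_pow_left₀ (Real.sinh_nonneg_iff.2 hs) (Real.sinh_le_sinh.2 h) n

theorem integral_exp_sq (M r : ℝ) :
    ∫ t in (0 : ℝ)..r, M * t * Real.exp (M * t ^ 2 / 2) = Real.exp (M * r ^ 2 / 2) - 1 := by
  have h : ∀ t ∈ uIcc 0 r, HasDerivAt (fun t : ℝ => Real.exp (M * t ^ 2 / 2))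
      (M * t * Real.exp (M * t ^ 2 / 2)) t := by
    intro t _
    have := ((((hasDerivAt_id t).pow 2).const_mul M).div_const 2).exp
    convert! this using 1
    simp; ring
  rw [intervalIntegral.integral_eq_sub_of_hasDerivAt h]
  · simp
  · exact (by fun_prop : Continuous fun t : ℝ => M * t * Real.exp (M * t ^ 2 / 2)).intervalIntegrable _ _

/-- The function exp(M r² / 2) is a supersolution: as sinh increases, the inner integral is at most
M t sinhⁿ t exp(M t² / 2), the weight cancels, and the rest integrates to the exponential minus one.
A least fixed point lies below every supersolution, so finiteness needs no Picard iteration. -/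
theorem profE_le {n : ℕ} {q : ℝ → ℝ} {M : ℝ} (hM : 0 ≤ M) (hq : ∀ r, q r ≤ M) (r : ℝ) :
    profE n q r ≤ ENNReal.ofReal (Real.exp (M * r ^ 2 / 2)) := by
  refine (volterra n q).lfp_le (a := fun r => ENNReal.ofReal (Real.exp (M * r ^ 2 / 2))) ?_ r
  intro r
  change 1 + ∫⁻ t in Ioc 0 r, ENNReal.ofReal ((Real.sinh t ^ n)⁻¹) *
    ∫⁻ τ in Ioc 0 t, ENNReal.ofReal (q τ * Real.sinh τ ^ n) *
      ENNReal.ofReal (Real.exp (M * τ ^ 2 / 2)) ≤ ENNReal.ofReal (Real.exp (M * r ^ 2 / 2))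
  rcases le_or_gt r 0 with hr | hr
  · rw [Ioc_eq_empty (by simpa using hr)]
    simp only [Measure.restrict_empty, lintegral_zero_measure, add_zero]
    rw [← ENNReal.ofReal_one]
    exact ENNReal.ofReal_le_ofReal (Real.one_le_exp (by positivity))
  have inner : ∀ t ∈ Ioc 0 r, ENNReal.ofReal ((Real.sinh t ^ n)⁻¹) *
      ∫⁻ τ in Ioc 0 t, ENNReal.ofReal (q τ * Real.sinh τ ^ n) *
      ENNReal.ofReal (Real.exp (M * τ ^ 2 / 2)) ≤
      ENNReal.ofReal (M * t * Real.exp (M * t ^ 2 / 2)) := by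
    intro t ht
    have h1 : ∫⁻ τ in Ioc 0 t, ENNReal.ofReal (q τ * Real.sinh τ ^ n) *
        ENNReal.ofReal (Real.exp (M * τ ^ 2 / 2)) ≤
        ∫⁻ _ in Ioc 0 t, ENNReal.ofReal (M * Real.sinh t ^ n * Real.exp (M * t ^ 2 / 2)) := by
      refine setLIntegral_mono' measurableSet_Ioc fun τ hτ => ?_
      rw [← ENNReal.ofReal_mul' (Real.exp_pos _).le]
      have h2 := sinh_pow_le n hτ.1.le hτ.2
      have h3 := sinh_pow_pos n hτ.1
      refine ENNReal.ofReal_le_ofReal (mul_le_mul (mul_le_mul (hq τ) h2 h3.le hM) ?_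
        (Real.exp_pos _).le (mul_nonneg hM (h3.le.trans h2)))
      refine Real.exp_le_exp.2 ?_
      have := pow_le_pow_left₀ hτ.1.le hτ.2 2
      nlinarith
    rw [setLIntegral_const, Real.volume_Ioc, ← ENNReal.ofReal_mul' (by linarith [ht.1])] at h1
    refine (mul_le_mul_right h1 _).trans ?_
    rw [← ENNReal.ofReal_mul (inv_nonneg.2 (sinh_pow_pos n ht.1).le)]
    refine ENNReal.ofReal_le_ofReal (le_of_eq ?_)
    have := (sinh_pow_pos n ht.1).ne'
    field_simp
    ring
  refine (add_le_add_right (setLIntegral_mono' measurableSet_Ioc inner) 1).trans ?_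
  rw [← ofReal_integral_eq_lintegral_ofReal, ← intervalIntegral.integral_of_le hr.le,
    integral_exp_sq, ← ENNReal.ofReal_one, ← ENNReal.ofReal_add zero_le_one]
  · simp
  · simpa using Real.one_le_exp (by positivity)
  · exact (by fun_prop : Continuous fun t : ℝ => M * t * Real.exp (M * t ^ 2 / 2)).integrableOn_Ioc
  · filter_upwards [ae_restrict_mem measurableSet_Ioc] with t ht
    have := ht.1
    positivity

section Bounded

variable {n : ℕ} {q : ℝ → ℝ} {M : ℝ}

theorem profE_ne_top (hM : 0 ≤ M) (hq : ∀ r, q r ≤ M) (r : ℝ) : profE n q r ≠ ⊤ :=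
  ((profE_le hM hq r).trans_lt ENNReal.ofReal_lt_top).ne

theorem prof_mono (hM : 0 ≤ M) (hq : ∀ r, q r ≤ M) : Monotone (prof n q) := fun _ b h =>
  ENNReal.toReal_mono (profE_ne_top hM hq b) (profE_mono n q h)

theorem one_le_prof (hM : 0 ≤ M) (hq : ∀ r, q r ≤ M) (r : ℝ) : 1 ≤ prof n q r := by
  have := ENNReal.toReal_mono (profE_ne_top hM hq r) (one_le_profE n q r)
  simpa [prof] using this

theorem prof_pos (hM : 0 ≤ M) (hq : ∀ r, q r ≤ M) (r : ℝ) : 0 < prof n q r :=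
  zero_lt_one.trans_le (one_le_prof hM hq r)

theorem measurable_prof (n : ℕ) (q : ℝ → ℝ) : Measurable (prof n q) :=
  (profE_mono n q).measurable.ennreal_toReal

theorem norm_source_le (hM : 0 ≤ M) (h0 : ∀ r, 0 ≤ q r) (hq : ∀ r, q r ≤ M) {τ t : ℝ}
    (hτ : 0 ≤ τ) (ht : τ ≤ t) :
    ‖q τ * Real.sinh τ ^ n * prof n q τ‖ ≤ M * Real.sinh t ^ n * prof n q t := by
  have h2 := sinh_pow_le n hτ ht
  have h3 : 0 ≤ Real.sinh τ ^ n := pow_nonneg (Real.sinh_nonneg_iff.2 hτ) n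
  have h4 := (prof_pos (n := n) hM hq τ).le
  rw [Real.norm_of_nonneg (mul_nonneg (mul_nonneg (h0 τ) h3) h4)]
  exact mul_le_mul (mul_le_mul (hq τ) h2 h3 hM) (prof_mono hM hq ht) h4
    (mul_nonneg hM (h3.trans h2))

theorem measurable_source (hqm : Measurable q) :
    Measurable fun τ => q τ * Real.sinh τ ^ n * prof n q τ := by
  have := measurable_prof n q
  have h : Measurable fun τ => Real.sinh τ ^ n := (Real.continuous_sinh.pow n).measurable
  fun_prop

theorem intervalIntegrable_source (hM : 0 ≤ M) (hqm : Measurable q) (h0 : ∀ r, 0 ≤ q r)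
    (hq : ∀ r, q r ≤ M) {a b : ℝ} (ha : 0 ≤ a) (hb : 0 ≤ b) :
    IntervalIntegrable (fun τ => q τ * Real.sinh τ ^ n * prof n q τ) volume a b := by
  refine (intervalIntegrable_const (c := M * Real.sinh (max a b) ^ n * prof n q (max a b))).mono_fun'
    (measurable_source hqm).aestronglyMeasurable ?_
  filter_upwards [ae_restrict_mem measurableSet_uIoc] with τ hτ
  refine norm_source_le hM h0 hq ?_ hτ.2
  exact (le_min ha hb).trans hτ.1.le

theorem flux_zero (n : ℕ) (q : ℝ → ℝ) : flux n q 0 = 0 := by simp [flux]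

theorem flux_mono (hM : 0 ≤ M) (hqm : Measurable q) (h0 : ∀ r, 0 ≤ q r) (hq : ∀ r, q r ≤ M)
    {a b : ℝ} (ha : 0 ≤ a) (hab : a ≤ b) : flux n q a ≤ flux n q b := by
  have hb := ha.trans hab
  have h := intervalIntegral.integral_add_adjacent_intervals
    (intervalIntegrable_source (n := n) hM hqm h0 hq le_rfl ha)
    (intervalIntegrable_source hM hqm h0 hq ha hb)
  have h2 : 0 ≤ ∫ τ in a..b, q τ * Real.sinh τ ^ n * prof n q τ := by
    refine intervalIntegral.integral_nonneg hab fun u hu => ?_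
    exact mul_nonneg (mul_nonneg (h0 u) (pow_nonneg (Real.sinh_nonneg_iff.2 (ha.trans hu.1)) n))
      (prof_pos hM hq u).le
  unfold flux
  linarith

theorem flux_nonneg (hM : 0 ≤ M) (hqm : Measurable q) (h0 : ∀ r, 0 ≤ q r) (hq : ∀ r, q r ≤ M)
    {r : ℝ} (hr : 0 ≤ r) : 0 ≤ flux n q r := by
  simpa [flux_zero] using flux_mono (n := n) hM hqm h0 hq le_rfl hr

theorem flux_le (hM : 0 ≤ M) (h0 : ∀ r, 0 ≤ q r) (hq : ∀ r, q r ≤ M) {r : ℝ} (hr : 0 ≤ r) :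
    flux n q r ≤ M * r * Real.sinh r ^ n * prof n q r := by
  have := intervalIntegral.norm_integral_le_of_norm_le_const (a := 0) (b := r)
    (f := fun τ => q τ * Real.sinh τ ^ n * prof n q τ) (C := M * Real.sinh r ^ n * prof n q r) ?_
  · rw [sub_zero, abs_of_nonneg hr] at this
    calc flux n q r ≤ ‖flux n q r‖ := Real.le_norm_self _
      _ ≤ _ := this
      _ = _ := by ring
  · intro τ hτ
    rw [uIoc_of_le hr] at hτ
    exact norm_source_le hM h0 hq hτ.1.le hτ.2

/-- The flux contains the factor sinhⁿ that the quotient removes, so the derivative of the solution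
vanishes linearly at 0 although 1 / sinhⁿ is singular there. -/
theorem flux_div_le (hM : 0 ≤ M) (h0 : ∀ r, 0 ≤ q r) (hq : ∀ r, q r ≤ M) {r : ℝ} (hr : 0 ≤ r) :
    flux n q r / Real.sinh r ^ n ≤ M * r * prof n q r := by
  rcases hr.eq_or_lt with rfl | hr'
  · simp [flux_zero]
  rw [div_le_iff₀ (sinh_pow_pos n hr')]
  have := flux_le (n := n) hM h0 hq hr
  linarith

theorem continuousOn_flux (hM : 0 ≤ M) (hqm : Measurable q) (h0 : ∀ r, 0 ≤ q r)
    (hq : ∀ r, q r ≤ M) {R : ℝ} (hR : 0 ≤ R) : ContinuousOn (flux n q) (Icc 0 R) := by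
  have := (intervalIntegrable_source (n := n) hM hqm h0 hq le_rfl hR)
  have h2 := intervalIntegral.continuousOn_primitive_interval' (μ := volume) this left_mem_uIcc
  rwa [uIcc_of_le hR] at h2

theorem lintegral_source (hM : 0 ≤ M) (hqm : Measurable q) (h0 : ∀ r, 0 ≤ q r)
    (hq : ∀ r, q r ≤ M) {t : ℝ} (ht : 0 ≤ t) :
    ∫⁻ τ in Ioc 0 t, ENNReal.ofReal (q τ * Real.sinh τ ^ n) * profE n q τ =
      ENNReal.ofReal (flux n q t) := by
  rw [flux, intervalIntegral.integral_of_le ht, ofReal_integral_eq_lintegral_ofReal]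
  · refine setLIntegral_congr_fun measurableSet_Ioc fun τ hτ => ?_
    rw [ENNReal.ofReal_mul (mul_nonneg (h0 τ) (sinh_pow_pos n hτ.1).le), prof,
      ENNReal.ofReal_toReal (profE_ne_top hM hq τ)]
  · exact (intervalIntegrable_source hM hqm h0 hq le_rfl ht).1
  · filter_upwards [ae_restrict_mem measurableSet_Ioc] with τ hτ
    exact mul_nonneg (mul_nonneg (h0 τ) (sinh_pow_pos n hτ.1).le) (prof_pos hM hq τ).le

theorem intervalIntegrable_flux_div (hM : 0 ≤ M) (hqm : Measurable q) (h0 : ∀ r, 0 ≤ q r)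
    (hq : ∀ r, q r ≤ M) {a b : ℝ} (ha : 0 ≤ a) (hb : 0 ≤ b) :
    IntervalIntegrable (fun t => flux n q t / Real.sinh t ^ n) volume a b := by
  suffices h : ∀ R, 0 ≤ R → IntervalIntegrable (fun t => flux n q t / Real.sinh t ^ n) volume 0 R from
    (h a ha).symm.trans (h b hb)
  intro R hR
  have hcont : ContinuousOn (fun t => flux n q t / Real.sinh t ^ n) (Ioc 0 R) :=
    ((continuousOn_flux hM hqm h0 hq hR).mono Ioc_subset_Icc_self).div
      (Real.continuous_sinh.pow n).continuousOn fun t ht => (sinh_pow_pos n ht.1).ne'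
  refine (intervalIntegrable_const (c := M * R * prof n q R)).mono_fun' ?_ ?_
  · rw [uIoc_of_le hR]
    exact hcont.aestronglyMeasurable measurableSet_Ioc
  · filter_upwards [ae_restrict_mem measurableSet_uIoc] with t ht
    rw [uIoc_of_le hR] at ht
    rw [Real.norm_of_nonneg (div_nonneg (flux_nonneg hM hqm h0 hq ht.1.le) (sinh_pow_pos n ht.1).le)]
    refine (flux_div_le hM h0 hq ht.1.le).trans ?_
    have := prof_mono (n := n) hM hq ht.2
    have := prof_pos (n := n) hM hq t
    have := ht.2
    have := ht.1
    gcongr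

theorem prof_eq_integral (hM : 0 ≤ M) (hqm : Measurable q) (h0 : ∀ r, 0 ≤ q r)
    (hq : ∀ r, q r ≤ M) {r : ℝ} (hr : 0 ≤ r) :
    prof n q r = 1 + ∫ t in (0 : ℝ)..r, flux n q t / Real.sinh t ^ n := by
  have h1 : ∫⁻ t in Ioc 0 r, ENNReal.ofReal ((Real.sinh t ^ n)⁻¹) *
      ∫⁻ τ in Ioc 0 t, ENNReal.ofReal (q τ * Real.sinh τ ^ n) * profE n q τ =
      ENNReal.ofReal (∫ t in (0 : ℝ)..r, flux n q t / Real.sinh t ^ n) := by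
    rw [intervalIntegral.integral_of_le hr, ofReal_integral_eq_lintegral_ofReal]
    · refine setLIntegral_congr_fun measurableSet_Ioc fun t ht => ?_
      rw [lintegral_source hM hqm h0 hq ht.1.le,
        ← ENNReal.ofReal_mul (inv_nonneg.2 (sinh_pow_pos n ht.1).le), div_eq_inv_mul]
    · exact (intervalIntegrable_flux_div hM hqm h0 hq le_rfl hr).1
    · filter_upwards [ae_restrict_mem measurableSet_Ioc] with t ht
      exact div_nonneg (flux_nonneg hM hqm h0 hq ht.1.le) (sinh_pow_pos n ht.1).le
  have hnn : 0 ≤ ∫ t in (0 : ℝ)..r, flux n q t / Real.sinh t ^ n :=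
    intervalIntegral.integral_nonneg hr fun t ht =>
      div_nonneg (flux_nonneg hM hqm h0 hq ht.1) (pow_nonneg (Real.sinh_nonneg_iff.2 ht.1) n)
  rw [prof, profE_eq, h1, ENNReal.toReal_add (by simp) ENNReal.ofReal_ne_top,
    ENNReal.toReal_ofReal hnn]
  simp

/-- The flux is a primitive, hence continuous even for a merely measurable q. The solution is thus
C¹ on (0, ∞); only its second derivative is restricted to almost every radius. -/
theorem hasDerivAt_prof (hM : 0 ≤ M) (hqm : Measurable q) (h0 : ∀ r, 0 ≤ q r)
    (hq : ∀ r, q r ≤ M) {r : ℝ} (hr : 0 < r) :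
    HasDerivAt (prof n q) (flux n q r / Real.sinh r ^ n) r := by
  have hcont : ContinuousOn (fun t => flux n q t / Real.sinh t ^ n) (Ioo 0 (r + 1)) :=
    ((continuousOn_flux hM hqm h0 hq (by linarith : (0:ℝ) ≤ r + 1)).mono Ioo_subset_Icc_self).div
      (Real.continuous_sinh.pow n).continuousOn fun t ht => (sinh_pow_pos n ht.1).ne'
  have hn : Ioo 0 (r + 1) ∈ 𝓝 r := Ioo_mem_nhds hr (by linarith)
  have h1 := intervalIntegral.integral_hasDerivAt_right
    (intervalIntegrable_flux_div (n := n) hM hqm h0 hq le_rfl hr.le)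
    (hcont.stronglyMeasurableAtFilter isOpen_Ioo r ⟨hr, by linarith⟩)
    (hcont.continuousAt hn)
  refine (h1.const_add 1).congr_of_eventuallyEq ?_
  filter_upwards [hn] with t ht
  exact prof_eq_integral hM hqm h0 hq ht.1.le

theorem prof_sub_eq_integral (hM : 0 ≤ M) (hqm : Measurable q) (h0 : ∀ r, 0 ≤ q r)
    (hq : ∀ r, q r ≤ M) {a b : ℝ} (ha : 0 ≤ a) (hb : 0 ≤ b) :
    prof n q b - prof n q a = ∫ t in a..b, flux n q t / Real.sinh t ^ n := by
  rw [prof_eq_integral hM hqm h0 hq ha, prof_eq_integral hM hqm h0 hq hb,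
    ← intervalIntegral.integral_add_adjacent_intervals
      (intervalIntegrable_flux_div hM hqm h0 hq le_rfl ha)
      (intervalIntegrable_flux_div hM hqm h0 hq ha hb)]
  ring

theorem abs_prof_sub_le (hM : 0 ≤ M) (hqm : Measurable q) (h0 : ∀ r, 0 ≤ q r)
    (hq : ∀ r, q r ≤ M) {a b R : ℝ} (ha : 0 ≤ a) (hab : a ≤ b) (hR : b ≤ R) :
    |prof n q b - prof n q a| ≤ M * prof n q R * b * (b - a) := by
  rw [prof_sub_eq_integral hM hqm h0 hq ha (ha.trans hab), ← Real.norm_eq_abs,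
    ← abs_of_nonneg (sub_nonneg.2 hab)]
  refine intervalIntegral.norm_integral_le_of_norm_le_const fun t ht => ?_
  rw [uIoc_of_le hab] at ht
  have h0t := ha.trans ht.1.le
  rw [Real.norm_of_nonneg (div_nonneg (flux_nonneg hM hqm h0 hq h0t)
    (pow_nonneg (Real.sinh_nonneg_iff.2 h0t) n))]
  have h1 := prof_mono (n := n) hM hq (ht.2.trans hR)
  have h2 := prof_pos (n := n) hM hq t
  calc _ ≤ M * t * prof n q t := flux_div_le hM h0 hq h0t
    _ ≤ M * b * prof n q R := by
      have := ht.2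
      have := ha.trans hab
      gcongr
    _ = _ := by ring

/-- The quadratic bound at 0 is what makes the associated radial function differentiable at the
centre of the ball. -/
theorem abs_prof_sub_one_le (hM : 0 ≤ M) (hqm : Measurable q) (h0 : ∀ r, 0 ≤ q r)
    (hq : ∀ r, q r ≤ M) {r R : ℝ} (hr : 0 ≤ r) (hR : r ≤ R) :
    |prof n q r - prof n q 0| ≤ M * prof n q R * r ^ 2 := by
  have := abs_prof_sub_le (n := n) hM hqm h0 hq le_rfl hr hR
  rw [sub_zero] at this
  linarith

theorem continuousOn_prof (hM : 0 ≤ M) (hqm : Measurable q) (h0 : ∀ r, 0 ≤ q r)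
    (hq : ∀ r, q r ≤ M) (R : ℝ) : ContinuousOn (prof n q) (Icc 0 R) := by
  rcases lt_or_ge R 0 with hR | hR
  · simp [Icc_eq_empty (not_le.2 hR)]
  have h2 := intervalIntegral.continuousOn_primitive_interval' (μ := volume)
    (intervalIntegrable_flux_div (n := n) hM hqm h0 hq le_rfl hR) left_mem_uIcc
  rw [uIcc_of_le hR] at h2
  exact (continuousOn_const.add h2).congr fun t ht => prof_eq_integral hM hqm h0 hq ht.1

end Bounded

/-! ### Weak form of the radial equation and comparison of potentials. -/

/-- A bounded, measurable, non-negative radial potential. -/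
structure IsBddPotential (q : ℝ → ℝ) (M : ℝ) : Prop where
  bound_nonneg : 0 ≤ M
  measurable : Measurable q
  nonneg : ∀ r, 0 ≤ q r
  le : ∀ r, q r ≤ M

/-- The radial part `sinhⁿ r dr` of the hyperbolic volume on `(0, R)`. -/
def radMeas (n : ℕ) (R : ℝ) : Measure ℝ :=
  (volume.restrict (Ioo 0 R)).withDensity fun r => ENNReal.ofReal (Real.sinh r ^ n)

/-- The derivative of the solution `prof` of the radial equation. -/
def dprof (n : ℕ) (q : ℝ → ℝ) (r : ℝ) : ℝ := flux n q r / Real.sinh r ^ n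

theorem measurable_sinh_pow (n : ℕ) : Measurable fun r : ℝ => ENNReal.ofReal (Real.sinh r ^ n) :=
  ENNReal.measurable_ofReal.comp (Real.continuous_sinh.pow n).measurable

instance isFiniteMeasure_radMeas (n : ℕ) (R : ℝ) : IsFiniteMeasure (radMeas n R) := by
  refine isFiniteMeasure_withDensity_ofReal (f := fun r => Real.sinh r ^ n) ?_
  exact ((Real.continuous_sinh.pow n).integrableOn_Icc.mono_set Ioo_subset_Icc_self).2

theorem ae_radMeas_of_forall {n : ℕ} {R : ℝ} {p : ℝ → Prop} (h : ∀ r ∈ Ioo 0 R, p r) :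
    ∀ᵐ r ∂(radMeas n R), p r :=
  withDensity_absolutelyContinuous _ _ ((ae_restrict_iff' measurableSet_Ioo).2 (.of_forall h))

theorem integral_radMeas (n : ℕ) (R : ℝ) (F : ℝ → ℝ) :
    ∫ r, F r ∂(radMeas n R) = ∫ r in Ioo 0 R, Real.sinh r ^ n * F r := by
  rw [radMeas, integral_withDensity_eq_integral_toReal_smul (measurable_sinh_pow n)
    (.of_forall fun _ => ENNReal.ofReal_lt_top)]
  refine setIntegral_congr_fun measurableSet_Ioo fun r hr => ?_
  simp [ENNReal.toReal_ofReal (sinh_pow_pos n hr.1).le]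

theorem integrable_radMeas_of_bound {n : ℕ} {R C : ℝ} {F : ℝ → ℝ}
    (hF : AEStronglyMeasurable F (volume.restrict (Ioo 0 R))) (h : ∀ r ∈ Ioo 0 R, |F r| ≤ C) :
    Integrable F (radMeas n R) :=
  .of_bound (hF.mono_ac (withDensity_absolutelyContinuous _ _)) C (ae_radMeas_of_forall h)

/-- The derivative bound gives a Lipschitz estimate on the open interval, and continuity extends it
to the endpoints, where the boundary terms of the integration by parts are read off. -/
theorem absolutelyContinuousOnInterval_of_bound {u u' : ℝ → ℝ} {R C : ℝ} (hR : 0 < R)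
    (hc : ContinuousOn u (Icc 0 R)) (hd : ∀ r ∈ Ioo 0 R, HasDerivAt u (u' r) r)
    (hb : ∀ r ∈ Ioo 0 R, |u' r| ≤ C) : AbsolutelyContinuousOnInterval u 0 R := by
  have h1 : LipschitzOnWith C.toNNReal u (Ioo 0 R) :=
    (convex_Ioo 0 R).lipschitzOnWith_of_nnnorm_hasDerivWithin_le
      (fun r hr => (hd r hr).hasDerivWithinAt) fun r hr => by
        rw [← NNReal.coe_le_coe, coe_nnnorm]
        exact (hb r hr).trans (Real.le_coe_toNNReal C)
  have h2 := LipschitzOnWith.closure (by rwa [closure_Ioo hR.ne]) h1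
  rw [closure_Ioo hR.ne] at h2
  refine LipschitzOnWith.absolutelyContinuousOnInterval (K := C.toNNReal) ?_
  rwa [uIcc_of_le hR.le]

theorem aestronglyMeasurable_of_hasDerivAt {u u' : ℝ → ℝ} {R : ℝ}
    (hd : ∀ r ∈ Ioo 0 R, HasDerivAt u (u' r) r) :
    AEStronglyMeasurable u' (volume.restrict (Ioo 0 R)) :=
  (measurable_deriv u).aestronglyMeasurable.congr
    ((ae_restrict_iff' measurableSet_Ioo).2 (.of_forall fun r hr => (hd r hr).deriv))

section Bounded

variable {n : ℕ} {q : ℝ → ℝ} {M : ℝ}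

theorem IsBddPotential.hasDerivAt_prof (h : IsBddPotential q M) {r : ℝ} (hr : 0 < r) :
    HasDerivAt (prof n q) (dprof n q r) r :=
  HypScattering.hasDerivAt_prof h.1 h.2 h.3 h.4 hr

theorem IsBddPotential.prof_pos (h : IsBddPotential q M) (r : ℝ) : 0 < prof n q r :=
  HypScattering.prof_pos h.1 h.4 r

theorem IsBddPotential.dprof_nonneg (h : IsBddPotential q M) {r : ℝ} (hr : 0 ≤ r) :
    0 ≤ dprof n q r :=
  div_nonneg (flux_nonneg h.1 h.2 h.3 h.4 hr) (pow_nonneg (Real.sinh_nonneg_iff.2 hr) n)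

theorem IsBddPotential.abs_dprof_le (h : IsBddPotential q M) {r R : ℝ} (hr : 0 ≤ r) (hR : r ≤ R) :
    |dprof n q r| ≤ M * R * prof n q R := by
  rw [abs_of_nonneg (h.dprof_nonneg hr)]
  refine (flux_div_le h.1 h.3 h.4 hr).trans ?_
  have := prof_mono (n := n) h.1 h.4 hR
  have := h.prof_pos (n := n) r
  have := h.1
  have := hr.trans hR
  gcongr

theorem IsBddPotential.abs_prof_le (h : IsBddPotential q M) {r R : ℝ} (hR : r ≤ R) :
    |prof n q r| ≤ prof n q R := by
  rw [abs_of_nonneg (h.prof_pos r).le]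
  exact prof_mono h.1 h.4 hR

theorem IsBddPotential.aestronglyMeasurable_dprof (h : IsBddPotential q M) (R : ℝ) :
    AEStronglyMeasurable (dprof n q) (volume.restrict (Ioo 0 R)) :=
  aestronglyMeasurable_of_hasDerivAt fun _ hr => h.hasDerivAt_prof hr.1

theorem abs_add_mul_le {a b c d e A B C D E : ℝ} (ha : |a| ≤ A) (hb : |b| ≤ B) (hc : |c| ≤ C)
    (hd : |d| ≤ D) (he : |e| ≤ E) : |a * b + c * d * e| ≤ A * B + C * D * E := by
  have hA := (abs_nonneg _).trans ha
  have hC := (abs_nonneg _).trans hc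
  have hD := (abs_nonneg _).trans hd
  refine (abs_add_le _ _).trans ?_
  rw [abs_mul, abs_mul, abs_mul]
  gcongr

theorem IsBddPotential.integrable_weak (h : IsBddPotential q M) {u u' : ℝ → ℝ} {R C D : ℝ}
    (hu : AEStronglyMeasurable u (volume.restrict (Ioo 0 R)))
    (hu' : AEStronglyMeasurable u' (volume.restrict (Ioo 0 R)))
    (hb : ∀ r ∈ Ioo 0 R, |u' r| ≤ C) (hb' : ∀ r ∈ Ioo 0 R, |u r| ≤ D) :
    Integrable (fun r => dprof n q r * u' r + q r * prof n q r * u r) (radMeas n R) := by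
  refine integrable_radMeas_of_bound (C := M * R * prof n q R * C + M * prof n q R * D) ?_ ?_
  · have h1 := h.aestronglyMeasurable_dprof (n := n) R
    have h2 := (measurable_prof n q).aestronglyMeasurable (μ := volume.restrict (Ioo 0 R))
    have h3 := h.2.aestronglyMeasurable (μ := volume.restrict (Ioo 0 R))
    exact (h1.mul hu').add ((h3.mul h2).mul hu)
  · intro r hr
    exact abs_add_mul_le (h.abs_dprof_le hr.1.le hr.2.le) (hb r hr)
      (by rw [abs_of_nonneg (h.3 r)]; exact h.4 r) (h.abs_prof_le hr.2.le) (hb' r hr)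

/-- The weak form of the radial equation on `(0, R)`, with its boundary term. -/
theorem IsBddPotential.integral_weak (h : IsBddPotential q M) {u u' : ℝ → ℝ} {R C : ℝ} (hR : 0 < R)
    (hc : ContinuousOn u (Icc 0 R)) (hd : ∀ r ∈ Ioo 0 R, HasDerivAt u (u' r) r)
    (hb : ∀ r ∈ Ioo 0 R, |u' r| ≤ C) :
    ∫ r, (dprof n q r * u' r + q r * prof n q r * u r) ∂(radMeas n R) = flux n q R * u R := by
  have hu := absolutelyContinuousOnInterval_of_bound hR hc hd hb
  have hi := intervalIntegrable_source (n := n) h.1 h.2 h.3 h.4 le_rfl hR.le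
  have hf : AbsolutelyContinuousOnInterval (flux n q) 0 R :=
    hi.absolutelyContinuousOnInterval_intervalIntegral left_mem_uIcc
  -- For measurable q the flux has derivative q sinhⁿ g only almost everywhere, so the integration
  -- by parts is the one for absolutely continuous functions.
  have key := hf.integral_deriv_mul_eq_sub hu
  rw [flux_zero, zero_mul, sub_zero, intervalIntegral.integral_of_le hR.le,
    integral_Ioc_eq_integral_Ioo] at key
  rw [integral_radMeas, ← key]
  refine setIntegral_congr_ae measurableSet_Ioo ?_
  filter_upwards [hi.ae_hasDerivAt_integral] with r hr hrR
  have h1 := (hr (by rw [uIcc_of_le hR.le]; exact Ioo_subset_Icc_self hrR) 0 left_mem_uIcc)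
  have h2 : deriv (flux n q) r = _ := h1.deriv
  rw [h2, (hd r hrR).deriv, dprof]
  have := (sinh_pow_pos n hrR.1).ne'
  field_simp
  ring

theorem IsBddPotential.prof_bounds (h : IsBddPotential q M) (R : ℝ) :
    ContinuousOn (prof n q) (Icc 0 R) ∧
    (∀ r ∈ Ioo 0 R, HasDerivAt (prof n q) (dprof n q r) r) ∧
    (∀ r ∈ Ioo 0 R, |dprof n q r| ≤ M * R * prof n q R) ∧
    (∀ r ∈ Ioo 0 R, |prof n q r| ≤ prof n q R) :=
  ⟨continuousOn_prof h.1 h.2 h.3 h.4 R, fun _ hr => h.hasDerivAt_prof hr.1,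
    fun _ hr => h.abs_dprof_le hr.1.le hr.2.le, fun _ hr => h.abs_prof_le hr.2.le⟩

variable {q₁ q₂ : ℝ → ℝ} {M₁ M₂ : ℝ}

theorem IsBddPotential.integral_weak_prof (h₁ : IsBddPotential q₁ M₁) (h₂ : IsBddPotential q₂ M₂)
    {R : ℝ} (hR : 0 < R) :
    Integrable (fun r => dprof n q₁ r * dprof n q₂ r + q₁ r * prof n q₁ r * prof n q₂ r)
      (radMeas n R) ∧
    ∫ r, (dprof n q₁ r * dprof n q₂ r + q₁ r * prof n q₁ r * prof n q₂ r) ∂(radMeas n R) =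
      flux n q₁ R * prof n q₂ R := by
  obtain ⟨a, b, c, e⟩ := h₂.prof_bounds (n := n) R
  exact ⟨h₁.integrable_weak (measurable_prof n q₂).aestronglyMeasurable
    (h₂.aestronglyMeasurable_dprof R) c e, h₁.integral_weak hR a b c⟩

/-- Each equation is tested with the solution of the other. The two integrands differ by (q₂ - q₁)
g₁ g₂ ≥ 0, which fixes the sign of the Wronskian; equivalently, the logarithmic derivative at R
grows with the potential. -/
theorem flux_mul_prof_le (h₁ : IsBddPotential q₁ M₁) (h₂ : IsBddPotential q₂ M₂)
    (h : ∀ r, q₁ r ≤ q₂ r) {R : ℝ} (hR : 0 < R) :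
    flux n q₁ R * prof n q₂ R ≤ flux n q₂ R * prof n q₁ R := by
  obtain ⟨i₁, e₁⟩ := h₁.integral_weak_prof h₂ (n := n) hR
  obtain ⟨i₂, e₂⟩ := h₂.integral_weak_prof h₁ (n := n) hR
  rw [← e₁, ← e₂]
  refine integral_mono i₁ i₂ fun r => ?_
  have := mul_le_mul_of_nonneg_right (h r)
    (mul_pos (h₁.prof_pos (n := n) r) (h₂.prof_pos (n := n) r)).le
  dsimp only
  linarith

/-- The normalised solutions decrease when the potential increases. -/
theorem prof_div_le (h₁ : IsBddPotential q₁ M₁) (h₂ : IsBddPotential q₂ M₂)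
    (h : ∀ r, q₁ r ≤ q₂ r) {r R : ℝ} (hr : 0 ≤ r) (hR : r ≤ R) :
    prof n q₂ r / prof n q₂ R ≤ prof n q₁ r / prof n q₁ R := by
  have hp₁ := fun r => h₁.prof_pos (n := n) r
  have hp₂ := fun r => h₂.prof_pos (n := n) r
  -- The derivative of g₂ / g₁ at x has the sign of the Wronskian at x, so the comparison of fluxes
  -- is applied with x in the role of R.
  have hm : MonotoneOn (fun r => prof n q₂ r / prof n q₁ r) (Icc 0 R) := by
    refine monotoneOn_of_hasDerivWithinAt_nonneg (convex_Icc 0 R)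
      ((h₂.prof_bounds R).1.div (h₁.prof_bounds R).1 fun x _ => (hp₁ x).ne')
      (f' := fun r => (dprof n q₂ r * prof n q₁ r - prof n q₂ r * dprof n q₁ r) / prof n q₁ r ^ 2)
      ?_ ?_
    · intro x hx
      rw [interior_Icc] at hx
      exact ((h₂.hasDerivAt_prof hx.1).div (h₁.hasDerivAt_prof hx.1) (hp₁ x).ne').hasDerivWithinAt
    · intro x hx
      rw [interior_Icc] at hx
      refine div_nonneg ?_ (sq_nonneg _)
      have := flux_mul_prof_le (n := n) h₁ h₂ h hx.1
      rw [dprof, dprof, div_mul_eq_mul_div, ← mul_div_assoc, ← sub_div]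
      exact div_nonneg (by linarith) (sinh_pow_pos n hx.1).le
  have := hm ⟨hr, hR⟩ ⟨hr.trans hR, le_rfl⟩ hR
  dsimp only at this
  rw [div_le_div_iff₀ (hp₁ r) (hp₁ R)] at this
  rw [div_le_div_iff₀ (hp₂ R) (hp₁ R)]
  linarith

theorem IsBddPotential.integral_energy (h : IsBddPotential q M) {R : ℝ} (hR : 0 < R) :
    Integrable (fun r => (dprof n q r / prof n q R) ^ 2 + q r * (prof n q r / prof n q R) ^ 2)
      (radMeas n R) ∧
    ∫ r, ((dprof n q r / prof n q R) ^ 2 + q r * (prof n q r / prof n q R) ^ 2) ∂(radMeas n R) =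
      flux n q R / prof n q R := by
  obtain ⟨i, e⟩ := h.integral_weak_prof h (n := n) hR
  have hp := (h.prof_pos (n := n) R).ne'
  have : ∀ r, (dprof n q r / prof n q R) ^ 2 + q r * (prof n q r / prof n q R) ^ 2 =
      (dprof n q r * dprof n q r + q r * prof n q r * prof n q r) / prof n q R ^ 2 := by
    intro r
    field_simp
  simp_rw [this]
  refine ⟨i.div_const _, ?_⟩
  rw [integral_div, e]
  field_simp

/-- Let g₁, g₂ be the normalised solutions and E₁, E₂ their energies for their own potentials. As g₂
is 1 at R, testing the first equation with g₂ gives the cross term E₁. Hence the q₁-energy of g₁ -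
g₂ is E₁ plus the q₁-energy of g₂ minus 2 E₁, which is at most E₂ - E₁. Convergence of the minimal
energies thereby becomes L² convergence of derivatives. -/
theorem integral_sq_sub_le (h₁ : IsBddPotential q₁ M₁) (h₂ : IsBddPotential q₂ M₂)
    (h : ∀ r, q₁ r ≤ q₂ r) {R : ℝ} (hR : 0 < R) :
    Integrable (fun r => (dprof n q₁ r / prof n q₁ R - dprof n q₂ r / prof n q₂ R) ^ 2)
      (radMeas n R) ∧
    ∫ r, (dprof n q₁ r / prof n q₁ R - dprof n q₂ r / prof n q₂ R) ^ 2 ∂(radMeas n R) ≤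
      flux n q₂ R / prof n q₂ R - flux n q₁ R / prof n q₁ R := by
  obtain ⟨i₁, e₁⟩ := h₁.integral_energy (n := n) hR
  obtain ⟨i₂, e₂⟩ := h₂.integral_energy (n := n) hR
  obtain ⟨i₃, e₃⟩ := h₁.integral_weak_prof h₂ (n := n) hR
  have hp₁ := (h₁.prof_pos (n := n) R).ne'
  have hp₂ := (h₂.prof_pos (n := n) R).ne'
  have hi : Integrable (fun r => (dprof n q₁ r / prof n q₁ R - dprof n q₂ r / prof n q₂ R) ^ 2)
      (radMeas n R) := by
    obtain ⟨-, -, c₁, -⟩ := h₁.prof_bounds (n := n) R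
    obtain ⟨-, -, c₂, -⟩ := h₂.prof_bounds (n := n) R
    refine integrable_radMeas_of_bound (C := (M₁ * R + M₂ * R) ^ 2) ?_ fun r hr => ?_
    · have h1 := h₁.aestronglyMeasurable_dprof (n := n) R
      have h2 := h₂.aestronglyMeasurable_dprof (n := n) R
      simp_rw [div_eq_mul_inv]
      exact ((h1.mul_const _).sub (h2.mul_const _)).pow 2
    · rw [abs_pow]
      refine pow_le_pow_left₀ (abs_nonneg _) ((abs_sub _ _).trans (add_le_add ?_ ?_)) 2
      · rw [abs_div, abs_of_pos (h₁.prof_pos (n := n) R), div_le_iff₀ (h₁.prof_pos R)]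
        exact c₁ r hr
      · rw [abs_div, abs_of_pos (h₂.prof_pos (n := n) R), div_le_iff₀ (h₂.prof_pos R)]
        exact c₂ r hr
  refine ⟨hi, ?_⟩
  have hle : ∫ r, (dprof n q₁ r / prof n q₁ R - dprof n q₂ r / prof n q₂ R) ^ 2 ∂(radMeas n R) ≤
      ∫ r, (((dprof n q₁ r / prof n q₁ R) ^ 2 + q₁ r * (prof n q₁ r / prof n q₁ R) ^ 2) +
        ((dprof n q₂ r / prof n q₂ R) ^ 2 + q₂ r * (prof n q₂ r / prof n q₂ R) ^ 2) -
        2 / (prof n q₁ R * prof n q₂ R) *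
        (dprof n q₁ r * dprof n q₂ r + q₁ r * prof n q₁ r * prof n q₂ r)) ∂(radMeas n R) := by
    refine integral_mono hi ((i₁.add i₂).sub (i₃.const_mul _)) fun r => ?_
    have h1 : 0 ≤ q₁ r * (prof n q₁ r / prof n q₁ R - prof n q₂ r / prof n q₂ R) ^ 2 :=
      mul_nonneg (h₁.3 r) (sq_nonneg _)
    have h2 := mul_le_mul_of_nonneg_right (h r) (sq_nonneg (prof n q₂ r / prof n q₂ R))
    have h3 : 2 / (prof n q₁ R * prof n q₂ R) *
        (dprof n q₁ r * dprof n q₂ r + q₁ r * prof n q₁ r * prof n q₂ r) =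
        2 * (dprof n q₁ r / prof n q₁ R) * (dprof n q₂ r / prof n q₂ R) +
        2 * q₁ r * (prof n q₁ r / prof n q₁ R) * (prof n q₂ r / prof n q₂ R) := by
      field_simp
    simp only [h3]
    nlinarith
  refine hle.trans (le_of_eq ((integral_sub (i₁.add i₂) (i₃.const_mul _)).trans ?_))
  rw [integral_add' i₁ i₂, integral_const_mul, e₁, e₂, e₃]
  field_simp
  ring

theorem flux_eq_of_ae_zero {R₀ r : ℝ} (h : IsBddPotential q M) (hR : 0 ≤ R₀)
    (h0 : ∀ᵐ t ∂(volume.restrict (Ioi R₀)), q t = 0) (hr : R₀ ≤ r) :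
    flux n q r = flux n q R₀ := by
  have h1 := intervalIntegral.integral_add_adjacent_intervals
    (intervalIntegrable_source (n := n) h.1 h.2 h.3 h.4 le_rfl hR)
    (intervalIntegrable_source h.1 h.2 h.3 h.4 hR (hR.trans hr))
  have h2 : ∫ τ in R₀..r, q τ * Real.sinh τ ^ n * prof n q τ = 0 := by
    rw [intervalIntegral.integral_of_le hr]
    refine integral_eq_zero_of_ae ?_
    filter_upwards [ae_restrict_of_ae_restrict_of_subset Ioc_subset_Ioi_self h0] with τ hτ
    simp [hτ]
  rw [flux, flux, ← h1, h2, add_zero]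

theorem flux_pos {R : ℝ} (h : IsBddPotential q M) (hR : 0 < R)
    (h0 : ¬ ∀ᵐ t ∂(volume.restrict (Ioc 0 R)), q t = 0) : 0 < flux n q R := by
  refine lt_of_le_of_ne (flux_nonneg h.1 h.2 h.3 h.4 hR.le) fun h1 => h0 ?_
  rw [flux, intervalIntegral.integral_of_le hR.le, eq_comm, integral_eq_zero_iff_of_nonneg_ae] at h1
  · filter_upwards [h1, ae_restrict_mem measurableSet_Ioc] with t ht ht'
    have h2 := (sinh_pow_pos n ht'.1).ne'
    have h3 := (h.prof_pos (n := n) t).ne'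
    simpa [h2, h3] using ht
  · filter_upwards [ae_restrict_mem measurableSet_Ioc] with τ hτ
    exact mul_nonneg (mul_nonneg (h.3 τ) (sinh_pow_pos n hτ.1).le) (h.prof_pos τ).le
  · exact (intervalIntegrable_source h.1 h.2 h.3 h.4 le_rfl hR.le).1

/-- The solution is convex as a function of a primitive `H` of `sinh⁻ⁿ`. -/
theorem prof_sub_bounds (h : IsBddPotential q M) {H : ℝ → ℝ}
    (hH : ∀ t, 0 < t → HasDerivAt H (1 / Real.sinh t ^ n) t) {r R : ℝ} (hr : 0 < r) (hR : r ≤ R) :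
    flux n q r * (H R - H r) ≤ prof n q R - prof n q r ∧
    prof n q R - prof n q r ≤ flux n q R * (H R - H r) := by
  have hpos : ∀ t ∈ Icc r R, 0 < t := fun t ht => hr.trans_le ht.1
  have hcH : ContinuousOn H (Icc r R) := fun t ht => (hH t (hpos t ht)).continuousAt.continuousWithinAt
  have hcp : ContinuousOn (prof n q) (Icc r R) :=
    fun t ht => (h.hasDerivAt_prof (hpos t ht)).continuousAt.continuousWithinAt
  -- The derivative of g - c H is (flux - c) / sinhⁿ. Since the flux increases, c = flux at r makes
  -- the difference increasing on [r, R] and c = flux at R makes it decreasing.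
  have hd : ∀ t ∈ interior (Icc r R), ∀ c, HasDerivWithinAt (fun t => prof n q t - c * H t)
      (dprof n q t - c * (1 / Real.sinh t ^ n)) (interior (Icc r R)) t := fun t ht c =>
    ((h.hasDerivAt_prof (hpos t (interior_subset ht))).sub
      ((hH t (hpos t (interior_subset ht))).const_mul c)).hasDerivWithinAt
  have hfl : ∀ t ∈ Icc r R, flux n q r ≤ flux n q t ∧ flux n q t ≤ flux n q R := fun t ht =>
    ⟨flux_mono h.1 h.2 h.3 h.4 hr.le ht.1, flux_mono h.1 h.2 h.3 h.4 (hpos t ht).le ht.2⟩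
  constructor
  · have hm := monotoneOn_of_hasDerivWithinAt_nonneg (convex_Icc r R)
      (hcp.sub (hcH.const_smul (flux n q r))) (fun t ht => hd t ht (flux n q r)) fun t ht => by
        rw [dprof, mul_one_div, ← sub_div]
        exact div_nonneg (by linarith [hfl t (interior_subset ht)])
          (sinh_pow_pos n (hpos t (interior_subset ht))).le
    have := hm ⟨le_rfl, hR⟩ ⟨hR, le_rfl⟩ hR
    simp only [Pi.sub_apply, Pi.smul_apply, smul_eq_mul] at this
    linarith
  · have hm := antitoneOn_of_hasDerivWithinAt_nonpos (convex_Icc r R)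
      (hcp.sub (hcH.const_smul (flux n q R))) (fun t ht => hd t ht (flux n q R)) fun t ht => by
        rw [dprof, mul_one_div, ← sub_div]
        exact div_nonpos_of_nonpos_of_nonneg (by linarith [hfl t (interior_subset ht)])
          (sinh_pow_pos n (hpos t (interior_subset ht))).le
    have := hm ⟨le_rfl, hR⟩ ⟨hR, le_rfl⟩ hR
    simp only [Pi.sub_apply, Pi.smul_apply, smul_eq_mul] at this
    linarith

end Bounded

/-! ### Isometries, volume and polar coordinates in the Poincaré ball. -/

section Geometry

variable {d : ℕ}

theorem mem_poincareBall {x : Coord d} : x ∈ poincareBall d ↔ ‖x‖ < 1 := by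
  simp [poincareBall]

theorem zero_mem_poincareBall : (0 : Coord d) ∈ poincareBall d := by simp [mem_poincareBall]

theorem one_sub_norm_sq_pos {x : Coord d} (hx : x ∈ poincareBall d) : 0 < 1 - ‖x‖ ^ 2 := by
  have := mem_poincareBall.1 hx
  nlinarith [norm_nonneg x]

theorem conf_pos {x : Coord d} (hx : x ∈ poincareBall d) : 0 < conf x :=
  div_pos two_pos (one_sub_norm_sq_pos hx)

theorem two_le_conf {x : Coord d} (hx : x ∈ poincareBall d) : 2 ≤ conf x := by
  rw [conf, le_div_iff₀ (one_sub_norm_sq_pos hx)]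
  nlinarith [sq_nonneg ‖x‖]

theorem isOpen_poincareBall : IsOpen (poincareBall d) := Metric.isOpen_ball

theorem measurable_conf : Measurable (conf : Coord d → ℝ) := by
  unfold conf
  fun_prop

theorem measurable_hdist (o : Coord d) : Measurable (hdist o) := by
  unfold hdist
  have := Real.continuous_arsinh.measurable
  fun_prop

theorem hdist_nonneg (o x : Coord d) : 0 ≤ hdist o x :=
  mul_nonneg zero_le_two (Real.arsinh_nonneg_iff.2 (by positivity))

theorem hdist_self (o : Coord d) : hdist o o = 0 := by simp [hdist]

/-- A computation of tanh ∘ arsinh. It is the dictionary between geodesic radius r and Euclidean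
radius tanh (r/2) behind all polar computations. -/
theorem tanh_half_hdist_zero {y : Coord d} (hy : y ∈ poincareBall d) :
    Real.tanh (hdist 0 y / 2) = ‖y‖ := by
  have h := one_sub_norm_sq_pos hy
  have h2 := Real.sq_sqrt h.le
  have h3 := Real.sqrt_pos.2 h
  rw [hdist, mul_div_cancel_left₀ _ two_ne_zero, Real.tanh_arsinh]
  simp only [zero_sub, norm_neg, norm_zero, ne_eq, OfNat.ofNat_ne_zero, not_false_eq_true,
    zero_pow, sub_zero, one_mul]
  have : 1 + (‖y‖ / √(1 - ‖y‖ ^ 2)) ^ 2 = (1 / √(1 - ‖y‖ ^ 2)) ^ 2 := by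
    rw [div_pow, div_pow, h2]
    field_simp
    ring
  rw [this, Real.sqrt_sq (by positivity)]
  field_simp

theorem tanh_strictMono : StrictMono Real.tanh := fun a b h => by
  rw [← Real.artanh_lt_artanh_iff ⟨Real.neg_one_lt_tanh a, Real.tanh_lt_one a⟩
    ⟨Real.neg_one_lt_tanh b, Real.tanh_lt_one b⟩, Real.artanh_tanh, Real.artanh_tanh]
  exact h

theorem tanh_half_pos {r : ℝ} (hr : 0 < r) : 0 < Real.tanh (r / 2) := by
  rw [← Real.tanh_zero]
  exact tanh_strictMono (by linarith)

theorem hdist_zero_lt_iff {y : Coord d} (hy : y ∈ poincareBall d) {R : ℝ} :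
    hdist 0 y < R ↔ ‖y‖ < Real.tanh (R / 2) := by
  rw [← tanh_half_hdist_zero hy, tanh_strictMono.lt_iff_lt]
  constructor <;> intro h <;> linarith

theorem hball_zero (R : ℝ) : hball (0 : Coord d) R = Metric.ball 0 (Real.tanh (R / 2)) := by
  ext y
  simp only [hball, mem_ofPred_eq, Metric.mem_ball, dist_zero_right]
  constructor
  · rintro ⟨h1, h2⟩
    exact (hdist_zero_lt_iff h1).1 h2
  · intro h
    have h1 : y ∈ poincareBall d := mem_poincareBall.2 (h.trans (Real.tanh_lt_one _))
    exact ⟨h1, (hdist_zero_lt_iff h1).2 h⟩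

/-- `T` is a hyperbolic isometry of the Poincaré ball which swaps `0` and `o`. -/
structure IsHypSwap (o : Coord d) (T : Coord d → Coord d) : Prop where
  meas : Measurable T
  mapsTo : ∀ y ∈ poincareBall d, T y ∈ poincareBall d
  invol : ∀ y ∈ poincareBall d, T (T y) = y
  zero : T 0 = o
  dist : ∀ y ∈ poincareBall d, hdist o (T y) = hdist 0 y
  deriv : ∀ y ∈ poincareBall d, ∃ L : Coord d ≃ₗᵢ[ℝ] Coord d,
    HasFDerivAt T ((conf y / conf (T y)) • (L : Coord d →L[ℝ] Coord d)) y

/-- For o ≠ 0 the swap is inversion in the sphere with centre c = o / ‖o‖² and squared radius ‖c‖² -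
1. This sphere is orthogonal to the unit sphere, so the inversion preserves the ball and its metric.
An involution is convenient because it is its own inverse. -/
theorem exists_isHypSwap {o : Coord d} (ho : o ∈ poincareBall d) :
    ∃ T : Coord d → Coord d, IsHypSwap o T := by
  rcases eq_or_ne o 0 with rfl | h0
  · refine ⟨id, measurable_id, fun _ h => h, fun _ _ => rfl, rfl, fun _ _ => rfl, fun y hy =>
      ⟨.refl ℝ _, ?_⟩⟩
    rw [id, div_self (conf_pos hy).ne', one_smul]
    exact hasFDerivAt_id y
  have hno : 0 < ‖o‖ := norm_pos_iff.2 h0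
  have hno1 : ‖o‖ < 1 := mem_poincareBall.1 ho
  set c : Coord d := (‖o‖ ^ 2)⁻¹ • o with hc
  set ρ : ℝ := √(‖c‖ ^ 2 - 1) with hρ
  have hcn : ‖c‖ = ‖o‖⁻¹ := by
    rw [hc, norm_smul, Real.norm_of_nonneg (by positivity)]
    field_simp
  have hc1 : 1 < ‖c‖ := by
    rw [hcn]
    exact (one_lt_inv₀ hno).2 hno1
  have hρ2 : ρ ^ 2 = ‖c‖ ^ 2 - 1 := Real.sq_sqrt (by nlinarith)
  have hρ0 : ρ ≠ 0 := by
    intro h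
    rw [h] at hρ2
    nlinarith
  have hne : ∀ y ∈ poincareBall d, y ≠ c := by
    rintro y hy rfl
    exact absurd (mem_poincareBall.1 hy) (by linarith)
  have hpos : ∀ y ∈ poincareBall d, 0 < ‖y - c‖ := fun y hy =>
    norm_pos_iff.2 (sub_ne_zero.2 (hne y hy))
  -- This identity carries the construction: it keeps the image inside the ball, it identifies the
  -- dilation factor (ρ / ‖y - c‖)² with `conf y / conf (T y)`, and combined with the distance
  -- formula for inversions it yields invariance of `hdist`.
  have hfac : ∀ y ∈ poincareBall d, 1 - ‖EuclideanGeometry.inversion c ρ y‖ ^ 2 =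
      (ρ / dist y c) ^ 2 * (1 - ‖y‖ ^ 2) := by
    intro y hy
    have hp := hpos y hy
    have e1 : EuclideanGeometry.inversion c ρ y = (ρ / dist y c) ^ 2 • (y - c) + c := rfl
    have e2 : ‖y‖ ^ 2 = ‖y - c‖ ^ 2 + 2 * inner ℝ (y - c) c + ‖c‖ ^ 2 := by
      rw [← norm_add_sq_real, sub_add_cancel]
    rw [e1, norm_add_sq_real, inner_smul_left, norm_smul, e2, dist_eq_norm]
    simp only [norm_pow, norm_div, Real.norm_eq_abs, abs_norm, sq_abs, div_pow, conj_trivial]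
    rw [hρ2]
    field_simp
    ring
  have hconf : ∀ y ∈ poincareBall d, 0 < 1 - ‖EuclideanGeometry.inversion c ρ y‖ ^ 2 := by
    intro y hy
    rw [hfac y hy]
    have := one_sub_norm_sq_pos hy
    have := hpos y hy
    rw [dist_eq_norm]
    positivity
  have hz : EuclideanGeometry.inversion c ρ 0 = o := by
    change (ρ / dist 0 c) ^ 2 • ((0 : Coord d) - c) + c = o
    rw [dist_zero_left, div_pow, hρ2, zero_sub, smul_neg, neg_add_eq_sub]
    have : c - ((‖c‖ ^ 2 - 1) / ‖c‖ ^ 2) • c = (‖c‖ ^ 2)⁻¹ • c := by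
      have : (0 : ℝ) < ‖c‖ := by linarith
      rw [sub_eq_iff_eq_add, ← add_smul]
      have : (‖c‖ ^ 2)⁻¹ + (‖c‖ ^ 2 - 1) / ‖c‖ ^ 2 = 1 := by
        field_simp
        ring
      rw [this, one_smul]
    rw [this, hcn, hc, smul_smul]
    have : (‖o‖⁻¹ ^ 2)⁻¹ * (‖o‖ ^ 2)⁻¹ = 1 := by field_simp
    rw [this, one_smul]
  refine ⟨EuclideanGeometry.inversion c ρ, ?_, ?_, fun y _ =>
    EuclideanGeometry.inversion_inversion c hρ0 y, hz, ?_, ?_⟩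
  · have : EuclideanGeometry.inversion c ρ = fun y : Coord d =>
      (ρ / dist y c) ^ 2 • (y - c) + c := rfl
    rw [this]
    fun_prop
  · intro y hy
    have := hconf y hy
    rw [mem_poincareBall]
    nlinarith [norm_nonneg (EuclideanGeometry.inversion c ρ y)]
  · intro y hy
    have hp := hpos y hy
    have hp0 := hpos 0 zero_mem_poincareBall
    have e1 : hdist o (EuclideanGeometry.inversion c ρ y) = hdist
        (EuclideanGeometry.inversion c ρ 0) (EuclideanGeometry.inversion c ρ y) := by rw [hz]
    rw [e1, hdist, hdist, hfac y hy, hfac 0 zero_mem_poincareBall, ← dist_eq_norm,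
      EuclideanGeometry.dist_inversion_inversion (hne 0 zero_mem_poincareBall) (hne y hy),
      ← dist_eq_norm 0 y]
    have e2 : (ρ / dist 0 c) ^ 2 * (1 - ‖(0 : Coord d)‖ ^ 2) *
        ((ρ / dist y c) ^ 2 * (1 - ‖y‖ ^ 2)) = (ρ ^ 2 / (dist 0 c * dist y c)) ^ 2 *
        ((1 - ‖(0 : Coord d)‖ ^ 2) * (1 - ‖y‖ ^ 2)) := by
      rw [dist_eq_norm, dist_eq_norm]
      field_simp
    rw [e2, Real.sqrt_mul (sq_nonneg _), Real.sqrt_sq (by positivity), mul_div_mul_left]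
    rw [dist_eq_norm, dist_eq_norm]
    positivity
  · intro y hy
    refine ⟨(Submodule.span ℝ {y - c})ᗮ.reflection, ?_⟩
    convert! EuclideanGeometry.hasFDerivAt_inversion (R := ρ) (hne y hy) using 2
    rw [conf, conf, hfac y hy]
    have h1 := (one_sub_norm_sq_pos hy).ne'
    have h2 := (hpos y hy).ne'
    rw [dist_eq_norm]
    field_simp

variable {o : Coord d} {T : Coord d → Coord d}

theorem IsHypSwap.image_ball (h : IsHypSwap o T) (R : ℝ) :
    T '' Metric.ball 0 (Real.tanh (R / 2)) = hball o R := by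
  rw [← hball_zero]
  ext x
  constructor
  · rintro ⟨y, hy, rfl⟩
    exact ⟨h.mapsTo y hy.1, by rw [h.dist y hy.1]; exact hy.2⟩
  · intro hx
    refine ⟨T x, ⟨h.mapsTo x hx.1, ?_⟩, h.invol x hx.1⟩
    rw [← h.dist _ (h.mapsTo x hx.1), h.invol x hx.1]
    exact hx.2

theorem measurableSet_hball (o : Coord d) (R : ℝ) : MeasurableSet (hball o R) :=
  isOpen_poincareBall.measurableSet.inter (measurableSet_lt (measurable_hdist o) measurable_const)

theorem hball_subset (o : Coord d) (R : ℝ) : hball o R ⊆ poincareBall d := fun _ h => h.1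

theorem lintegral_hball (o : Coord d) (R : ℝ) (F : Coord d → ℝ≥0∞) :
    ∫⁻ x in hball o R, F x ∂(hvol d) =
      ∫⁻ x in hball o R, ENNReal.ofReal (conf x ^ d) * F x := by
  have hm : Measurable fun x : Coord d => ENNReal.ofReal (conf x ^ d) :=
    ENNReal.measurable_ofReal.comp (measurable_conf.pow_const d)
  rw [hvol, restrict_withDensity (measurableSet_hball o R),
    Measure.restrict_restrict (measurableSet_hball o R),
    inter_eq_left.2 (hball_subset o R), lintegral_withDensity_eq_lintegral_mul_non_measurable₀ _
      hm.aemeasurable (.of_forall fun _ => ENNReal.ofReal_lt_top)]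
  rfl

/-- A linear isometry maps the unit ball onto itself, so its volume factor is 1. -/
theorem abs_det_linearIsometryEquiv (L : Coord d ≃ₗᵢ[ℝ] Coord d) :
    |(L : Coord d →L[ℝ] Coord d).det| = 1 := by
  have h := Measure.addHaar_image_continuousLinearMap (volume : Measure (Coord d))
    (L : Coord d →L[ℝ] Coord d) (Metric.ball 0 1)
  have e : (L : Coord d →L[ℝ] Coord d) '' Metric.ball 0 1 = Metric.ball 0 1 := by
    have := L.image_ball 0 1
    rw [map_zero] at this
    exact this
  have h0 : volume (Metric.ball (0 : Coord d) 1) ≠ 0 := (Metric.measure_ball_pos _ _ one_pos).ne'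
  have h1 : volume (Metric.ball (0 : Coord d) 1) ≠ ⊤ := measure_ball_lt_top.ne
  rw [e, eq_comm, ENNReal.mul_eq_right h0 h1] at h
  exact ENNReal.ofReal_eq_one.1 h

/-- The Jacobian (conf y / conf (T y))^d converts the density at T y into the density at y, which is
the invariance of hyperbolic volume. -/
theorem IsHypSwap.lintegral_hball_eq (h : IsHypSwap o T) (R : ℝ) (F : Coord d → ℝ≥0∞) :
    ∫⁻ x in hball o R, F x ∂(hvol d) =
      ∫⁻ y in Metric.ball 0 (Real.tanh (R / 2)), ENNReal.ofReal (conf y ^ d) * F (T y) := by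
  have hsub : Metric.ball (0 : Coord d) (Real.tanh (R / 2)) ⊆ poincareBall d :=
    Metric.ball_subset_ball (Real.tanh_lt_one _).le
  rw [lintegral_hball, ← h.image_ball, lintegral_image_eq_lintegral_abs_det_fderiv_mul volume
    Metric.isOpen_ball.measurableSet (f' := fderiv ℝ T)]
  · refine setLIntegral_congr_fun Metric.isOpen_ball.measurableSet fun y hy => ?_
    obtain ⟨L, hL⟩ := h.deriv y (hsub hy)
    have h1 := conf_pos (hsub hy)
    have h2 := conf_pos (h.mapsTo y (hsub hy))
    rw [hL.fderiv, ← mul_assoc, ← ENNReal.ofReal_mul (abs_nonneg _)]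
    congr 2
    have h3 : |(L : Coord d →L[ℝ] Coord d).det| = 1 := by
      exact abs_det_linearIsometryEquiv L
    rw [ContinuousLinearMap.det, ContinuousLinearMap.toLinearMap_smul, LinearMap.det_smul, abs_mul,
      abs_of_pos (by positivity)]
    rw [ContinuousLinearMap.det] at h3
    rw [h3, finrank_euclideanSpace_fin, mul_one, div_pow]
    field_simp
  · intro y hy
    obtain ⟨L, hL⟩ := h.deriv y (hsub hy)
    rw [hL.fderiv]
    exact hL.hasFDerivWithinAt
  · intro y hy z hz hyz
    rw [← h.invol y (hsub hy), hyz, h.invol z (hsub hz)]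

theorem lintegral_ball_polar (hd : 0 < d) (t : ℝ) {G : Coord d → ℝ≥0∞} (hG : Measurable G) :
    ∫⁻ y in Metric.ball 0 t, G y = ∫⁻ w : Metric.sphere (0 : Coord d) 1,
      (∫⁻ s in Ioo 0 t, ENNReal.ofReal (s ^ (d - 1)) * G (s • (w : Coord d)))
      ∂(volume : Measure (Coord d)).toSphere := by
  have : NeZero d := ⟨hd.ne'⟩
  have hpres := (volume : Measure (Coord d)).measurePreserving_homeomorphUnitSphereProd
  have hmeas : Measurable fun p : Metric.sphere (0 : Coord d) 1 × Ioi (0 : ℝ) =>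
      (Metric.ball (0 : Coord d) t).indicator G ((p.2 : ℝ) • (p.1 : Coord d)) := by
    refine (hG.indicator Metric.isOpen_ball.measurableSet).comp ?_
    fun_prop
  have h1 : ∫⁻ y in Metric.ball 0 t, G y = ∫⁻ p : Metric.sphere (0 : Coord d) 1 × Ioi (0 : ℝ),
      (Metric.ball (0 : Coord d) t).indicator G ((p.2 : ℝ) • (p.1 : Coord d))
      ∂((volume : Measure (Coord d)).toSphere.prod (Measure.volumeIoiPow (d - 1))) := by
    rw [finrank_euclideanSpace_fin] at hpres
    -- The polar homeomorphism is defined only off the origin, which is a null set because d > 0.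
    rw [← hpres.lintegral_comp hmeas, ← lintegral_indicator Metric.isOpen_ball.measurableSet,
      ← lintegral_add_compl _ (measurableSet_singleton (0 : Coord d)),
      ← lintegral_subtype_comap (measurableSet_singleton (0 : Coord d)).compl]
    rw [Measure.restrict_singleton]
    simp only [measure_singleton, zero_smul, lintegral_zero_measure, zero_add]
    refine lintegral_congr fun y => ?_
    congr 1
    have hy : ‖(y : Coord d)‖ ≠ 0 := norm_ne_zero_iff.2 y.2
    simp [smul_smul, hy]
  rw [h1, lintegral_prod _ hmeas.aemeasurable]
  refine lintegral_congr fun w => ?_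
  rw [Measure.volumeIoiPow, lintegral_withDensity_eq_lintegral_mul_non_measurable₀ _
    (by fun_prop) (.of_forall fun _ => ENNReal.ofReal_lt_top)]
  simp only [Pi.mul_apply]
  rw [lintegral_subtype_comap measurableSet_Ioi (fun s : ℝ => ENNReal.ofReal (s ^ (d - 1)) *
    (Metric.ball (0 : Coord d) t).indicator G (s • (w : Coord d))),
    ← lintegral_indicator measurableSet_Ioi, ← lintegral_indicator measurableSet_Ioo]
  refine lintegral_congr fun s => ?_
  by_cases hs : 0 < s
  · have : s • (w : Coord d) ∈ Metric.ball (0 : Coord d) t ↔ s < t := by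
      simp [norm_smul, abs_of_pos hs]
    by_cases hst : s < t
    · simp [indicator, hs, hst, this]
    · simp [indicator, hs, hst, this]
  · simp [indicator, hs]

theorem hasDerivAt_tanh_half (r : ℝ) :
    HasDerivAt (fun r => Real.tanh (r / 2)) (1 / (2 * Real.cosh (r / 2) ^ 2)) r := by
  have h := ((Real.hasDerivAt_sinh (r / 2)).div (Real.hasDerivAt_cosh (r / 2))
    (Real.cosh_pos _).ne').comp r ((hasDerivAt_id r).div_const 2)
  have e : (fun r : ℝ => Real.tanh (r / 2)) = (fun x => Real.sinh x / Real.cosh x) ∘ fun x => id x / 2 := by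
    ext x
    simp [Real.tanh_eq_sinh_div_cosh]
  rw [e]
  convert! h using 1
  have := Real.cosh_sq (r / 2)
  have h2 := (Real.cosh_pos (r / 2)).ne'
  field_simp
  linarith

theorem one_sub_tanh_sq (r : ℝ) : 1 - Real.tanh r ^ 2 = 1 / Real.cosh r ^ 2 := by
  have := Real.cosh_sq r
  have h2 := (Real.cosh_pos r).ne'
  rw [Real.tanh_eq_sinh_div_cosh]
  field_simp
  linarith

theorem image_tanh_half {R : ℝ} :
    (fun r => Real.tanh (r / 2)) '' Ioo 0 R = Ioo 0 (Real.tanh (R / 2)) := by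
  ext s
  constructor
  · rintro ⟨r, hr, rfl⟩
    exact ⟨tanh_half_pos hr.1, tanh_strictMono (by linarith [hr.2])⟩
  · rintro ⟨h1, h2⟩
    have hs : s ∈ Ioo (-1 : ℝ) 1 := ⟨by linarith, h2.trans (Real.tanh_lt_one _)⟩
    have e : Real.tanh (2 * Real.artanh s / 2) = s := by
      rw [mul_div_cancel_left₀ _ two_ne_zero, Real.tanh_artanh hs]
    refine ⟨2 * Real.artanh s, ⟨?_, ?_⟩, e⟩
    · have := Real.artanh_pos ⟨h1, hs.2⟩
      linarith
    · have h3 : 2 * Real.artanh s / 2 < R / 2 := by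
        rw [← tanh_strictMono.lt_iff_lt, e]
        exact h2
      linarith

theorem conf_tanh_smul (r : ℝ) (w : Metric.sphere (0 : Coord d) 1) :
    conf (Real.tanh (r / 2) • (w : Coord d)) = 2 * Real.cosh (r / 2) ^ 2 := by
  have h2 := (Real.cosh_pos (r / 2)).ne'
  rw [conf, norm_smul]
  simp only [Real.norm_eq_abs, norm_eq_of_mem_sphere, mul_one, sq_abs, one_sub_tanh_sq]
  field_simp

theorem tanh_smul_mem (r : ℝ) (w : Metric.sphere (0 : Coord d) 1) :
    Real.tanh (r / 2) • (w : Coord d) ∈ poincareBall d := by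
  rw [mem_poincareBall, norm_smul]
  simpa using Real.abs_tanh_lt_one _

/-- Put s = tanh (r/2). Then `conf` = 2 cosh² (r/2), ds = dr / conf and s · conf = sinh r, so that
conf^d s^(d-1) ds = sinh^(d-1) r dr. -/
theorem IsHypSwap.lintegral_polar (h : IsHypSwap o T) (hd : 0 < d) (R : ℝ) {F : Coord d → ℝ≥0∞}
    (hF : Measurable F) :
    ∫⁻ x in hball o R, F x ∂(hvol d) = ∫⁻ w : Metric.sphere (0 : Coord d) 1,
      (∫⁻ r, F (T (Real.tanh (r / 2) • (w : Coord d))) ∂(radMeas (d - 1) R))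
      ∂(volume : Measure (Coord d)).toSphere := by
  have hG : Measurable fun y => ENNReal.ofReal (conf y ^ d) * F (T y) :=
    (ENNReal.measurable_ofReal.comp (measurable_conf.pow_const d)).mul (hF.comp h.meas)
  rw [h.lintegral_hball_eq, lintegral_ball_polar hd _ hG]
  refine lintegral_congr fun w => ?_
  rw [← image_tanh_half, lintegral_image_eq_lintegral_abs_deriv_mul measurableSet_Ioo
    (fun r _ => (hasDerivAt_tanh_half r).hasDerivWithinAt), radMeas,
    lintegral_withDensity_eq_lintegral_mul_non_measurable₀ _ (measurable_sinh_pow _).aemeasurable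
    (.of_forall fun _ => ENNReal.ofReal_lt_top)]
  · refine setLIntegral_congr_fun measurableSet_Ioo fun r hr => ?_
    have hc := Real.cosh_pos (r / 2)
    have ht := tanh_half_pos hr.1
    simp only [Pi.mul_apply]
    rw [← mul_assoc, ← mul_assoc, ← ENNReal.ofReal_mul (abs_nonneg _),
      ← ENNReal.ofReal_mul (by positivity), conf_tanh_smul, abs_of_pos (by positivity)]
    congr 2
    obtain ⟨k, rfl⟩ : ∃ k, d = k + 1 := ⟨d - 1, by omega⟩
    have hs : Real.sinh r = Real.tanh (r / 2) * (2 * Real.cosh (r / 2) ^ 2) := by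
      have := Real.sinh_two_mul (r / 2)
      rw [mul_div_cancel₀ _ two_ne_zero] at this
      rw [this, Real.tanh_eq_sinh_div_cosh]
      field_simp
    rw [Nat.add_sub_cancel, hs, mul_pow, pow_succ]
    field_simp
    ring
  · intro a _ b _ hab
    have := tanh_strictMono.injective hab
    linarith

end Geometry

/-! ### Gradient of the distance function and geodesic rays. -/

section Gradient

variable {d : ℕ}

theorem hasDerivAt_two_arsinh {t : ℝ} (h0 : 0 ≤ t) (h1 : t < 1) :
    HasDerivAt (fun t : ℝ => 2 * Real.arsinh (t / √(1 - t ^ 2))) (2 / (1 - t ^ 2)) t := by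
  have hp : 0 < 1 - t ^ 2 := by nlinarith
  have hs := Real.sqrt_pos.2 hp
  have hsq := Real.sq_sqrt hp.le
  have hd : HasDerivAt (fun t : ℝ => 1 - t ^ 2) (-(2 * t)) t := by
    simpa using ((hasDerivAt_id t).pow 2).const_sub 1
  have h := (((hasDerivAt_id t).div (hd.sqrt hp.ne') hs.ne').arsinh).const_mul 2
  convert! h using 1
  have e : 1 + (t / √(1 - t ^ 2)) ^ 2 = (1 / √(1 - t ^ 2)) ^ 2 := by
    rw [div_pow, div_pow, hsq]
    field_simp
    ring
  simp only [id, smul_eq_mul, Pi.div_apply]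
  rw [e, Real.sqrt_sq (by positivity), hsq]
  field_simp
  rw [hsq]
  ring

theorem hasFDerivAt_norm_of_ne_zero {y : Coord d} (hy : y ≠ 0) :
    HasFDerivAt (fun y : Coord d => ‖y‖) (innerSL ℝ (‖y‖⁻¹ • y)) y := by
  have h := ((hasStrictFDerivAt_norm_sq y).hasFDerivAt.sqrt (pow_ne_zero 2 (norm_ne_zero_iff.2 hy)))
  have hn := norm_ne_zero_iff.2 hy
  convert! h using 1
  · ext z
    exact (Real.sqrt_sq (norm_nonneg z)).symm
  · ext z
    rw [Real.sqrt_sq (norm_nonneg y)]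
    simp
    field_simp

theorem hasFDerivAt_hdist_zero {y : Coord d} (hy : y ∈ poincareBall d) (h0 : y ≠ 0) :
    HasFDerivAt (hdist (0 : Coord d)) (conf y • innerSL ℝ (‖y‖⁻¹ • y)) y := by
  have h := (hasDerivAt_two_arsinh (norm_nonneg y) (mem_poincareBall.1 hy)).comp_hasFDerivAt y
    (hasFDerivAt_norm_of_ne_zero h0)
  convert! h using 1
  ext z
  simp [hdist]

/-- The Euclidean gradient of the hyperbolic distance from `o`. -/
def distGrad (o x : Coord d) : Coord d := gradient (hdist o) x

theorem measurable_distGrad (o : Coord d) : Measurable (distGrad o) :=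
  (InnerProductSpace.toDual ℝ (Coord d)).symm.continuous.measurable.comp
    (measurable_fderiv ℝ (hdist o))

variable {o : Coord d} {T : Coord d → Coord d}

theorem IsHypSwap.eq_zero_iff (h : IsHypSwap o T) {x : Coord d} (hx : x ∈ poincareBall d) :
    T x = 0 ↔ x = o := by
  constructor
  · intro h0
    rw [← h.invol x hx, h0, h.zero]
  · rintro rfl
    have := h.invol 0 zero_mem_poincareBall
    rwa [h.zero] at this

theorem IsHypSwap.hdist_eq (h : IsHypSwap o T) {x : Coord d} (hx : x ∈ poincareBall d) :
    hdist o x = hdist 0 (T x) := by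
  rw [← h.dist _ (h.mapsTo x hx), h.invol x hx]

/-- The norm identity is the eikonal equation. The swap reduces it to the centre 0, where the
gradient at T x has length `conf (T x)`; the derivative of T is an isometry times `conf x / conf (T
x)`, and `conf (T x)` cancels. -/
theorem hasFDerivAt_hdist (ho : o ∈ poincareBall d) {x : Coord d} (hx : x ∈ poincareBall d)
    (hxo : x ≠ o) :
    HasFDerivAt (hdist o) (innerSL ℝ (distGrad o x)) x ∧ ‖distGrad o x‖ = conf x := by
  obtain ⟨T, h⟩ := exists_isHypSwap ho
  obtain ⟨L, hL⟩ := h.deriv x hx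
  have hT0 : T x ≠ 0 := fun h0 => hxo ((h.eq_zero_iff hx).1 h0)
  have hc1 := conf_pos hx
  have hc2 := conf_pos (h.mapsTo x hx)
  have h1 := (hasFDerivAt_hdist_zero (h.mapsTo x hx) hT0).comp x hL
  have h2 : HasFDerivAt (hdist o) (innerSL ℝ (conf x • L.symm (‖T x‖⁻¹ • T x))) x := by
    refine (h1.congr_of_eventuallyEq ?_).congr_fderiv ?_
    · filter_upwards [isOpen_poincareBall.mem_nhds hx] with z hz
      exact h.hdist_eq hz
    · ext z
      simp only [ContinuousLinearMap.comp_apply, smul_apply, innerSL_apply_apply, smul_eq_mul,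
        map_smul]
      have : inner ℝ (L.symm (T x)) z = inner ℝ (T x) (L z) := by
        rw [← L.inner_map_map, L.apply_symm_apply]
      rw [this]
      change conf x / conf (T x) * (conf (T x) * (‖T x‖⁻¹ * inner ℝ (T x) (L z))) = _
      field_simp
  have e : distGrad o x = conf x • L.symm (‖T x‖⁻¹ • T x) := by
    refine HasGradientAt.gradient (hasGradientAt_iff_hasFDerivAt.2 ?_)
    exact h2
  rw [e]
  refine ⟨h2, ?_⟩
  rw [norm_smul, L.symm.norm_map, norm_smul, norm_inv, norm_norm,
    inv_mul_cancel₀ (norm_ne_zero_iff.2 hT0), mul_one, Real.norm_of_nonneg hc1.le]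

theorem IsHypSwap.continuousOn (h : IsHypSwap o T) : ContinuousOn T (poincareBall d) := by
  intro y hy
  obtain ⟨L, hL⟩ := h.deriv y hy
  exact hL.continuousAt.continuousWithinAt

theorem isOpen_hball (ho : o ∈ poincareBall d) (R : ℝ) : IsOpen (hball o R) := by
  obtain ⟨T, h⟩ := exists_isHypSwap ho
  have : hball o R = poincareBall d ∩ T ⁻¹' Metric.ball 0 (Real.tanh (R / 2)) := by
    ext x
    refine and_congr_right fun hx => ?_
    rw [h.hdist_eq hx, hdist_zero_lt_iff (h.mapsTo x hx)]
    simp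
  rw [this]
  exact h.continuousOn.isOpen_inter_preimage isOpen_poincareBall Metric.isOpen_ball

theorem isCompact_closed_hball (ho : o ∈ poincareBall d) (R : ℝ) :
    IsCompact {x | x ∈ poincareBall d ∧ hdist o x ≤ R} := by
  obtain ⟨T, h⟩ := exists_isHypSwap ho
  have hle : ∀ y ∈ poincareBall d, hdist 0 y ≤ R ↔ ‖y‖ ≤ Real.tanh (R / 2) := by
    intro y hy
    rw [← tanh_half_hdist_zero hy, tanh_strictMono.le_iff_le]
    constructor <;> intro h <;> linarith
  have hsub : Metric.closedBall (0 : Coord d) (Real.tanh (R / 2)) ⊆ poincareBall d :=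
    Metric.closedBall_subset_ball (Real.tanh_lt_one _)
  have : {x | x ∈ poincareBall d ∧ hdist o x ≤ R} =
      T '' Metric.closedBall 0 (Real.tanh (R / 2)) := by
    ext x
    constructor
    · rintro ⟨hx, hR⟩
      refine ⟨T x, ?_, h.invol x hx⟩
      rw [h.hdist_eq hx, hle _ (h.mapsTo x hx)] at hR
      simpa using hR
    · rintro ⟨y, hy, rfl⟩
      refine ⟨h.mapsTo y (hsub hy), ?_⟩
      rw [h.dist y (hsub hy), hle y (hsub hy)]
      simpa using hy
  rw [this]
  exact (isCompact_closedBall _ _).image_of_continuousOn (h.continuousOn.mono hsub)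

theorem contDiffAt_hdist (ho : o ∈ poincareBall d) {x : Coord d} (hx : x ∈ poincareBall d)
    (hxo : x ≠ o) : ContDiffAt ℝ ∞ (hdist o) x := by
  have h1 := mul_pos (one_sub_norm_sq_pos ho) (one_sub_norm_sq_pos hx)
  have h2 : ContDiffAt ℝ ∞ (fun x : Coord d => (1 - ‖o‖ ^ 2) * (1 - ‖x‖ ^ 2)) x :=
    contDiffAt_const.mul (contDiffAt_const.sub (contDiff_norm_sq ℝ).contDiffAt)
  have h3 : ContDiffAt ℝ ∞ (fun x : Coord d => ‖o - x‖) x :=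
    (contDiffAt_const.sub contDiffAt_id).norm ℝ (sub_ne_zero.2 hxo.symm)
  exact contDiffAt_const.mul ((h3.div (h2.sqrt h1.ne') (Real.sqrt_pos.2 h1).ne').arsinh)

theorem IsHypSwap.hdist_polar (h : IsHypSwap o T) {r : ℝ} (hr : 0 ≤ r)
    (w : Metric.sphere (0 : Coord d) 1) : hdist o (T (Real.tanh (r / 2) • (w : Coord d))) = r := by
  rw [h.dist _ (tanh_smul_mem r w)]
  have h1 := tanh_half_hdist_zero (tanh_smul_mem r w)
  have h2 : 0 ≤ Real.tanh (r / 2) := by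
    rw [← Real.tanh_zero]
    exact tanh_strictMono.monotone (by linarith)
  rw [norm_smul, norm_eq_of_mem_sphere, mul_one, Real.norm_of_nonneg h2] at h1
  have := tanh_strictMono.injective h1
  linarith

theorem IsHypSwap.polar_mem (h : IsHypSwap o T) {r R : ℝ} (hr : 0 ≤ r) (hR : r < R)
    (w : Metric.sphere (0 : Coord d) 1) : T (Real.tanh (r / 2) • (w : Coord d)) ∈ hball o R :=
  ⟨h.mapsTo _ (tanh_smul_mem r w), by rwa [h.hdist_polar hr w]⟩

theorem IsHypSwap.polar_ne (h : IsHypSwap o T) {r : ℝ} (hr : 0 < r)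
    (w : Metric.sphere (0 : Coord d) 1) : T (Real.tanh (r / 2) • (w : Coord d)) ≠ o := by
  intro e
  have := h.hdist_polar hr.le w
  rw [e, hdist_self] at this
  exact hr.ne this

/-- The images of radii under T are unit speed rays from o. The velocity has Euclidean length 1 /
conf, the gradient of the distance has length conf, and their inner product is 1 because the
distance along the ray is r. Equality in Cauchy–Schwarz makes the two vectors parallel. -/
theorem IsHypSwap.hasDerivAt_polar (h : IsHypSwap o T) (ho : o ∈ poincareBall d) {r : ℝ}
    (hr : 0 < r) (w : Metric.sphere (0 : Coord d) 1) :
    HasDerivAt (fun r => T (Real.tanh (r / 2) • (w : Coord d)))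
      ((conf (T (Real.tanh (r / 2) • (w : Coord d))) ^ 2)⁻¹ •
        distGrad o (T (Real.tanh (r / 2) • (w : Coord d)))) r := by
  set x := T (Real.tanh (r / 2) • (w : Coord d)) with hx
  have hmem := tanh_smul_mem r w
  have hxm : x ∈ poincareBall d := h.mapsTo _ hmem
  obtain ⟨L, hL⟩ := h.deriv _ hmem
  obtain ⟨hg, hgn⟩ := hasFDerivAt_hdist ho hxm (h.polar_ne hr w)
  have hc := conf_pos hxm
  have h1 := hL.comp_hasDerivAt r ((hasDerivAt_tanh_half r).smul_const (w : Coord d))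
  rw [← hx] at h1
  set v := ((conf (Real.tanh (r / 2) • (w : Coord d)) / conf x) • (L : Coord d →L[ℝ] Coord d))
    ((1 / (2 * Real.cosh (r / 2) ^ 2)) • (w : Coord d)) with hv
  have hcosh := Real.cosh_pos (r / 2)
  have hvn : ‖v‖ = (conf x)⁻¹ := by
    rw [hv, smul_apply, norm_smul]
    have : ‖(L : Coord d →L[ℝ] Coord d) ((1 / (2 * Real.cosh (r / 2) ^ 2)) • (w : Coord d))‖ =
        1 / (2 * Real.cosh (r / 2) ^ 2) := by
      change ‖L _‖ = _
      rw [L.norm_map, norm_smul, norm_eq_of_mem_sphere, mul_one, Real.norm_of_nonneg (by positivity)]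
    rw [this, conf_tanh_smul, Real.norm_of_nonneg (by positivity)]
    field_simp
  have h2 : inner ℝ (distGrad o x) v = 1 := by
    have h3 := hg.comp_hasDerivAt r h1
    have h4 : HasDerivAt (fun r => r) 1 r := hasDerivAt_id r
    have h5 := h4.congr_of_eventuallyEq (f₁ := hdist o ∘
      T ∘ fun r => Real.tanh (r / 2) • (w : Coord d)) ?_
    · exact h3.unique h5
    · filter_upwards [eventually_gt_nhds hr] with s hs
      exact h.hdist_polar hs.le w
  have h6 : v = (conf x ^ 2)⁻¹ • distGrad o x := by
    rw [← sub_eq_zero, ← norm_eq_zero, ← sq_eq_zero_iff, norm_sub_sq_real, inner_smul_right,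
      real_inner_comm, h2, hvn, norm_smul, hgn, Real.norm_of_nonneg (by positivity)]
    field_simp
    ring
  rw [← h6]
  exact h1

theorem lintegral_comp_hdist (ho : o ∈ poincareBall d) (hd : 0 < d) (R : ℝ) {F : ℝ → ℝ≥0∞}
    (hF : Measurable F) :
    ∫⁻ x in hball o R, F (hdist o x) ∂(hvol d) =
      (volume : Measure (Coord d)).toSphere univ * ∫⁻ r, F r ∂(radMeas (d - 1) R) := by
  obtain ⟨T, h⟩ := exists_isHypSwap ho
  refine (h.lintegral_polar hd R (hF.comp (measurable_hdist o))).trans ?_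
  have : ∀ w : Metric.sphere (0 : Coord d) 1, ∫⁻ r, (F ∘ hdist o)
      (T (Real.tanh (r / 2) • (w : Coord d))) ∂(radMeas (d - 1) R) =
      ∫⁻ r, F r ∂(radMeas (d - 1) R) := fun w =>
    lintegral_congr_ae (ae_radMeas_of_forall fun r hr => by
      simp only [Function.comp_apply, h.hdist_polar hr.1.le w])
  simp_rw [this, lintegral_const]
  rw [mul_comm]

theorem map_hdist (ho : o ∈ poincareBall d) (hd : 0 < d) (R : ℝ) :
    ((hvol d).restrict (hball o R)).map (hdist o) =
      (volume : Measure (Coord d)).toSphere univ • radMeas (d - 1) R := by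
  refine Measure.ext_of_lintegral _ fun F hF => ?_
  rw [lintegral_map hF (measurable_hdist o), lintegral_comp_hdist ho hd R hF, lintegral_smul_measure]
  rfl

theorem quasiMeasurePreserving_hdist (ho : o ∈ poincareBall d) (hd : 0 < d) (R : ℝ) :
    Measure.QuasiMeasurePreserving (hdist o) ((hvol d).restrict (hball o R))
      (radMeas (d - 1) R) := by
  refine ⟨measurable_hdist o, ?_⟩
  rw [map_hdist ho hd]
  exact Measure.smul_absolutelyContinuous

theorem hvol_hball_lt_top (ho : o ∈ poincareBall d) (hd : 0 < d) (R : ℝ) :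
    hvol d (hball o R) < ⊤ := by
  have h := lintegral_comp_hdist ho hd R (F := fun _ => 1) measurable_const
  simp only [lintegral_const, Measure.restrict_apply_univ, one_mul] at h
  rw [h]
  exact ENNReal.mul_lt_top (measure_lt_top _ _) (measure_lt_top _ _)

theorem hvol_absolutelyContinuous : hvol d ≪ volume :=
  (withDensity_absolutelyContinuous _ _).trans Measure.absolutelyContinuous_restrict

theorem hvol_restrict_absolutelyContinuous (U : Set (Coord d)) :
    (hvol d).restrict U ≪ volume.restrict U :=
  hvol_absolutelyContinuous.restrict U

/-- The density of the hyperbolic volume is at least 1. Null sets and L² bounds thus pass to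
Lebesgue measure, with respect to which weak differentials are defined. -/
theorem volume_restrict_le (o : Coord d) (R : ℝ) :
    (volume : Measure (Coord d)).restrict (hball o R) ≤ (hvol d).restrict (hball o R) := by
  refine Measure.le_iff.2 fun s hs => ?_
  rw [← lintegral_indicator_one hs, ← lintegral_indicator_one hs, lintegral_hball]
  refine setLIntegral_mono' (measurableSet_hball o R) fun x hx => ?_
  refine le_mul_of_one_le_left' ?_
  rw [ENNReal.one_le_ofReal]
  exact one_le_pow₀ (by linarith [two_le_conf hx.1])

theorem ae_hball (hd : 0 < d) (o : Coord d) (R : ℝ) :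
    ∀ᵐ x ∂((hvol d).restrict (hball o R)), x ∈ hball o R ∧ x ≠ o := by
  have : NeZero d := ⟨hd.ne'⟩
  have h1 : ∀ᵐ x ∂((hvol d).restrict (hball o R)), x ∈ hball o R :=
    ae_restrict_mem (measurableSet_hball o R)
  have h2 : ∀ᵐ x ∂((hvol d).restrict (hball o R)), x ≠ o := by
    refine ae_restrict_of_ae (hvol_absolutelyContinuous ?_)
    simp
  exact h1.and h2

end Gradient

/-! ### Calculus of weak differentials. -/

section Weak

variable {d : ℕ} {U : Set (Coord d)}

theorem IsTestFunction.continuous_pderiv {F : Type*} [NormedAddCommGroup F] [NormedSpace ℝ F]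
    {ψ : Coord d → F} (h : IsTestFunction U ψ) (i : Fin d) : Continuous (pderiv i ψ) :=
  (h.1.continuous_fderiv (by simp)).clm_apply continuous_const

theorem tsupport_pderiv_subset {F : Type*} [NormedAddCommGroup F] [NormedSpace ℝ F]
    (ψ : Coord d → F) (i : Fin d) : tsupport (pderiv i ψ) ⊆ tsupport ψ := by
  refine (closure_mono fun x hx => ?_).trans (tsupport_fderiv_subset ℝ (f := ψ))
  intro h0
  apply hx
  simp [pderiv, h0]

theorem IsTestFunction.hasCompactSupport_pderiv {F : Type*} [NormedAddCommGroup F]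
    [NormedSpace ℝ F] {ψ : Coord d → F} (h : IsTestFunction U ψ) (i : Fin d) :
    HasCompactSupport (pderiv i ψ) :=
  IsCompact.of_isClosed_subset h.2.1 (isClosed_tsupport _) (tsupport_pderiv_subset ψ i)

theorem integrableOn_smul_of_tsupport_subset {F : Type*} [NormedAddCommGroup F] [NormedSpace ℝ F]
    {u : Coord d → F} (hu : LocallyIntegrableOn u U volume) {g : Coord d → ℝ} (hg : Continuous g)
    (hc : HasCompactSupport g) (hs : tsupport g ⊆ U) :
    Integrable (fun x => g x • u x) := by
  have h1 : IntegrableOn u (tsupport g) := hu.integrableOn_compact_subset hs hc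
  obtain ⟨C, hC⟩ := hc.exists_bound_of_continuous hg
  have h2 : IntegrableOn (fun x => g x • u x) (tsupport g) :=
    h1.bdd_smul C hg.aestronglyMeasurable (.of_forall hC)
  exact (integrableOn_iff_integrable_of_support_subset ((Function.support_smul_subset_left g u).trans
    (subset_tsupport g))).1 h2

theorem setIntegral_smul_of_tsupport_subset {F : Type*} [NormedAddCommGroup F] [NormedSpace ℝ F]
    (u : Coord d → F) {g : Coord d → ℝ} (hs : tsupport g ⊆ U) :
    ∫ x in U, g x • u x = ∫ x, g x • u x :=
  setIntegral_eq_integral_of_forall_compl_eq_zero fun x hx => by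
    rw [image_eq_zero_of_notMem_tsupport fun h => hx (hs h), zero_smul]

theorem locallyIntegrableOn_component {G : Coord d → EuclideanSpace ℂ (Fin d)}
    (h : LocallyIntegrableOn G U volume) (i : Fin d) :
    LocallyIntegrableOn (fun x => G x i) U volume := fun x hx => by
  obtain ⟨s, hs, hi⟩ := h x hx
  exact ⟨s, hs, (EuclideanSpace.proj (𝕜 := ℂ) i).integrable_comp hi⟩

theorem isWeakDifferential_iff {u : Coord d → ℂ} {G : Coord d → EuclideanSpace ℂ (Fin d)} :
    IsWeakDifferential U u G ↔ LocallyIntegrableOn u U volume ∧ LocallyIntegrableOn G U volume ∧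
      ∀ ψ : Coord d → ℝ, IsTestFunction U ψ → ∀ i : Fin d,
        ∫ x, pderiv i ψ x • u x = - ∫ x, ψ x • G x i := by
  refine and_congr_right fun _ => and_congr_right fun _ => forall_congr' fun ψ =>
    forall_congr' fun hψ => forall_congr' fun i => ?_
  rw [← setIntegral_smul_of_tsupport_subset u ((tsupport_pderiv_subset ψ i).trans hψ.2.2),
    ← setIntegral_smul_of_tsupport_subset (fun x => G x i) hψ.2.2]
  simp only [Complex.real_smul]

theorem IsWeakDifferential.add {u v : Coord d → ℂ} {G K : Coord d → EuclideanSpace ℂ (Fin d)}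
    (hu : IsWeakDifferential U u G) (hv : IsWeakDifferential U v K) :
    IsWeakDifferential U (fun x => u x + v x) (fun x => G x + K x) := by
  rw [isWeakDifferential_iff] at *
  refine ⟨hu.1.add hv.1, hu.2.1.add hv.2.1, fun ψ hψ i => ?_⟩
  have hs := (tsupport_pderiv_subset ψ i).trans hψ.2.2
  simp only [smul_add, PiLp.add_apply]
  rw [integral_add (integrableOn_smul_of_tsupport_subset hu.1 (hψ.continuous_pderiv i)
      (hψ.hasCompactSupport_pderiv i) hs)
    (integrableOn_smul_of_tsupport_subset hv.1 (hψ.continuous_pderiv i)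
      (hψ.hasCompactSupport_pderiv i) hs),
    integral_add (integrableOn_smul_of_tsupport_subset (locallyIntegrableOn_component hu.2.1 i) hψ.1.continuous
      hψ.2.1 hψ.2.2)
    (integrableOn_smul_of_tsupport_subset (locallyIntegrableOn_component hv.2.1 i) hψ.1.continuous
      hψ.2.1 hψ.2.2), hu.2.2 ψ hψ i, hv.2.2 ψ hψ i]
  ring

theorem IsWeakDifferential.const_mul {u : Coord d → ℂ} {G : Coord d → EuclideanSpace ℂ (Fin d)}
    (hu : IsWeakDifferential U u G) (c : ℂ) :
    IsWeakDifferential U (fun x => c * u x) (fun x => c • G x) := by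
  rw [isWeakDifferential_iff] at *
  refine ⟨hu.1.smul c, hu.2.1.smul c, fun ψ hψ i => ?_⟩
  have e1 : ∀ x, pderiv i ψ x • (c * u x) = c * (pderiv i ψ x • u x) := fun x =>
    mul_smul_comm _ _ _ |>.symm
  have e2 : ∀ x, ψ x • (c • G x) i = c * (ψ x • G x i) := fun x => by
    rw [PiLp.smul_apply, smul_eq_mul, mul_smul_comm]
  simp_rw [e1, e2]
  rw [integral_const_mul, integral_const_mul, hu.2.2 ψ hψ i, mul_neg]

theorem IsWeakDifferential.sub {u v : Coord d → ℂ} {G K : Coord d → EuclideanSpace ℂ (Fin d)}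
    (hu : IsWeakDifferential U u G) (hv : IsWeakDifferential U v K) :
    IsWeakDifferential U (fun x => u x - v x) (fun x => G x - K x) := by
  have := hu.add (hv.const_mul (-1))
  simpa [sub_eq_add_neg] using this

/-- Integration by parts here needs differentiability at every point and integrability of the
products with test functions, but no continuity of the derivative. -/
theorem isWeakDifferential_of_hasFDerivAt {u : Coord d → ℂ}
    {G : Coord d → EuclideanSpace ℂ (Fin d)} {u' : Coord d → Coord d →L[ℝ] ℂ}
    (hu : LocallyIntegrableOn u U volume) (hG : LocallyIntegrableOn G U volume)
    (hd : ∀ x ∈ U, HasFDerivAt u (u' x) x)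
    (he : ∀ x ∈ U, ∀ i, G x i = u' x (EuclideanSpace.single i 1)) :
    IsWeakDifferential U u G := by
  rw [isWeakDifferential_iff]
  refine ⟨hu, hG, fun ψ hψ i => ?_⟩
  have hs := (tsupport_pderiv_subset ψ i).trans hψ.2.2
  have e : ∀ x, ψ x • G x i = ψ x • u' x (EuclideanSpace.single i 1) := fun x => by
    by_cases hx : x ∈ tsupport ψ
    · rw [he x (hψ.2.2 hx)]
    · rw [image_eq_zero_of_notMem_tsupport hx, zero_smul, zero_smul]
  have i1 := integrableOn_smul_of_tsupport_subset (locallyIntegrableOn_component hG i) hψ.1.continuous hψ.2.1 hψ.2.2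
  simp_rw [e] at i1 ⊢
  have h := integral_bilinear_hasFDerivAt_right_eq_neg_left_of_integrable (μ := volume)
    (B := ContinuousLinearMap.lsmul ℝ ℝ (E := ℂ)) (f := ψ) (f' := fderiv ℝ ψ) (g := u) (g' := u')
    (v := EuclideanSpace.single i 1)
    (integrableOn_smul_of_tsupport_subset hu (hψ.continuous_pderiv i)
      (hψ.hasCompactSupport_pderiv i) hs) i1
    (integrableOn_smul_of_tsupport_subset hu hψ.1.continuous hψ.2.1 hψ.2.2)
    (fun x _ => (hψ.1.differentiable (by simp) x).hasFDerivAt) (fun x hx => hd x (hψ.2.2 hx))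
  simp only [ContinuousLinearMap.lsmul_apply] at h
  rw [h, neg_neg]
  rfl

theorem locallyIntegrableOn_const (c : ℂ) :
    LocallyIntegrableOn (fun _ : Coord d => c) U volume :=
  (continuous_const.locallyIntegrable).locallyIntegrableOn U

theorem isWeakDifferential_const (c : ℂ) :
    IsWeakDifferential U (fun _ : Coord d => c) (fun _ => 0) :=
  isWeakDifferential_of_hasFDerivAt (locallyIntegrableOn_const c)
    (continuous_const.locallyIntegrable.locallyIntegrableOn U)
    (fun x _ => hasFDerivAt_const c x) (fun _ _ _ => rfl)

theorem IsWeakDifferential.ae_unique (hU : IsOpen U) {u : Coord d → ℂ}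
    {G K : Coord d → EuclideanSpace ℂ (Fin d)}
    (hG : IsWeakDifferential U u G) (hK : IsWeakDifferential U u K) :
    G =ᵐ[volume.restrict U] K := by
  rw [isWeakDifferential_iff] at hG hK
  have h : ∀ i, ∀ᵐ x ∂(volume : Measure (Coord d)), x ∈ U → G x i - K x i = 0 := by
    intro i
    refine hU.ae_eq_zero_of_integral_contDiff_smul_eq_zero
      ((locallyIntegrableOn_component hG.2.1 i).sub
        (locallyIntegrableOn_component hK.2.1 i)) fun ψ h1 h2 h3 => ?_
    have hψ : IsTestFunction U ψ := ⟨h1, h2, h3⟩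
    have e := (hG.2.2 ψ hψ i).symm.trans (hK.2.2 ψ hψ i)
    simp only [smul_sub]
    rw [integral_sub (integrableOn_smul_of_tsupport_subset (locallyIntegrableOn_component hG.2.1 i)
      h1.continuous h2 h3) (integrableOn_smul_of_tsupport_subset
      (locallyIntegrableOn_component hK.2.1 i) h1.continuous h2 h3), neg_inj.1 e, sub_self]
  rw [Filter.EventuallyEq, ae_restrict_iff' hU.measurableSet]
  filter_upwards [ae_all_iff.2 h] with x hx hxU
  ext i
  exact sub_eq_zero.1 (hx i hxU)

/-- The energy is defined through a chosen weak differential; uniqueness allows it to be computed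
with any explicit one. -/
theorem IsWeakDifferential.weakDifferential_ae (hU : IsOpen U) {u : Coord d → ℂ}
    {G : Coord d → EuclideanSpace ℂ (Fin d)} (h : IsWeakDifferential U u G) :
    weakDifferential U u =ᵐ[volume.restrict U] G := by
  have hex : ∃ G, IsWeakDifferential U u G := ⟨G, h⟩
  rw [weakDifferential, dif_pos hex]
  exact (Classical.choose_spec hex).ae_unique hU h

/-- Test functions and their derivatives are bounded, so the defining identity already passes to L¹
limits. -/
theorem isWeakDifferential_of_tendsto {u : Coord d → ℂ} {G : Coord d → EuclideanSpace ℂ (Fin d)}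
    {v : ℕ → Coord d → ℂ} {K : ℕ → Coord d → EuclideanSpace ℂ (Fin d)}
    (hu : LocallyIntegrableOn u U volume) (hG : LocallyIntegrableOn G U volume)
    (h : ∀ n, IsWeakDifferential U (v n) (K n))
    (h1 : Tendsto (fun n => ∫⁻ x in U, ‖v n x - u x‖ₑ) atTop (𝓝 0))
    (h2 : Tendsto (fun n => ∫⁻ x in U, ‖K n x - G x‖ₑ) atTop (𝓝 0)) :
    IsWeakDifferential U u G := by
  have key : ∀ {w : Coord d → ℂ} {W : ℕ → Coord d → ℂ} {g : Coord d → ℝ},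
      LocallyIntegrableOn w U volume → (∀ n, LocallyIntegrableOn (W n) U volume) →
      Continuous g → HasCompactSupport g → tsupport g ⊆ U →
      Tendsto (fun n => ∫⁻ x in U, ‖W n x - w x‖ₑ) atTop (𝓝 0) →
      Tendsto (fun n => ∫ x, g x • W n x) atTop (𝓝 (∫ x, g x • w x)) := by
    intro w W g hw hW hg hc hs ht
    refine tendsto_integral_of_L1 _ (integrableOn_smul_of_tsupport_subset hw hg hc hs).1
      (.of_forall fun n => integrableOn_smul_of_tsupport_subset (hW n) hg hc hs) ?_
    obtain ⟨C, hC⟩ := hc.exists_bound_of_continuous hg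
    have hle : ∀ n, ∫⁻ x, ‖g x • W n x - g x • w x‖ₑ ≤
        ENNReal.ofReal C * ∫⁻ x in U, ‖W n x - w x‖ₑ := by
      intro n
      rw [← lintegral_const_mul' _ _ ENNReal.ofReal_ne_top]
      rw [← setLIntegral_eq_of_support_subset (s := U)]
      · refine lintegral_mono fun x => ?_
        rw [← smul_sub, enorm_smul]
        gcongr
        rw [← ofReal_norm]
        exact ENNReal.ofReal_le_ofReal (hC x)
      · intro x hx
        by_contra hxU
        apply hx
        have : g x = 0 := image_eq_zero_of_notMem_tsupport fun h => hxU (hs h)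
        simp [this]
    refine tendsto_of_tendsto_of_tendsto_of_le_of_le tendsto_const_nhds ?_ (fun _ => zero_le) hle
    simpa using ENNReal.Tendsto.const_mul ht (Or.inr ENNReal.ofReal_ne_top)
  rw [isWeakDifferential_iff]
  refine ⟨hu, hG, fun ψ hψ i => ?_⟩
  have t1 := key hu (fun n => (h n).1) (hψ.continuous_pderiv i) (hψ.hasCompactSupport_pderiv i)
    ((tsupport_pderiv_subset ψ i).trans hψ.2.2) h1
  have t2 := key (locallyIntegrableOn_component hG i) (fun n => locallyIntegrableOn_component (h n).2.1 i) hψ.1.continuous hψ.2.1 hψ.2.2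
    (W := fun n x => K n x i) (tendsto_of_tendsto_of_tendsto_of_le_of_le tendsto_const_nhds h2
      (fun _ => zero_le) fun n => lintegral_mono fun x => by
        have := PiLp.enorm_apply_le (K n x - G x) i
        simpa using this)
  refine tendsto_nhds_unique t1 ?_
  simp_rw [fun n => (isWeakDifferential_iff.1 (h n)).2.2 ψ hψ i]
  exact t2.neg

end Weak

/-! ### The spaces H¹ and H¹₀ on a hyperbolic ball. -/

section Sobolev

variable {d : ℕ} {o : Coord d} {R : ℝ}

/-- The quadratic energy `∫ (μ |∇u|² + W(d(o,x)) |u|²)` of a function `u` with differential `G` on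
the ball `B_R(o)`. -/
def quadE (μ : ℝ) (W : ℝ → ℝ) (o : Coord d) (R : ℝ) (u : Coord d → ℂ)
    (G : Coord d → EuclideanSpace ℂ (Fin d)) : ℝ≥0∞ :=
  ∫⁻ x in hball o R,
    ENNReal.ofReal (μ * (‖G x‖ ^ 2 / conf x ^ 2) + W (hdist o x) * ‖u x‖ ^ 2) ∂(hvol d)

theorem IsWeakDifferential.ae_hvol (ho : o ∈ poincareBall d) {u : Coord d → ℂ}
    {G : Coord d → EuclideanSpace ℂ (Fin d)} (h : IsWeakDifferential (hball o R) u G) :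
    weakDifferential (hball o R) u =ᵐ[(hvol d).restrict (hball o R)] G :=
  hvol_restrict_absolutelyContinuous _ (h.weakDifferential_ae (isOpen_hball ho R))

theorem h1NormSq_eq (ho : o ∈ poincareBall d) {u : Coord d → ℂ}
    {G : Coord d → EuclideanSpace ℂ (Fin d)} (h : IsWeakDifferential (hball o R) u G) :
    h1NormSq (hball o R) u = quadE 1 (fun _ => 1) o R u G :=
  lintegral_congr_ae (by
    filter_upwards [h.ae_hvol ho] with x hx
    rw [gradSq, hx, one_mul, one_mul])

theorem energy_eq (ho : o ∈ poincareBall d) (μ : ℝ) (V : ℝ → ℝ) {u : Coord d → ℂ}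
    {G : Coord d → EuclideanSpace ℂ (Fin d)} (h : IsWeakDifferential (hball o R) u G) :
    energy μ V o R u = quadE μ (fun r => 1 / 2 * V r) o R u G :=
  lintegral_congr_ae (by
    filter_upwards [h.ae_hvol ho] with x hx
    rw [gradSq, hx])

theorem IsWeakDifferential.aestronglyMeasurable {u : Coord d → ℂ}
    {G : Coord d → EuclideanSpace ℂ (Fin d)} (h : IsWeakDifferential (hball o R) u G) :
    AEStronglyMeasurable u ((hvol d).restrict (hball o R)) ∧
      AEStronglyMeasurable G ((hvol d).restrict (hball o R)) :=
  ⟨h.1.aestronglyMeasurable.mono_ac (hvol_restrict_absolutelyContinuous _),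
    h.2.1.aestronglyMeasurable.mono_ac (hvol_restrict_absolutelyContinuous _)⟩

theorem aemeasurable_density {ν : Measure (Coord d)} (μ : ℝ) {W : ℝ → ℝ} (hW : Measurable W)
    {u : Coord d → ℂ} {G : Coord d → EuclideanSpace ℂ (Fin d)} (hu : AEStronglyMeasurable u ν)
    (hG : AEStronglyMeasurable G ν) : AEMeasurable (fun x => ENNReal.ofReal
      (μ * (‖G x‖ ^ 2 / conf x ^ 2) + W (hdist o x) * ‖u x‖ ^ 2)) ν := by
  have h1 := hu.norm.aemeasurable
  have h2 := hG.norm.aemeasurable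
  have h3 := (measurable_conf (d := d)).aemeasurable (μ := ν)
  have h4 := (hW.comp (measurable_hdist o)).aemeasurable (μ := ν)
  exact (((h2.pow_const 2).div (h3.pow_const 2)).const_mul μ |>.add
    (h4.mul (h1.pow_const 2))).ennreal_ofReal

variable {μ : ℝ} {W : ℝ → ℝ}

theorem density_nonneg (hμ : 0 ≤ μ) (hW0 : ∀ r, 0 ≤ r → 0 ≤ W r) (u : Coord d → ℂ)
    (G : Coord d → EuclideanSpace ℂ (Fin d)) (x : Coord d) :
    0 ≤ μ * (‖G x‖ ^ 2 / conf x ^ 2) + W (hdist o x) * ‖u x‖ ^ 2 := by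
  have := hW0 _ (hdist_nonneg o x)
  positivity

theorem quadE_const_mul (u : Coord d → ℂ) (G : Coord d → EuclideanSpace ℂ (Fin d)) (c : ℂ) :
    quadE μ W o R (fun x => c * u x) (fun x => c • G x) =
      ENNReal.ofReal (‖c‖ ^ 2) * quadE μ W o R u G := by
  rw [quadE, quadE, ← lintegral_const_mul' _ _ ENNReal.ofReal_ne_top]
  refine lintegral_congr fun x => ?_
  rw [← ENNReal.ofReal_mul (sq_nonneg _), norm_mul, norm_smul]
  congr 1
  ring

/-- Young's inequality with a free parameter: the main term keeps a factor arbitrarily close to 1,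
which the lower bound for general admissible functions requires. -/
theorem norm_add_sq_le_of_pos {E : Type*} [SeminormedAddCommGroup E] {ε : ℝ} (hε : 0 < ε)
    (a b : E) : ‖a + b‖ ^ 2 ≤ (1 + ε) * ‖a‖ ^ 2 + (1 + ε⁻¹) * ‖b‖ ^ 2 := by
  have h1 : ‖a + b‖ ^ 2 ≤ (‖a‖ + ‖b‖) ^ 2 := pow_le_pow_left₀ (norm_nonneg _) (norm_add_le a b) 2
  have h2 : 0 ≤ ε⁻¹ * (ε * ‖a‖ - ‖b‖) ^ 2 := by positivity
  have h3 : ε⁻¹ * (ε * ‖a‖ - ‖b‖) ^ 2 = ε * ‖a‖ ^ 2 - 2 * ‖a‖ * ‖b‖ + ε⁻¹ * ‖b‖ ^ 2 := by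
    field_simp
    ring
  nlinarith

theorem quadE_add_le (hμ : 0 ≤ μ) (hW : Measurable W) (hW0 : ∀ r, 0 ≤ r → 0 ≤ W r)
    {u v : Coord d → ℂ} {G K : Coord d → EuclideanSpace ℂ (Fin d)}
    (hu : AEStronglyMeasurable u ((hvol d).restrict (hball o R)))
    (hG : AEStronglyMeasurable G ((hvol d).restrict (hball o R))) {ε : ℝ} (hε : 0 < ε) :
    quadE μ W o R (fun x => u x + v x) (fun x => G x + K x) ≤
      ENNReal.ofReal (1 + ε) * quadE μ W o R u G + ENNReal.ofReal (1 + ε⁻¹) * quadE μ W o R v K := by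
  rw [quadE, quadE, quadE, ← lintegral_const_mul' _ _ ENNReal.ofReal_ne_top,
    ← lintegral_const_mul' _ _ ENNReal.ofReal_ne_top,
    ← lintegral_add_left' ((aemeasurable_density μ hW hu hG).const_mul _)]
  refine lintegral_mono fun x => ?_
  have h0 := hW0 _ (hdist_nonneg o x)
  rw [← ENNReal.ofReal_mul (by positivity), ← ENNReal.ofReal_mul (by positivity),
    ← ENNReal.ofReal_add (mul_nonneg (by positivity) (density_nonneg hμ hW0 u G x))
      (mul_nonneg (by positivity) (density_nonneg hμ hW0 v K x))]
  refine ENNReal.ofReal_le_ofReal ?_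
  have h1 := mul_le_mul_of_nonneg_left (norm_add_sq_le_of_pos hε (u x) (v x)) h0
  have h2 := mul_le_mul_of_nonneg_left (norm_add_sq_le_of_pos hε (G x) (K x))
    (by positivity : 0 ≤ μ * (conf x ^ 2)⁻¹)
  simp only [div_eq_mul_inv]
  nlinarith

theorem quadE_add_le_two (hμ : 0 ≤ μ) (hW : Measurable W) (hW0 : ∀ r, 0 ≤ r → 0 ≤ W r)
    {u v : Coord d → ℂ} {G K : Coord d → EuclideanSpace ℂ (Fin d)}
    (hu : AEStronglyMeasurable u ((hvol d).restrict (hball o R)))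
    (hG : AEStronglyMeasurable G ((hvol d).restrict (hball o R))) :
    quadE μ W o R (fun x => u x + v x) (fun x => G x + K x) ≤
      2 * quadE μ W o R u G + 2 * quadE μ W o R v K := by
  have := quadE_add_le hμ hW hW0 hu hG (v := v) (K := K) one_pos
  norm_num at this
  exact this

theorem two_mul_ofReal (a : ℝ) : 2 * ENNReal.ofReal a = ENNReal.ofReal (2 * a) := by
  rw [ENNReal.ofReal_mul zero_le_two, ENNReal.ofReal_ofNat]

/-- The parallelogram identity for the energy. -/
theorem quadE_parallelogram (hμ : 0 ≤ μ) (hW : Measurable W) (hW0 : ∀ r, 0 ≤ r → 0 ≤ W r)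
    {u v : Coord d → ℂ} {G K : Coord d → EuclideanSpace ℂ (Fin d)}
    (hu : AEStronglyMeasurable u ((hvol d).restrict (hball o R)))
    (hG : AEStronglyMeasurable G ((hvol d).restrict (hball o R)))
    (hv : AEStronglyMeasurable v ((hvol d).restrict (hball o R)))
    (hK : AEStronglyMeasurable K ((hvol d).restrict (hball o R))) :
    quadE μ W o R (fun x => u x + v x) (fun x => G x + K x) +
      quadE μ W o R (fun x => u x - v x) (fun x => G x - K x) =
      2 * quadE μ W o R u G + 2 * quadE μ W o R v K := by
  simp only [quadE]
  rw [← lintegral_const_mul' _ _ ENNReal.ofNat_ne_top, ← lintegral_const_mul' _ _ ENNReal.ofNat_ne_top,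
    ← lintegral_add_left' (aemeasurable_density (u := fun x => u x + v x)
      (G := fun x => G x + K x) μ hW (hu.add hv) (hG.add hK)),
    ← lintegral_add_left' ((aemeasurable_density μ hW hu hG).const_mul _)]
  refine lintegral_congr fun x => ?_
  rw [← ENNReal.ofReal_add (density_nonneg hμ hW0 (fun x => u x + v x) (fun x => G x + K x) x)
    (density_nonneg hμ hW0 (fun x => u x - v x) (fun x => G x - K x) x), ← mul_add,
    ← ENNReal.ofReal_add (density_nonneg hμ hW0 u G x) (density_nonneg hμ hW0 v K x),
    two_mul_ofReal]
  congr 1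
  have h1 := parallelogram_law_with_norm ℝ (u x) (v x)
  have h2 := parallelogram_law_with_norm ℂ (G x) (K x)
  simp only [div_eq_mul_inv]
  linear_combination (W (hdist o x)) * h1 + (μ * (conf x ^ 2)⁻¹) * h2

/-- The gradient term carries the weight conf^d / conf², which is at least 1 because d ≥ 2. The
Dirichlet energy therefore controls the Euclidean L² norm of the differential. -/
theorem lintegral_sq_le_hvol (hd : 2 ≤ d) {F : Type*} [NormedAddCommGroup F] (G : Coord d → F) :
    ∫⁻ x in hball o R, ENNReal.ofReal (‖G x‖ ^ 2) ≤
      ∫⁻ x in hball o R, ENNReal.ofReal (‖G x‖ ^ 2 / conf x ^ 2) ∂(hvol d) := by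
  rw [lintegral_hball]
  refine setLIntegral_mono' (measurableSet_hball o R) fun x hx => ?_
  have h1 := two_le_conf hx.1
  rw [← ENNReal.ofReal_mul (by positivity)]
  refine ENNReal.ofReal_le_ofReal ?_
  have h2 : conf x ^ 2 ≤ conf x ^ d := pow_le_pow_right₀ (by linarith) hd
  rw [← mul_div_assoc, le_div_iff₀ (by positivity), mul_comm]
  gcongr

theorem lintegral_sq_le_hvol' {F : Type*} [NormedAddCommGroup F] (u : Coord d → F) :
    ∫⁻ x in hball o R, ENNReal.ofReal (‖u x‖ ^ 2) ≤
      ∫⁻ x in hball o R, ENNReal.ofReal (‖u x‖ ^ 2) ∂(hvol d) :=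
  lintegral_mono' (volume_restrict_le o R) le_rfl

theorem lintegral_grad_le_quadE (hW0 : ∀ r, 0 ≤ r → 0 ≤ W r) (u : Coord d → ℂ)
    (G : Coord d → EuclideanSpace ℂ (Fin d)) :
    ∫⁻ x in hball o R, ENNReal.ofReal (‖G x‖ ^ 2 / conf x ^ 2) ∂(hvol d) ≤ quadE 1 W o R u G :=
  lintegral_mono fun x => ENNReal.ofReal_le_ofReal (by
    have := mul_nonneg (hW0 _ (hdist_nonneg o x)) (sq_nonneg ‖u x‖)
    linarith)

theorem lintegral_fun_le_quadE (u : Coord d → ℂ) (G : Coord d → EuclideanSpace ℂ (Fin d)) :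
    ∫⁻ x in hball o R, ENNReal.ofReal (‖u x‖ ^ 2) ∂(hvol d) ≤ quadE 1 (fun _ => 1) o R u G :=
  lintegral_mono fun x => ENNReal.ofReal_le_ofReal (by
    have : 0 ≤ ‖G x‖ ^ 2 / conf x ^ 2 := by positivity
    linarith)

theorem isFiniteMeasure_hvol_restrict (ho : o ∈ poincareBall d) (hd : 0 < d) :
    IsFiniteMeasure ((hvol d).restrict (hball o R)) :=
  ⟨by simpa using hvol_hball_lt_top ho hd R⟩

theorem isFiniteMeasure_volume_restrict (o : Coord d) (R : ℝ) :
    IsFiniteMeasure ((volume : Measure (Coord d)).restrict (hball o R)) :=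
  ⟨by simpa using (measure_mono (hball_subset o R)).trans_lt measure_ball_lt_top⟩

theorem eLpNorm_two_sq {α F : Type*} [MeasurableSpace α] [NormedAddCommGroup F] (ν : Measure α)
    (u : α → F) : eLpNorm u 2 ν = (∫⁻ x, ENNReal.ofReal (‖u x‖ ^ 2) ∂ν) ^ (1 / 2 : ℝ) := by
  rw [eLpNorm_eq_lintegral_rpow_enorm_toReal two_ne_zero ENNReal.ofNat_ne_top]
  simp only [ENNReal.toReal_ofNat]
  congr 1
  refine lintegral_congr fun x => ?_
  rw [← ofReal_norm, ENNReal.ofReal_rpow_of_nonneg (norm_nonneg _) zero_le_two]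
  simp

theorem memLp_two_of_lintegral {α F : Type*} [MeasurableSpace α] [NormedAddCommGroup F]
    {ν : Measure α} {u : α → F} (hu : AEStronglyMeasurable u ν)
    (h : ∫⁻ x, ENNReal.ofReal (‖u x‖ ^ 2) ∂ν < ⊤) : MemLp u 2 ν := by
  refine ⟨hu, ?_⟩
  rw [eLpNorm_two_sq]
  exact ENNReal.rpow_lt_top_of_nonneg (by norm_num) h.ne

theorem tendsto_lintegral_enorm_of_sq {α F : Type*} [MeasurableSpace α] [NormedAddCommGroup F]
    {ν : Measure α} [IsFiniteMeasure ν] {u : ℕ → α → F} (hu : ∀ n, AEStronglyMeasurable (u n) ν)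
    (h : Tendsto (fun n => ∫⁻ x, ENNReal.ofReal (‖u n x‖ ^ 2) ∂ν) atTop (𝓝 0)) :
    Tendsto (fun n => ∫⁻ x, ‖u n x‖ₑ ∂ν) atTop (𝓝 0) := by
  have h1 : ∀ n, ∫⁻ x, ‖u n x‖ₑ ∂ν ≤ (∫⁻ x, ENNReal.ofReal (‖u n x‖ ^ 2) ∂ν) ^ (1 / 2 : ℝ) *
      ν univ ^ (1 / 2 : ℝ) := by
    intro n
    have := eLpNorm_le_eLpNorm_mul_rpow_measure_univ (p := 1) (q := 2) one_le_two (hu n)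
    rw [eLpNorm_two_sq, eLpNorm_one_eq_lintegral_enorm] at this
    norm_num at this ⊢
    exact this
  refine tendsto_of_tendsto_of_tendsto_of_le_of_le tendsto_const_nhds ?_ (fun _ => zero_le) h1
  have h2 := (ENNReal.continuous_rpow_const (y := 1 / 2)).continuousAt.tendsto.comp h
  rw [ENNReal.zero_rpow_of_pos (by norm_num)] at h2
  have h3 := ENNReal.Tendsto.mul_const (b := ν univ ^ (1 / 2 : ℝ)) h2
    (Or.inr (ENNReal.rpow_ne_top_of_nonneg (by norm_num) (measure_ne_top _ _)))
  simpa using h3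

theorem locallyIntegrableOn_of_quadE (hd : 2 ≤ d) {u : Coord d → ℂ}
    {G : Coord d → EuclideanSpace ℂ (Fin d)}
    (hu : AEStronglyMeasurable u (volume.restrict (hball o R)))
    (hG : AEStronglyMeasurable G (volume.restrict (hball o R)))
    (h : quadE 1 (fun _ => 1) o R u G < ⊤) :
    LocallyIntegrableOn u (hball o R) volume ∧ LocallyIntegrableOn G (hball o R) volume := by
  have := isFiniteMeasure_volume_restrict o R
  have h1 := memLp_two_of_lintegral hu
    ((lintegral_sq_le_hvol' u).trans_lt ((lintegral_fun_le_quadE u G).trans_lt h))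
  have h2 := memLp_two_of_lintegral hG ((lintegral_sq_le_hvol hd G).trans_lt
    ((lintegral_grad_le_quadE (fun _ _ => zero_le_one) u G).trans_lt h))
  have i1 : IntegrableOn u (hball o R) := h1.integrable one_le_two
  have i2 : IntegrableOn G (hball o R) := h2.integrable one_le_two
  exact ⟨i1.locallyIntegrableOn, i2.locallyIntegrableOn⟩

/-- Convergence in `H¹` implies convergence of functions and differentials in `L¹`. -/
theorem tendsto_L1_of_quadE (hd : 2 ≤ d) {v : ℕ → Coord d → ℂ}
    {K : ℕ → Coord d → EuclideanSpace ℂ (Fin d)}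
    (hv : ∀ n, AEStronglyMeasurable (v n) (volume.restrict (hball o R)))
    (hK : ∀ n, AEStronglyMeasurable (K n) (volume.restrict (hball o R)))
    (h : Tendsto (fun n => quadE 1 (fun _ => 1) o R (v n) (K n)) atTop (𝓝 0)) :
    Tendsto (fun n => ∫⁻ x in hball o R, ‖v n x‖ₑ) atTop (𝓝 0) ∧
    Tendsto (fun n => ∫⁻ x in hball o R, ‖K n x‖ₑ) atTop (𝓝 0) := by
  have := isFiniteMeasure_volume_restrict o R
  exact ⟨tendsto_lintegral_enorm_of_sq hv (tendsto_of_tendsto_of_tendsto_of_le_of_le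
      tendsto_const_nhds h (fun _ => zero_le) fun n =>
        (lintegral_sq_le_hvol' (v n)).trans (lintegral_fun_le_quadE (v n) (K n))),
    tendsto_lintegral_enorm_of_sq hK (tendsto_of_tendsto_of_tendsto_of_le_of_le
      tendsto_const_nhds h (fun _ => zero_le) fun n => (lintegral_sq_le_hvol hd (K n)).trans
        (lintegral_grad_le_quadE (fun _ _ => zero_le_one) (v n) (K n)))⟩

theorem isWeakDifferential_of_tendsto_quadE (hd : 2 ≤ d) {u : Coord d → ℂ}
    {G : Coord d → EuclideanSpace ℂ (Fin d)} {v : ℕ → Coord d → ℂ}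
    {K : ℕ → Coord d → EuclideanSpace ℂ (Fin d)}
    (hu : LocallyIntegrableOn u (hball o R) volume) (hG : LocallyIntegrableOn G (hball o R) volume)
    (h : ∀ n, IsWeakDifferential (hball o R) (v n) (K n))
    (ht : Tendsto (fun n => quadE 1 (fun _ => 1) o R (fun x => v n x - u x) (fun x => K n x - G x))
      atTop (𝓝 0)) : IsWeakDifferential (hball o R) u G := by
  obtain ⟨h1, h2⟩ := tendsto_L1_of_quadE hd
    (fun n => (h n).1.aestronglyMeasurable.sub hu.aestronglyMeasurable)
    (fun n => (h n).2.1.aestronglyMeasurable.sub hG.aestronglyMeasurable) ht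
  exact isWeakDifferential_of_tendsto hu hG h h1 h2

theorem memH1_iff (ho : o ∈ poincareBall d) {u : Coord d → ℂ} :
    MemH1 (hball o R) u ↔
      ∃ G, IsWeakDifferential (hball o R) u G ∧ quadE 1 (fun _ => 1) o R u G < ⊤ := by
  constructor
  · rintro ⟨-, ⟨G, hG⟩, h⟩
    exact ⟨G, hG, by rwa [← h1NormSq_eq ho hG]⟩
  · rintro ⟨G, hG, h⟩
    exact ⟨hG.aestronglyMeasurable.1, ⟨G, hG⟩, by rwa [h1NormSq_eq ho hG]⟩

theorem MemH1.add (ho : o ∈ poincareBall d) {u v : Coord d → ℂ} (hu : MemH1 (hball o R) u)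
    (hv : MemH1 (hball o R) v) : MemH1 (hball o R) (fun x => u x + v x) := by
  rw [memH1_iff ho] at *
  obtain ⟨G, hG, h⟩ := hu
  obtain ⟨K, hK, h'⟩ := hv
  refine ⟨_, hG.add hK, (quadE_add_le_two zero_le_one measurable_const (fun _ _ => zero_le_one)
    hG.aestronglyMeasurable.1 hG.aestronglyMeasurable.2).trans_lt ?_⟩
  exact ENNReal.add_lt_top.2 ⟨ENNReal.mul_lt_top (by simp) h, ENNReal.mul_lt_top (by simp) h'⟩

theorem MemH1.const_mul (ho : o ∈ poincareBall d) {u : Coord d → ℂ} (hu : MemH1 (hball o R) u)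
    (c : ℂ) : MemH1 (hball o R) (fun x => c * u x) := by
  rw [memH1_iff ho] at *
  obtain ⟨G, hG, h⟩ := hu
  refine ⟨_, hG.const_mul c, ?_⟩
  rw [quadE_const_mul]
  exact ENNReal.mul_lt_top (by simp) h

/-- The complex gradient of a smooth function. -/
def gradC (ψ : Coord d → ℂ) (x : Coord d) : EuclideanSpace ℂ (Fin d) :=
  WithLp.toLp 2 fun i => pderiv i ψ x

theorem norm_fderiv_le_gradC (ψ : Coord d → ℂ) (x : Coord d) :
    ‖fderiv ℝ ψ x‖ ≤ ‖gradC ψ x‖ := by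
  refine ContinuousLinearMap.opNorm_le_bound _ (norm_nonneg _) fun v => ?_
  have hv : v = ∑ i, v i • EuclideanSpace.single i (1 : ℝ) := by
    have := (EuclideanSpace.basisFun (Fin d) ℝ).sum_repr v
    simpa using this.symm
  have h1 : fderiv ℝ ψ x v = ∑ i, v i • pderiv i ψ x := by
    conv_lhs => rw [hv]
    rw [map_sum]
    simp [pderiv]
  rw [h1]
  refine (norm_sum_le _ _).trans ?_
  simp only [norm_smul]
  rw [EuclideanSpace.norm_eq, EuclideanSpace.norm_eq, mul_comm]
  exact Real.sum_mul_le_sqrt_mul_sqrt _ _ _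

theorem IsTestFunction.continuous_gradC {U : Set (Coord d)} {ψ : Coord d → ℂ}
    (h : IsTestFunction U ψ) : Continuous (gradC ψ) :=
  (PiLp.continuous_toLp 2 _).comp (continuous_pi fun i => h.continuous_pderiv i)

theorem IsTestFunction.isWeakDifferential {U : Set (Coord d)} {ψ : Coord d → ℂ}
    (h : IsTestFunction U ψ) : IsWeakDifferential U ψ (gradC ψ) :=
  isWeakDifferential_of_hasFDerivAt (h.1.continuous.locallyIntegrable.locallyIntegrableOn U)
    (h.continuous_gradC.locallyIntegrable.locallyIntegrableOn U)
    (fun x _ => (h.1.differentiable (by simp) x).hasFDerivAt) fun _ _ _ => rfl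

theorem gradC_eq_zero {ψ : Coord d → ℂ} {x : Coord d} (hx : x ∉ tsupport ψ) :
    gradC ψ x = 0 := by
  ext i
  have : pderiv i ψ x = 0 :=
    image_eq_zero_of_notMem_tsupport fun h => hx (tsupport_pderiv_subset ψ i h)
  exact this

theorem quadE_lt_top_of_bound (ho : o ∈ poincareBall d) (hd : 0 < d) (hμ : 0 ≤ μ) {M : ℝ}
    (hM : ∀ r, W r ≤ M) (hM0 : 0 ≤ M)
    {u : Coord d → ℂ} {G : Coord d → EuclideanSpace ℂ (Fin d)} {A B : ℝ}
    (hu : ∀ x ∈ hball o R, ‖u x‖ ≤ A) (hG : ∀ x ∈ hball o R, ‖G x‖ / conf x ≤ B) :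
    quadE μ W o R u G < ⊤ := by
  have := isFiniteMeasure_hvol_restrict ho hd (R := R)
  have h1 : quadE μ W o R u G ≤
      ∫⁻ _ in hball o R, ENNReal.ofReal (μ * B ^ 2 + M * A ^ 2) ∂(hvol d) := by
    refine setLIntegral_mono' (measurableSet_hball o R) fun x hx => ENNReal.ofReal_le_ofReal ?_
    have hc := conf_pos hx.1
    have h2 := pow_le_pow_left₀ (by positivity) (hG x hx) 2
    have h3 := pow_le_pow_left₀ (norm_nonneg _) (hu x hx) 2
    rw [div_pow] at h2
    have h4 := hM (hdist o x)
    gcongr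
  refine h1.trans_lt ?_
  rw [lintegral_const]
  exact ENNReal.mul_lt_top ENNReal.ofReal_lt_top (measure_lt_top _ _)

theorem IsTestFunction.exists_bound {U : Set (Coord d)} {ψ : Coord d → ℂ}
    (h : IsTestFunction U ψ) : ∃ C, ∀ x, ‖ψ x‖ ≤ C ∧ ‖gradC ψ x‖ ≤ C := by
  obtain ⟨A, hA⟩ := h.2.1.exists_bound_of_continuous h.1.continuous
  have hc : HasCompactSupport (gradC ψ) := HasCompactSupport.intro h.2.1 fun x hx => gradC_eq_zero hx
  obtain ⟨B, hB⟩ := hc.exists_bound_of_continuous h.continuous_gradC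
  exact ⟨max A B, fun x => ⟨(hA x).trans (le_max_left _ _), (hB x).trans (le_max_right _ _)⟩⟩

theorem IsTestFunction.memH1 (ho : o ∈ poincareBall d) (hd : 0 < d) {ψ : Coord d → ℂ}
    (h : IsTestFunction (hball o R) ψ) : MemH1 (hball o R) ψ := by
  obtain ⟨C, hC⟩ := h.exists_bound
  refine (memH1_iff ho).2 ⟨_, h.isWeakDifferential, quadE_lt_top_of_bound ho hd zero_le_one
    (M := 1) (fun _ => le_rfl) zero_le_one (A := C) (B := C) (fun x _ => (hC x).1) fun x hx => ?_⟩
  have := two_le_conf hx.1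
  exact (div_le_self (norm_nonneg _) (by linarith)).trans (hC x).2

theorem memH1_const (ho : o ∈ poincareBall d) (hd : 0 < d) (c : ℂ) :
    MemH1 (hball o R) (fun _ => c) :=
  (memH1_iff ho).2 ⟨_, isWeakDifferential_const c, quadE_lt_top_of_bound ho hd zero_le_one
    (M := 1) (fun _ => le_rfl) zero_le_one (A := ‖c‖) (B := 0) (fun _ _ => le_rfl) fun x _ => by simp⟩

theorem IsTestFunction.add {F : Type*} [NormedAddCommGroup F] [NormedSpace ℝ F]
    {U : Set (Coord d)} {ψ χ : Coord d → F} (h : IsTestFunction U ψ)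
    (h' : IsTestFunction U χ) : IsTestFunction U (fun x => ψ x + χ x) :=
  ⟨h.1.add h'.1, h.2.1.add h'.2.1, (tsupport_add ψ χ).trans (union_subset h.2.2 h'.2.2)⟩

theorem IsTestFunction.const_mul {U : Set (Coord d)} {ψ : Coord d → ℂ} (h : IsTestFunction U ψ)
    (c : ℂ) : IsTestFunction U (fun x => c * ψ x) :=
  ⟨contDiff_const.mul h.1, h.2.1.mul_left,
    (closure_mono (Function.support_mul_subset_right (fun _ => c) ψ)).trans h.2.2⟩

theorem MemH1Zero.add (ho : o ∈ poincareBall d) {u v : Coord d → ℂ}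
    (hu : MemH1Zero (hball o R) u) (hv : MemH1Zero (hball o R) v) :
    MemH1Zero (hball o R) (fun x => u x + v x) := by
  obtain ⟨h1, ψ, hψ, ht⟩ := hu
  obtain ⟨h2, χ, hχ, ht'⟩ := hv
  refine ⟨h1.add ho h2, fun n x => ψ n x + χ n x, fun n => (hψ n).add (hχ n), ?_⟩
  obtain ⟨G, hG, -⟩ := (memH1_iff ho).1 h1
  obtain ⟨K, hK, -⟩ := (memH1_iff ho).1 h2
  have hle : ∀ n, h1NormSq (hball o R) (fun x => u x + v x - (ψ n x + χ n x)) ≤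
      2 * h1NormSq (hball o R) (fun x => u x - ψ n x) +
      2 * h1NormSq (hball o R) (fun x => v x - χ n x) := by
    intro n
    have a1 := hG.sub (hψ n).isWeakDifferential
    have a2 := hK.sub (hχ n).isWeakDifferential
    have e : (fun x => u x + v x - (ψ n x + χ n x)) = fun x => (u x - ψ n x) + (v x - χ n x) := by
      ext x
      ring
    rw [e, h1NormSq_eq ho a1, h1NormSq_eq ho a2, h1NormSq_eq ho (a1.add a2)]
    exact quadE_add_le_two zero_le_one measurable_const (fun _ _ => zero_le_one)
      a1.aestronglyMeasurable.1 a1.aestronglyMeasurable.2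
  refine tendsto_of_tendsto_of_tendsto_of_le_of_le tendsto_const_nhds ?_ (fun _ => zero_le) hle
  have := (ENNReal.Tendsto.const_mul (a := 2) ht (Or.inr (by simp))).add
    (ENNReal.Tendsto.const_mul (a := 2) ht' (Or.inr (by simp)))
  simpa using this

theorem MemH1Zero.const_mul (ho : o ∈ poincareBall d) {u : Coord d → ℂ}
    (hu : MemH1Zero (hball o R) u) (c : ℂ) : MemH1Zero (hball o R) (fun x => c * u x) := by
  obtain ⟨h1, ψ, hψ, ht⟩ := hu
  refine ⟨h1.const_mul ho c, fun n x => c * ψ n x, fun n => (hψ n).const_mul c, ?_⟩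
  obtain ⟨G, hG, -⟩ := (memH1_iff ho).1 h1
  have he : ∀ n, h1NormSq (hball o R) (fun x => c * u x - c * ψ n x) =
      ENNReal.ofReal (‖c‖ ^ 2) * h1NormSq (hball o R) (fun x => u x - ψ n x) := by
    intro n
    have a1 := hG.sub (hψ n).isWeakDifferential
    simp_rw [← mul_sub]
    rw [h1NormSq_eq ho a1, h1NormSq_eq ho (a1.const_mul c), quadE_const_mul]
  simp_rw [he]
  have := ENNReal.Tendsto.const_mul (a := ENNReal.ofReal (‖c‖ ^ 2)) ht
    (Or.inr ENNReal.ofReal_ne_top)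
  rwa [mul_zero] at this

theorem IsTestFunction.memH1Zero (ho : o ∈ poincareBall d) (hd : 0 < d) {ψ : Coord d → ℂ}
    (h : IsTestFunction (hball o R) ψ) : MemH1Zero (hball o R) ψ := by
  refine ⟨h.memH1 ho hd, fun _ => ψ, fun _ => h, ?_⟩
  simp_rw [sub_self]
  rw [h1NormSq_eq ho (isWeakDifferential_const 0)]
  simp [quadE]

/-- H¹₀ is closed: a test function within 1 / (n + 1) of the n-th approximant gives a diagonal
sequence. -/
theorem MemH1Zero.of_tendsto (ho : o ∈ poincareBall d) {u : Coord d → ℂ}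
    (hu : MemH1 (hball o R) u) {v : ℕ → Coord d → ℂ} (hv : ∀ n, MemH1Zero (hball o R) (v n))
    (ht : Tendsto (fun n => h1NormSq (hball o R) (fun x => u x - v n x)) atTop (𝓝 0)) :
    MemH1Zero (hball o R) u := by
  have h1 : ∀ n, ∃ ψ, IsTestFunction (hball o R) ψ ∧
      h1NormSq (hball o R) (fun x => v n x - ψ x) ≤ ((n : ℝ≥0∞) + 1)⁻¹ := by
    intro n
    obtain ⟨-, ψ, hψ, h⟩ := hv n
    have hpos : (0 : ℝ≥0∞) < ((n : ℝ≥0∞) + 1)⁻¹ := by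
      rw [ENNReal.inv_pos]
      exact ENNReal.add_ne_top.2 ⟨ENNReal.natCast_ne_top n, ENNReal.one_ne_top⟩
    obtain ⟨m, hm⟩ := (h.eventually_le_const hpos).exists
    exact ⟨ψ m, hψ m, hm⟩
  choose ψ hψ hle using h1
  refine ⟨hu, ψ, hψ, ?_⟩
  obtain ⟨G, hG, -⟩ := (memH1_iff ho).1 hu
  have hle2 : ∀ n, h1NormSq (hball o R) (fun x => u x - ψ n x) ≤
      2 * h1NormSq (hball o R) (fun x => u x - v n x) + 2 * ((n : ℝ≥0∞) + 1)⁻¹ := by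
    intro n
    obtain ⟨K, hK, -⟩ := (memH1_iff ho).1 (hv n).1
    have a1 := hG.sub hK
    have a2 := hK.sub (hψ n).isWeakDifferential
    have e : (fun x => u x - ψ n x) = fun x => (u x - v n x) + (v n x - ψ n x) := by
      ext x
      ring
    refine le_trans ?_ (add_le_add_right (mul_le_mul_right (hle n) 2) _)
    rw [e, h1NormSq_eq ho a1, h1NormSq_eq ho a2, h1NormSq_eq ho (a1.add a2)]
    exact quadE_add_le_two zero_le_one measurable_const (fun _ _ => zero_le_one)
      a1.aestronglyMeasurable.1 a1.aestronglyMeasurable.2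
  refine tendsto_of_tendsto_of_tendsto_of_le_of_le tendsto_const_nhds ?_ (fun _ => zero_le) hle2
  have h3 : Tendsto (fun n : ℕ => ((n : ℝ≥0∞) + 1)⁻¹) atTop (𝓝 0) := by
    have := (tendsto_add_atTop_iff_nat 1).2 ENNReal.tendsto_inv_nat_nhds_zero
    simpa using this
  have := (ENNReal.Tendsto.const_mul (a := 2) ht (Or.inr (by simp))).add
    (ENNReal.Tendsto.const_mul (a := 2) h3 (Or.inr (by simp)))
  simpa using this

/-- A function in `H¹₀` with vanishing differential is zero. -/
theorem MemH1Zero.ae_eq_zero (ho : o ∈ poincareBall d) (hd : 2 ≤ d) {u : Coord d → ℂ}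
    (hu : MemH1Zero (hball o R) u) (h0 : IsWeakDifferential (hball o R) u (fun _ => 0)) :
    u =ᵐ[(hvol d).restrict (hball o R)] 0 := by
  have hfin := isFiniteMeasure_volume_restrict o R
  obtain ⟨-, ψ, hψ, ht⟩ := hu
  have hw := fun n => h0.sub (hψ n).isWeakDifferential
  simp_rw [fun n => h1NormSq_eq ho (hw n)] at ht
  obtain ⟨t1, t2⟩ := tendsto_L1_of_quadE hd (fun n => (hw n).1.aestronglyMeasurable)
    (fun n => (hw n).2.1.aestronglyMeasurable) ht
  simp only [zero_sub, enorm_neg] at t2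
  -- The Gagliardo–Nirenberg–Sobolev exponent p = d / (d - 1), finite because d ≥ 2.
  obtain ⟨p, hp⟩ : ∃ p : NNReal, NNReal.HolderConjugate (Module.finrank ℝ (Coord d)) p := by
    refine ⟨Real.toNNReal (Real.conjExponent d), ?_⟩
    have h1 : (1 : ℝ) < d := by exact_mod_cast hd
    have h2 := Real.HolderConjugate.conjExponent h1
    rw [finrank_euclideanSpace_fin]
    rw [← NNReal.holderConjugate_coe_iff, Real.coe_toNNReal _ h2.symm.nonneg]
    simpa using h2
  have hp1 : (1 : ℝ≥0∞) ≤ p := by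
    exact_mod_cast hp.symm.lt.le
  set ν := (volume : Measure (Coord d)).restrict (hball o R) with hν
  set C : ℝ≥0∞ := ENNReal.ofNNReal
    (eLpNormLESNormFDerivOneConst (volume : Measure (Coord d)) p) with hC
  -- An L¹ Poincaré inequality: Hölder on the bounded ball, then the Sobolev inequality for
  -- compactly supported functions. As u has zero differential, the gradients of ψₙ tend to 0 in L¹,
  -- hence so does ψₙ, which also tends to u.
  have hbd : ∀ n, ∫⁻ x in hball o R, ‖ψ n x‖ₑ ≤
      (C * ∫⁻ x in hball o R, ‖gradC (ψ n) x‖ₑ) * ν univ ^ (1 - 1 / (p : ℝ)) := by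
    intro n
    have h1 := eLpNorm_le_eLpNorm_mul_rpow_measure_univ (p := 1) (q := p) hp1
      (hψ n).1.continuous.aestronglyMeasurable (μ := ν) (f := ψ n)
    rw [eLpNorm_one_eq_lintegral_enorm] at h1
    simp only [ENNReal.toReal_one, ENNReal.coe_toReal, div_one] at h1
    refine h1.trans (mul_le_mul_left ?_ _)
    refine (eLpNorm_mono_measure (ψ n) Measure.restrict_le_self).trans ?_
    have hc1 : ContDiff ℝ 1 (ψ n) := (hψ n).1.of_le (by simp)
    refine (eLpNorm_le_eLpNorm_fderiv_one volume hc1 (hψ n).2.1 hp).trans ?_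
    refine mul_le_mul_right ?_ _
    rw [eLpNorm_one_eq_lintegral_enorm, ← setLIntegral_eq_of_support_subset (s := hball o R)]
    · refine lintegral_mono fun x => ?_
      rw [← ofReal_norm, ← ofReal_norm]
      exact ENNReal.ofReal_le_ofReal (norm_fderiv_le_gradC _ _)
    · intro x hx
      refine (hψ n).2.2 (tsupport_fderiv_subset ℝ (f := ψ n) (subset_tsupport _ ?_))
      intro h
      apply hx
      change ‖fderiv ℝ (ψ n) x‖ₑ = 0
      rw [← ofReal_norm, h, norm_zero, ENNReal.ofReal_zero]
  have t3 : Tendsto (fun n => ∫⁻ x in hball o R, ‖ψ n x‖ₑ) atTop (𝓝 0) := by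
    refine tendsto_of_tendsto_of_tendsto_of_le_of_le tendsto_const_nhds ?_ (fun _ => zero_le) hbd
    have hexp : 0 ≤ 1 - 1 / (p : ℝ) := by
      have h1 : (1 : ℝ) ≤ p := by exact_mod_cast hp1
      rw [sub_nonneg]
      exact (div_le_one (by linarith)).2 h1
    have h4 := ENNReal.Tendsto.mul_const (b := ν univ ^ (1 - 1 / (p : ℝ)))
      (ENNReal.Tendsto.const_mul (a := C) t2 (Or.inr ENNReal.coe_ne_top))
      (Or.inr (ENNReal.rpow_ne_top_of_nonneg hexp (measure_ne_top _ _)))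
    simpa using h4
  have hzero : ∫⁻ x in hball o R, ‖u x‖ₑ = 0 := by
    have t4 := t1.add t3
    rw [add_zero] at t4
    refine le_antisymm (ge_of_tendsto' t4 fun n => ?_) zero_le
    rw [← lintegral_add_left' (hw n).1.aestronglyMeasurable.enorm]
    refine lintegral_mono fun x => ?_
    simpa using enorm_add_le (u x - ψ n x) (ψ n x)
  rw [lintegral_eq_zero_iff' h0.1.aestronglyMeasurable.enorm] at hzero
  refine hvol_restrict_absolutelyContinuous _ ?_
  filter_upwards [hzero] with x hx
  simpa using hx

end Sobolev

/-! ### Radial functions and their differentials. -/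

section Radial

variable {d : ℕ} {o : Coord d} {R : ℝ}

/-- The real vector `v`, considered as a complex vector. -/
def toC (v : Coord d) : EuclideanSpace ℂ (Fin d) := WithLp.toLp 2 fun i => (v i : ℂ)

theorem norm_toC (v : Coord d) : ‖toC v‖ = ‖v‖ := by
  simp [toC, EuclideanSpace.norm_eq]

theorem continuous_toC : Continuous (toC : Coord d → EuclideanSpace ℂ (Fin d)) := by
  unfold toC
  fun_prop

/-- The differential of the radial function with profile `g`, where `h = g'`. -/
def radGrad (o : Coord d) (h : ℝ → ℝ) (x : Coord d) : EuclideanSpace ℂ (Fin d) :=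
  (h (hdist o x) : ℂ) • toC (distGrad o x)

theorem norm_radGrad_sq (ho : o ∈ poincareBall d) (h : ℝ → ℝ) {x : Coord d}
    (hx : x ∈ poincareBall d) (hxo : x ≠ o) :
    ‖radGrad o h x‖ ^ 2 / conf x ^ 2 = h (hdist o x) ^ 2 := by
  have hc := conf_pos hx
  rw [radGrad, norm_smul, norm_toC, (hasFDerivAt_hdist ho hx hxo).2, Complex.norm_real,
    mul_pow, Real.norm_eq_abs, sq_abs]
  field_simp

theorem aestronglyMeasurable_radial (ho : o ∈ poincareBall d) (hd : 0 < d) {g : ℝ → ℝ}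
    (hg : AEStronglyMeasurable g (radMeas (d - 1) R)) :
    AEStronglyMeasurable (radial o g) ((hvol d).restrict (hball o R)) :=
  Complex.continuous_ofReal.comp_aestronglyMeasurable
    (hg.comp_quasiMeasurePreserving (quasiMeasurePreserving_hdist ho hd R))

theorem aestronglyMeasurable_radGrad (ho : o ∈ poincareBall d) (hd : 0 < d) {h : ℝ → ℝ}
    (hh : AEStronglyMeasurable h (radMeas (d - 1) R)) :
    AEStronglyMeasurable (radGrad o h) ((hvol d).restrict (hball o R)) :=
  (aestronglyMeasurable_radial ho hd hh).smul
    (continuous_toC.measurable.comp (measurable_distGrad o)).aestronglyMeasurable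

theorem quadE_radial (ho : o ∈ poincareBall d) (hd : 0 < d) (μ : ℝ) {W : ℝ → ℝ}
    (hW : Measurable W) {g h : ℝ → ℝ} (hg : AEStronglyMeasurable g (radMeas (d - 1) R))
    (hh : AEStronglyMeasurable h (radMeas (d - 1) R)) :
    quadE μ W o R (radial o g) (radGrad o h) = (volume : Measure (Coord d)).toSphere univ *
      ∫⁻ r, ENNReal.ofReal (μ * h r ^ 2 + W r * g r ^ 2) ∂(radMeas (d - 1) R) := by
  have hm : AEMeasurable (fun r => ENNReal.ofReal (μ * h r ^ 2 + W r * g r ^ 2))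
      (radMeas (d - 1) R) :=
    (((hh.aemeasurable.pow_const 2).const_mul μ).add
      (hW.aemeasurable.mul (hg.aemeasurable.pow_const 2))).ennreal_ofReal
  have h1 := lintegral_map' (μ := (hvol d).restrict (hball o R)) (g := hdist o)
    (f := fun r => ENNReal.ofReal (μ * h r ^ 2 + W r * g r ^ 2))
    (by rw [map_hdist ho hd]; exact hm.smul_measure _) (measurable_hdist o).aemeasurable
  rw [map_hdist ho hd, lintegral_smul_measure, smul_eq_mul] at h1
  rw [h1]
  refine lintegral_congr_ae ?_
  filter_upwards [ae_hball hd o R] with x hx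
  rw [norm_radGrad_sq ho h hx.1.1 hx.2, radial, Complex.norm_real, Real.norm_eq_abs, sq_abs]

/-- Profiles whose radial functions are differentiable on `B_R(o)`, with bounded differential. -/
structure RadialProfile (R C : ℝ) (g g' : ℝ → ℝ) : Prop where
  deriv : ∀ r ∈ Ioo 0 R, HasDerivAt g (g' r) r
  bound : ∀ r ∈ Ico 0 R, |g r| ≤ C
  dbound : ∀ r ∈ Ico 0 R, |g' r| ≤ C
  dzero : g' 0 = 0
  zero : ∀ᶠ r in 𝓝[≥] 0, |g r - g 0| ≤ C * r ^ 2

theorem RadialProfile.sub {C D : ℝ} {g g' h h' : ℝ → ℝ} (hg : RadialProfile R C g g')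
    (hh : RadialProfile R D h h') :
    RadialProfile R (C + D) (fun r => g r - h r) (fun r => g' r - h' r) where
  deriv r hr := (hg.deriv r hr).sub (hh.deriv r hr)
  bound r hr := (abs_sub _ _).trans (add_le_add (hg.bound r hr) (hh.bound r hr))
  dbound r hr := (abs_sub _ _).trans (add_le_add (hg.dbound r hr) (hh.dbound r hr))
  dzero := by rw [hg.dzero, hh.dzero, sub_zero]
  zero := by
    filter_upwards [hg.zero, hh.zero] with r h1 h2
    have e : g r - h r - (g 0 - h 0) = (g r - g 0) - (h r - h 0) := by ring
    rw [e, add_mul]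
    exact (abs_sub _ _).trans (add_le_add h1 h2)

theorem radialProfile_const (R c : ℝ) : RadialProfile R |c| (fun _ => c) (fun _ => 0) where
  deriv r _ := hasDerivAt_const r c
  bound _ _ := le_rfl
  dbound _ _ := by simp
  dzero := rfl
  zero := .of_forall fun r => by
    rw [sub_self, abs_zero]
    positivity

theorem RadialProfile.aestronglyMeasurable {C : ℝ} {g g' : ℝ → ℝ} (h : RadialProfile R C g g')
    (n : ℕ) : AEStronglyMeasurable g (radMeas n R) ∧ AEStronglyMeasurable g' (radMeas n R) := by
  have hac : radMeas n R ≪ volume.restrict (Ioo 0 R) := withDensity_absolutelyContinuous _ _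
  have hc : ContinuousOn g (Ioo 0 R) := fun r hr => (h.deriv r hr).continuousAt.continuousWithinAt
  exact ⟨(hc.aestronglyMeasurable measurableSet_Ioo).mono_ac hac,
    (aestronglyMeasurable_of_hasDerivAt h.deriv).mono_ac hac⟩

theorem exists_hdist_le (ho : o ∈ poincareBall d) :
    ∃ K : ℝ, 0 < K ∧ ∀ᶠ x in 𝓝 o, hdist o x ≤ K * ‖x - o‖ := by
  have h1 := one_sub_norm_sq_pos ho
  have hc : ContinuousAt (fun x : Coord d => √((1 - ‖o‖ ^ 2) * (1 - ‖x‖ ^ 2))) o := by fun_prop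
  have hp : 0 < √((1 - ‖o‖ ^ 2) * (1 - ‖o‖ ^ 2)) := Real.sqrt_pos.2 (mul_pos h1 h1)
  set s := √((1 - ‖o‖ ^ 2) * (1 - ‖o‖ ^ 2)) with hs
  refine ⟨2 * (2 / s), by positivity, ?_⟩
  filter_upwards [hc.eventually (lt_mem_nhds (half_lt_self hp))] with x hx
  rw [hdist, mul_assoc]
  refine mul_le_mul_of_nonneg_left ?_ zero_le_two
  set t := ‖o - x‖ / √((1 - ‖o‖ ^ 2) * (1 - ‖x‖ ^ 2)) with ht
  have ht0 : 0 ≤ t := by positivity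
  have h2 : Real.arsinh t ≤ t := by
    have := Real.self_le_sinh_iff.2 (Real.arsinh_nonneg_iff.2 ht0)
    rwa [Real.sinh_arsinh] at this
  refine h2.trans ?_
  have hx0 : 0 < √((1 - ‖o‖ ^ 2) * (1 - ‖x‖ ^ 2)) := (half_pos hp).trans hx
  rw [ht, div_le_iff₀ hx0, norm_sub_rev]
  have h4 : 1 ≤ 2 / s * √((1 - ‖o‖ ^ 2) * (1 - ‖x‖ ^ 2)) := by
    rw [div_mul_eq_mul_div, le_div_iff₀ hp]
    linarith
  nlinarith [norm_nonneg (x - o)]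

theorem tendsto_hdist_self (ho : o ∈ poincareBall d) :
    Tendsto (hdist o) (𝓝 o) (𝓝[≥] 0) := by
  refine tendsto_nhdsWithin_iff.2 ⟨?_, .of_forall fun x => hdist_nonneg o x⟩
  obtain ⟨K, -, hK⟩ := exists_hdist_le ho
  refine tendsto_of_tendsto_of_tendsto_of_le_of_le' tendsto_const_nhds ?_
    (.of_forall fun x => hdist_nonneg o x) hK
  have : Continuous fun x : Coord d => K * ‖x - o‖ := by fun_prop
  have := this.tendsto o
  simpa using this

/-- Away from the centre this is the chain rule. At the centre `hdist o` is not differentiable, but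
the quadratic bound on the profile and the local estimate of `hdist` by a multiple of the Euclidean
distance give derivative 0, in agreement with g' 0 = 0. -/
theorem RadialProfile.hasFDerivAt (ho : o ∈ poincareBall d) {C : ℝ} {g g' : ℝ → ℝ}
    (h : RadialProfile R C g g') {x : Coord d} (hx : x ∈ hball o R) :
    HasFDerivAt (radial o g)
      (g' (hdist o x) • Complex.ofRealCLM.comp (innerSL ℝ (distGrad o x))) x := by
  rcases eq_or_ne x o with rfl | hxo
  · have e : g' (hdist x x) • Complex.ofRealCLM.comp (innerSL ℝ (distGrad x x)) = 0 := by
      ext v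
      simp [hdist_self, h.dzero]
    rw [e, hasFDerivAt_iff_isLittleO_nhds_zero]
    obtain ⟨K, hK0, hK⟩ := exists_hdist_le ho
    have h1 := (tendsto_hdist_self ho).eventually h.zero
    have h2 : Tendsto (fun v : Coord d => x + v) (𝓝 0) (𝓝 x) := by
      have : Continuous fun v : Coord d => x + v := by fun_prop
      simpa using this.tendsto 0
    have hC : 0 ≤ |C| * K ^ 2 := by positivity
    rw [Asymptotics.isLittleO_iff]
    intro c hc
    have hb : Metric.ball (0 : Coord d) (c / (|C| * K ^ 2 + 1)) ∈ 𝓝 (0 : Coord d) :=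
      Metric.ball_mem_nhds _ (by positivity)
    filter_upwards [h2.eventually h1, h2.eventually hK, hb] with v h3 h4 h5
    rw [add_sub_cancel_left] at h4
    rw [Metric.mem_ball, dist_zero_right, lt_div_iff₀ (by positivity)] at h5
    simp only [radial, hdist_self, zero_apply, sub_zero]
    rw [← Complex.ofReal_sub, Complex.norm_real, Real.norm_eq_abs]
    refine h3.trans ?_
    have h6 := pow_le_pow_left₀ (hdist_nonneg x (x + v)) h4 2
    calc C * hdist x (x + v) ^ 2 ≤ |C| * (K * ‖v‖) ^ 2 := by
          gcongr
          exact le_abs_self C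
      _ = (‖v‖ * (|C| * K ^ 2)) * ‖v‖ := by ring
      _ ≤ c * ‖v‖ := by
          refine mul_le_mul_of_nonneg_right ?_ (norm_nonneg v)
          nlinarith [norm_nonneg v]
  · have hpos : 0 < hdist o x := by
      refine lt_of_le_of_ne (hdist_nonneg o x) fun e => hxo ?_
      obtain ⟨T, hT⟩ := exists_isHypSwap ho
      rw [hT.hdist_eq hx.1] at e
      have := tanh_half_hdist_zero (hT.mapsTo x hx.1)
      rw [← e] at this
      simp only [zero_div, Real.tanh_zero] at this
      exact (hT.eq_zero_iff hx.1).1 (norm_eq_zero.1 this.symm)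
    have h1 := (h.deriv _ ⟨hpos, hx.2⟩).comp_hasFDerivAt x (hasFDerivAt_hdist ho hx.1 hxo).1
    have h2 := Complex.ofRealCLM.hasFDerivAt.comp x h1
    convert! h2 using 1
    ext v
    simp

theorem RadialProfile.quadE_lt_top (ho : o ∈ poincareBall d) (hd : 0 < d) {C : ℝ} {g g' : ℝ → ℝ}
    (h : RadialProfile R C g g') {μ M : ℝ} (hμ : 0 ≤ μ) {W : ℝ → ℝ} (hW : Measurable W)
    (hM : ∀ r, W r ≤ M) (hM0 : 0 ≤ M) :
    quadE μ W o R (radial o g) (radGrad o g') < ⊤ := by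
  have hm := h.aestronglyMeasurable (d - 1)
  rw [quadE_radial ho hd μ hW hm.1 hm.2]
  refine ENNReal.mul_lt_top (measure_lt_top _ _) ?_
  have h1 : ∫⁻ r, ENNReal.ofReal (μ * g' r ^ 2 + W r * g r ^ 2) ∂(radMeas (d - 1) R) ≤
      ∫⁻ _, ENNReal.ofReal (μ * C ^ 2 + M * C ^ 2) ∂(radMeas (d - 1) R) := by
    refine lintegral_mono_ae (ae_radMeas_of_forall fun r hr => ENNReal.ofReal_le_ofReal ?_)
    have h2 := pow_le_pow_left₀ (abs_nonneg _) (h.bound r ⟨hr.1.le, hr.2⟩) 2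
    have h3 := pow_le_pow_left₀ (abs_nonneg _) (h.dbound r ⟨hr.1.le, hr.2⟩) 2
    rw [sq_abs] at h2 h3
    have := hM r
    gcongr
  refine h1.trans_lt ?_
  rw [lintegral_const]
  exact ENNReal.mul_lt_top ENNReal.ofReal_lt_top (measure_lt_top _ _)

theorem RadialProfile.isWeakDifferential (ho : o ∈ poincareBall d) (hd : 2 ≤ d) {C : ℝ}
    {g g' : ℝ → ℝ} (h : RadialProfile R C g g') :
    IsWeakDifferential (hball o R) (radial o g) (radGrad o g') := by
  have hm := h.aestronglyMeasurable (d - 1)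
  have hd0 : 0 < d := by omega
  obtain ⟨h1, h2⟩ := locallyIntegrableOn_of_quadE hd
    ((aestronglyMeasurable_radial ho hd0 hm.1).mono_measure (volume_restrict_le o R))
    ((aestronglyMeasurable_radGrad ho hd0 hm.2).mono_measure (volume_restrict_le o R))
    (h.quadE_lt_top ho hd0 zero_le_one measurable_const (M := 1) (fun _ => le_rfl) zero_le_one)
  refine isWeakDifferential_of_hasFDerivAt h1 h2 (fun x hx => h.hasFDerivAt ho hx) fun x _ i => ?_
  simp [radGrad, toC, EuclideanSpace.inner_single_right]

theorem RadialProfile.memH1 (ho : o ∈ poincareBall d) (hd : 2 ≤ d) {C : ℝ}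
    {g g' : ℝ → ℝ} (h : RadialProfile R C g g') : MemH1 (hball o R) (radial o g) :=
  (memH1_iff ho).2 ⟨_, h.isWeakDifferential ho hd, h.quadE_lt_top ho (by omega) zero_le_one
    measurable_const (M := 1) (fun _ => le_rfl) zero_le_one⟩

theorem _root_.MeasureTheory.LocallyIntegrableOn.congr_ae {E : Type*} [NormedAddCommGroup E]
    {U : Set (Coord d)} {u v : Coord d → E}
    (h : LocallyIntegrableOn u U volume) (huv : u =ᵐ[volume.restrict U] v) :
    LocallyIntegrableOn v U volume := fun x hx => by
  obtain ⟨s, hs, hi⟩ := h x hx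
  refine ⟨s ∩ U, inter_mem hs self_mem_nhdsWithin, ?_⟩
  have h1 : IntegrableOn u (s ∩ U) := hi.mono_set inter_subset_left
  refine h1.congr ?_
  exact ae_restrict_of_ae_restrict_of_subset inter_subset_right huv

theorem IsWeakDifferential.congr_ae {U : Set (Coord d)} {u v : Coord d → ℂ}
    {G K : Coord d → EuclideanSpace ℂ (Fin d)} (h : IsWeakDifferential U u G)
    (huv : u =ᵐ[volume.restrict U] v) (hGK : G =ᵐ[volume.restrict U] K) :
    IsWeakDifferential U v K := by
  refine ⟨h.1.congr_ae huv, h.2.1.congr_ae hGK, fun ψ hψ i => ?_⟩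
  have h1 : ∫ x in U, ((pderiv i ψ x : ℝ) : ℂ) * v x = ∫ x in U, ((pderiv i ψ x : ℝ) : ℂ) * u x :=
    integral_congr_ae (by filter_upwards [huv] with x hx; rw [hx])
  have h2 : ∫ x in U, (ψ x : ℂ) * K x i = ∫ x in U, (ψ x : ℂ) * G x i :=
    integral_congr_ae (by filter_upwards [hGK] with x hx; rw [hx])
  rw [h1, h2]
  exact h.2.2 ψ hψ i

theorem IsWeakDifferential.congr_on {U : Set (Coord d)} (hU : MeasurableSet U) {u v : Coord d → ℂ}
    {G : Coord d → EuclideanSpace ℂ (Fin d)} (h : IsWeakDifferential U u G) (huv : EqOn u v U) :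
    IsWeakDifferential U v G :=
  h.congr_ae ((ae_restrict_iff' hU).2 (.of_forall fun _ hx => huv hx)) ae_eq_rfl

end Radial

/-! ### Radial functions in H¹₀. -/

section RadialZero

variable {d : ℕ} {o : Coord d} {R : ℝ}

/-- A continuous cutoff function, supported in `[(n+1)⁻¹, R - (n+1)⁻¹]`. -/
def cutoff (R : ℝ) (n : ℕ) (r : ℝ) : ℝ := max 0 (min 1 ((n + 1 : ℝ) * min r (R - r) - 1))

theorem continuous_cutoff (R : ℝ) (n : ℕ) : Continuous (cutoff R n) := by
  unfold cutoff
  fun_prop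

theorem cutoff_nonneg (R : ℝ) (n : ℕ) (r : ℝ) : 0 ≤ cutoff R n r := le_max_left _ _

theorem cutoff_le_one (R : ℝ) (n : ℕ) (r : ℝ) : cutoff R n r ≤ 1 :=
  max_le zero_le_one (min_le_left _ _)

theorem support_cutoff (R : ℝ) (n : ℕ) :
    Function.support (cutoff R n) ⊆ Icc (n + 1 : ℝ)⁻¹ (R - (n + 1 : ℝ)⁻¹) := by
  intro r hr
  by_contra h
  refine hr (max_eq_left ((min_le_right _ _).trans ?_))
  have hn : (0 : ℝ) < n + 1 := by positivity
  have h1 : min r (R - r) ≤ (n + 1 : ℝ)⁻¹ := by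
    by_contra! h2
    rw [lt_min_iff] at h2
    exact h ⟨h2.1.le, by linarith [h2.2]⟩
  have h3 := mul_le_mul_of_nonneg_left h1 hn.le
  rw [mul_inv_cancel₀ hn.ne'] at h3
  linarith

theorem tendsto_cutoff {r : ℝ} (hr : r ∈ Ioo 0 R) :
    Tendsto (fun n => cutoff R n r) atTop (𝓝 1) := by
  have hm : 0 < min r (R - r) := lt_min hr.1 (sub_pos.2 hr.2)
  have h1 : Tendsto (fun n : ℕ => (n + 1 : ℝ) * min r (R - r)) atTop atTop :=
    (tendsto_atTop_add_const_right _ _ tendsto_natCast_atTop_atTop).atTop_mul_const hm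
  refine tendsto_const_nhds.congr' ?_
  filter_upwards [h1.eventually_ge_atTop 2] with n hn
  rw [cutoff, min_eq_left (by linarith), max_eq_right zero_le_one]

/-- The derivative of the profile is continuous only on the open interval; cutting it off makes it
continuous on the line and thus open to smooth approximation. -/
theorem continuous_cutoff_mul {h : ℝ → ℝ} (hh : ContinuousOn h (Ioo 0 R)) (n : ℕ) :
    Continuous fun r => cutoff R n r * h r := by
  have hn : (0 : ℝ) < (n + 1 : ℝ)⁻¹ := by positivity
  have hs : tsupport (fun r => cutoff R n r * h r) ⊆ Ioo 0 R := by
    refine (closure_minimal ((Function.support_mul_subset_left _ _).trans (support_cutoff R n))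
      isClosed_Icc).trans fun r hr => ⟨hn.trans_le hr.1, hr.2.trans_lt (by linarith)⟩
  refine continuous_of_tsupport fun r hr => ?_
  have := hh.continuousAt (isOpen_Ioo.mem_nhds (hs hr))
  exact (continuous_cutoff R n).continuousAt.mul this

/-- Integrating from R makes the primitive vanish near R and constant near 0, the two conditions for
a smooth radial profile to define a test function. -/
theorem primitive_of_support {k : ℝ → ℝ} (hc : Continuous k) {ε : ℝ} (hε : 0 < ε)
    (hk : Function.support k ⊆ Icc ε (R - ε)) :
    (∀ r, R - ε ≤ r → ∫ t in R..r, k t = 0) ∧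
    (∀ r, r < ε → ∫ t in R..r, k t = ∫ t in R..(0 : ℝ), k t) := by
  have hz : ∀ t, t ∉ Icc ε (R - ε) → k t = 0 := fun t ht => by
    by_contra h
    exact ht (hk h)
  constructor
  · intro r hr
    refine intervalIntegral.integral_zero_ae (.of_forall fun t ht => hz t fun h => ?_)
    exact absurd (ht.1.trans_le h.2) (not_lt.2 (le_min (by linarith) hr))
  · intro r hr
    have h1 : ∫ t in (0 : ℝ)..r, k t = 0 := by
      refine intervalIntegral.integral_zero_ae (.of_forall fun t ht => hz t fun h => ?_)
      exact absurd (h.1.trans ht.2) (not_le.2 (max_lt hε hr))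
    rw [← intervalIntegral.integral_add_adjacent_intervals (hc.intervalIntegrable R 0)
      (hc.intervalIntegrable 0 r), h1, add_zero]

/-- Radial functions with a smooth profile that is constant near `0` and vanishes near `R`. -/
theorem isTestFunction_radial (ho : o ∈ poincareBall d) {F : ℝ → ℝ} (hF : ContDiff ℝ ∞ F) {ε : ℝ}
    (hε : 0 < ε) (h0 : ∀ r, r < ε → F r = F 0) (hR : ∀ r, R - ε ≤ r → F r = 0) :
    IsTestFunction (hball o R)
      (fun x => (((poincareBall d).indicator (fun x => F (hdist o x)) x : ℝ) : ℂ)) := by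
  classical
  -- Outside the unit ball the formula for `hdist` has no geometric meaning, so the profile is cut
  -- to the ball by an indicator.
  set ψ : Coord d → ℝ := (poincareBall d).indicator fun x => F (hdist o x) with hψ
  set K : Set (Coord d) := {x | x ∈ poincareBall d ∧ hdist o x ≤ R - ε} with hK
  have hKc : IsCompact K := isCompact_closed_hball ho (R - ε)
  have hz : ∀ x ∉ K, ψ x = 0 := by
    intro x hx
    by_cases hxb : x ∈ poincareBall d
    · rw [hψ, indicator_of_mem hxb]
      exact hR _ (not_le.1 fun h => hx ⟨hxb, h⟩).le
    · exact indicator_of_notMem hxb _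
  have hsupp : tsupport (fun x => (ψ x : ℂ)) ⊆ K := by
    refine closure_minimal (fun x hx => ?_) hKc.isClosed
    by_contra h
    exact hx (by simp [hz x h])
  refine ⟨?_, HasCompactSupport.of_support_subset_isCompact hKc (subset_closure.trans hsupp),
    hsupp.trans fun x hx => ⟨hx.1, hx.2.trans_lt (by linarith)⟩⟩
  refine Complex.ofRealCLM.contDiff.comp (contDiff_iff_contDiffAt.2 fun x => ?_)
  by_cases hx : x ∈ poincareBall d
  · have hev : ∀ᶠ y in 𝓝 x, ψ y = F (hdist o y) := by
      filter_upwards [isOpen_poincareBall.mem_nhds hx] with y hy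
      exact indicator_of_mem hy _
    refine ContDiffAt.congr_of_eventuallyEq ?_ hev
    -- The distance is not smooth at the centre; there the function is locally constant.
    rcases eq_or_ne x o with rfl | hxo
    · have h1 : ∀ᶠ y in 𝓝 x, F (hdist x y) = F 0 := by
        have h2 := tendsto_nhds_of_tendsto_nhdsWithin (tendsto_hdist_self ho)
        filter_upwards [h2.eventually (gt_mem_nhds hε)] with y hy
        exact h0 _ hy
      exact contDiffAt_const.congr_of_eventuallyEq h1
    · exact hF.contDiffAt.comp x (contDiffAt_hdist ho hx hxo)
  · have hev : ∀ᶠ y in 𝓝 x, ψ y = 0 := by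
      filter_upwards [hKc.isClosed.isOpen_compl.mem_nhds fun h => hx h.1] with y hy
      exact hz y hy
    exact contDiffAt_const.congr_of_eventuallyEq hev

theorem contDiff_primitive {k : ℝ → ℝ} (hk : ContDiff ℝ ∞ k) (a : ℝ) :
    ContDiff ℝ ∞ fun r => ∫ t in a..r, k t := by
  have h1 : ∀ r, HasDerivAt (fun r => ∫ t in a..r, k t) (k r) r := fun r =>
    hk.continuous.integral_hasStrictDerivAt a r |>.hasDerivAt
  rw [contDiff_infty_iff_deriv]
  refine ⟨fun r => (h1 r).differentiableAt, ?_⟩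
  rwa [funext fun r => (h1 r).deriv]

theorem radialProfile_primitive {k : ℝ → ℝ} (hc : Continuous k) {ε C : ℝ} (hε : 0 < ε)
    (hk : Function.support k ⊆ Icc ε (R - ε)) (hC : ∀ r, |k r| ≤ C) (hR : 0 ≤ R) :
    RadialProfile R (C + C * R) (fun r => ∫ t in R..r, k t) k := by
  have hC0 : 0 ≤ C := (abs_nonneg _).trans (hC 0)
  have hz : ∀ t, t ∉ Icc ε (R - ε) → k t = 0 := fun t ht => by
    by_contra h
    exact ht (hk h)
  refine ⟨fun r _ => (hc.integral_hasStrictDerivAt R r).hasDerivAt, fun r hr => ?_, fun r hr => ?_,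
    hz _ fun h => absurd h.1 (not_le.2 hε), ?_⟩
  · have := intervalIntegral.norm_integral_le_of_norm_le_const (a := R) (b := r) (f := k) (C := C)
      fun t _ => hC t
    rw [abs_sub_comm, abs_of_nonneg (sub_nonneg.2 hr.2.le), Real.norm_eq_abs] at this
    have := mul_le_mul_of_nonneg_left (sub_le_self R hr.1) hC0
    linarith
  · have := mul_nonneg hC0 (hr.1.trans hr.2.le)
    linarith [hC r]
  · filter_upwards [mem_nhdsWithin_of_mem_nhds (Iio_mem_nhds hε)] with r hr
    rw [(primitive_of_support hc hε hk).2 r hr, sub_self, abs_zero]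
    positivity

/-- A continuously differentiable radial profile that vanishes at `R` gives a function in
`H¹₀(B_R(o))`. -/
theorem RadialProfile.memH1Zero (ho : o ∈ poincareBall d) (hd : 2 ≤ d) (hR : 0 < R) {C : ℝ}
    {g g' : ℝ → ℝ} (h : RadialProfile R C g g') (hg' : ContinuousOn g' (Ioo 0 R))
    (hg : ContinuousOn g (Icc 0 R)) (hgR : g R = 0) : MemH1Zero (hball o R) (radial o g) := by
  have hd0 : 0 < d := by omega
  have hpos : ∀ n : ℕ, (0 : ℝ) < (n + 1 : ℝ)⁻¹ := fun n => by positivity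
  have hC0 : 0 ≤ C := (abs_nonneg _).trans (h.bound 0 ⟨le_rfl, hR⟩)
  -- The derivative is approximated rather than the function. Primitives from R of the smooth kₙ are
  -- test profiles, and g is itself the primitive of g' from R because g R = 0. Functions and
  -- derivatives then converge pointwise under uniform bounds, and dominated convergence gives H¹
  -- convergence.
  have hk : ∀ n : ℕ, ∃ k : ℝ → ℝ, ContDiff ℝ ∞ k ∧
      (∀ r, dist (k r) (cutoff R n r * g' r) < (n + 1 : ℝ)⁻¹) ∧
      Function.support k ⊆ Icc (n + 1 : ℝ)⁻¹ (R - (n + 1 : ℝ)⁻¹) := by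
    intro n
    obtain ⟨k, h1, h2, h3⟩ := (continuous_cutoff_mul hg' n).exists_contDiff_approx ⊤
      (ε := fun _ => (n + 1 : ℝ)⁻¹) continuous_const fun _ => hpos n
    exact ⟨k, h1, h2, h3.trans ((Function.support_mul_subset_left _ _).trans (support_cutoff R n))⟩
  choose k hks hka hksupp using hk
  have hkC : ∀ n r, |k n r| ≤ C + 1 := by
    intro n r
    by_cases hr : r ∈ Ioo 0 R
    · have h1 : |cutoff R n r * g' r| ≤ C := by
        rw [abs_mul, abs_of_nonneg (cutoff_nonneg R n r)]
        exact (mul_le_of_le_one_left (abs_nonneg _) (cutoff_le_one R n r)).trans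
          (h.dbound r ⟨hr.1.le, hr.2⟩)
      have h2 := hka n r
      rw [Real.dist_eq] at h2
      have h3 : (n + 1 : ℝ)⁻¹ ≤ 1 := inv_le_one_of_one_le₀ (by linarith [n.cast_nonneg (α := ℝ)])
      have h4 := abs_sub_abs_le_abs_sub (k n r) (cutoff R n r * g' r)
      linarith
    · have : k n r = 0 := by
        by_contra h'
        have := hksupp n h'
        exact hr ⟨(hpos n).trans_le this.1, this.2.trans_lt (by linarith [hpos n])⟩
      rw [this, abs_zero]
      linarith
  have hkt : ∀ r ∈ Ioo 0 R, Tendsto (fun n => k n r) atTop (𝓝 (g' r)) := by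
    intro r hr
    have h1 : Tendsto (fun n => cutoff R n r * g' r) atTop (𝓝 (g' r)) := by
      simpa using (tendsto_cutoff hr).mul_const (g' r)
    refine (tendsto_iff_of_dist (squeeze_zero (fun _ => dist_nonneg) (fun n => (hka n r).le)
      ?_)).2 h1
    have := tendsto_one_div_add_atTop_nhds_zero_nat (𝕜 := ℝ)
    simpa using this
  set F : ℕ → ℝ → ℝ := fun n r => ∫ t in R..r, k n t with hF
  have hFt : ∀ r ∈ Ioo 0 R, Tendsto (fun n => F n r) atTop (𝓝 (g r)) := by
    intro r hr
    have h1 : ∫ t in R..r, g' t = g r := by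
      have hi : IntervalIntegrable g' volume r R := by
        refine (intervalIntegrable_const (c := C)).mono_fun' ?_ ?_
        · rw [uIoc_of_le hr.2.le, ← restrict_Ioo_eq_restrict_Ioc]
          exact (aestronglyMeasurable_of_hasDerivAt h.deriv).mono_measure
            (Measure.restrict_mono (Ioo_subset_Ioo_left hr.1.le) le_rfl)
        · rw [uIoc_of_le hr.2.le, ← restrict_Ioo_eq_restrict_Ioc]
          exact (ae_restrict_iff' measurableSet_Ioo).2 (.of_forall fun t ht =>
            h.dbound t ⟨(hr.1.trans ht.1).le, ht.2⟩)
      have := intervalIntegral.integral_eq_sub_of_hasDerivAt_of_le hr.2.le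
        (hg.mono (Icc_subset_Icc_left hr.1.le)) (fun t ht => h.deriv t ⟨hr.1.trans ht.1, ht.2⟩) hi
      rw [intervalIntegral.integral_symm, this, hgR]
      ring
    rw [← h1]
    refine intervalIntegral.tendsto_integral_filter_of_dominated_convergence (fun _ => C + 1)
      (.of_forall fun n => (hks n).continuous.aestronglyMeasurable)
      (.of_forall fun n => .of_forall fun t _ => hkC n t) intervalIntegrable_const ?_
    have hne : ∀ᵐ t : ℝ, t ≠ R := by simp [ae_iff]
    filter_upwards [hne] with t ht htr
    rw [uIoc_of_ge hr.2.le] at htr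
    exact hkt t ⟨hr.1.trans htr.1, lt_of_le_of_ne htr.2 ht⟩
  have hFp := fun n => radialProfile_primitive (hks n).continuous (hpos n) (hksupp n) (hkC n) hR.le
  have hψ := fun n => isTestFunction_radial ho (contDiff_primitive (hks n) R) (hpos n)
    (primitive_of_support (hks n).continuous (hpos n) (hksupp n)).2
    (primitive_of_support (hks n).continuous (hpos n) (hksupp n)).1
  refine ⟨h.memH1 ho hd, _, hψ, ?_⟩
  have hw : ∀ n, IsWeakDifferential (hball o R) (fun x => radial o g x -
      (((poincareBall d).indicator (fun x => F n (hdist o x)) x : ℝ) : ℂ))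
      (radGrad o fun r => g' r - k n r) := fun n =>
    ((h.sub (hFp n)).isWeakDifferential ho hd).congr_on (measurableSet_hball o R) fun x hx => by
      rw [indicator_of_mem hx.1]
      simp [radial, hF]
  have hq : ∀ n, h1NormSq (hball o R) (fun x => radial o g x -
      (((poincareBall d).indicator (fun x => F n (hdist o x)) x : ℝ) : ℂ)) =
      (volume : Measure (Coord d)).toSphere univ *
      ∫⁻ r, ENNReal.ofReal (1 * (g' r - k n r) ^ 2 + 1 * (g r - F n r) ^ 2)
        ∂(radMeas (d - 1) R) := by
    intro n
    have hm := (h.sub (hFp n)).aestronglyMeasurable (d - 1)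
    rw [h1NormSq_eq ho (hw n), ← quadE_radial ho hd0 1 (W := fun _ => 1) measurable_const hm.1 hm.2]
    refine setLIntegral_congr_fun (measurableSet_hball o R) fun x hx => ?_
    beta_reduce
    rw [indicator_of_mem hx.1]
    simp [radial, hF]
  simp_rw [hF] at hq ⊢
  simp_rw [hq]
  have hA : (volume : Measure (Coord d)).toSphere univ ≠ ⊤ := measure_ne_top _ _
  rw [← mul_zero ((volume : Measure (Coord d)).toSphere univ)]
  refine ENNReal.Tendsto.const_mul ?_ (.inr hA)
  set D := C + ((C + 1) + (C + 1) * R) with hD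
  have hlim := tendsto_lintegral_of_dominated_convergence' (μ := radMeas (d - 1) R)
    (F := fun n r => ENNReal.ofReal (1 * (g' r - k n r) ^ 2 + 1 * (g r - F n r) ^ 2))
    (f := fun _ => 0) (fun _ => ENNReal.ofReal (D ^ 2 + D ^ 2)) ?_ ?_ ?_ ?_
  · simpa using hlim
  · intro n
    have hm := (h.sub (hFp n)).aestronglyMeasurable (d - 1)
    exact (((hm.2.aemeasurable.pow_const 2).const_mul 1).add
      ((hm.1.aemeasurable.pow_const 2).const_mul 1)).ennreal_ofReal
  · intro n
    refine ae_radMeas_of_forall fun r hr => ENNReal.ofReal_le_ofReal ?_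
    have h2 := pow_le_pow_left₀ (abs_nonneg _) ((h.sub (hFp n)).bound r ⟨hr.1.le, hr.2⟩) 2
    have h3 := pow_le_pow_left₀ (abs_nonneg _) ((h.sub (hFp n)).dbound r ⟨hr.1.le, hr.2⟩) 2
    rw [sq_abs] at h2 h3
    simp only [hF]
    linarith
  · rw [lintegral_const]
    exact (ENNReal.mul_lt_top ENNReal.ofReal_lt_top (measure_lt_top _ _)).ne
  · refine ae_radMeas_of_forall fun r hr => ?_
    have h1 : Tendsto (fun n => 1 * (g' r - k n r) ^ 2 + 1 * (g r - F n r) ^ 2) atTop (𝓝 0) := by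
      have := (((hkt r hr).const_sub (g' r)).pow 2 |>.const_mul 1).add
        (((hFt r hr).const_sub (g r)).pow 2 |>.const_mul 1)
      simpa using this
    have := ENNReal.tendsto_ofReal h1
    simpa using this

end RadialZero

/-! ### Lower bound for the energy with a bounded potential. -/

section LowerBound

theorem ofReal_integral_le_lintegral {α : Type*} [MeasurableSpace α] {ν : Measure α} {f : α → ℝ}
    (hf : Integrable f ν) : ENNReal.ofReal (∫ x, f x ∂ν) ≤ ∫⁻ x, ENNReal.ofReal (f x) ∂ν := by
  rw [integral_eq_lintegral_pos_part_sub_lintegral_neg_part hf]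
  exact (ENNReal.ofReal_le_ofReal (sub_le_self _ ENNReal.toReal_nonneg)).trans
    ENNReal.ofReal_toReal_le

/-- The one-dimensional energy of a function with boundary value `1` is at least that of the
normalised solution. -/
theorem IsBddPotential.ofReal_flux_div_le {n : ℕ} {q : ℝ → ℝ} {M R C : ℝ} (h : IsBddPotential q M)
    (hR : 0 < R) {u u' : ℝ → ℝ} (hc : ContinuousOn u (Icc 0 R))
    (hd : ∀ r ∈ Ioo 0 R, HasDerivAt u (u' r) r) (hb : ∀ r ∈ Ioo 0 R, |u' r| ≤ C) (h1 : u R = 1) :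
    ENNReal.ofReal (flux n q R / prof n q R) ≤
      ∫⁻ r, ENNReal.ofReal (u' r ^ 2 + q r * u r ^ 2) ∂(radMeas n R) := by
  obtain ⟨i₁, e₁⟩ := h.integral_energy (n := n) hR
  obtain ⟨D, hD⟩ := isCompact_Icc.exists_bound_of_continuousOn hc
  have i₂ := h.integrable_weak (n := n) (R := R)
    ((hc.mono Ioo_subset_Icc_self).aestronglyMeasurable measurableSet_Ioo)
    (aestronglyMeasurable_of_hasDerivAt hd) hb fun r hr => hD r (Ioo_subset_Icc_self hr)
  have e₂ := h.integral_weak (n := n) hR hc hd hb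
  rw [h1, mul_one] at e₂
  have hp := h.prof_pos (n := n) R
  have hi := (i₂.const_mul (2 / prof n q R)).sub i₁
  -- With B the bilinear form of the energy and g the normalised solution, B(u, u) ≥ 2 B(g, u) -
  -- B(g, g) pointwise. Since u R = 1, the right side integrates to twice the minimal value minus
  -- itself.
  have e : ∫ r, (2 / prof n q R * (dprof n q r * u' r + q r * prof n q r * u r) -
      ((dprof n q r / prof n q R) ^ 2 + q r * (prof n q r / prof n q R) ^ 2)) ∂(radMeas n R) =
      flux n q R / prof n q R := by
    rw [integral_sub (i₂.const_mul _) i₁, integral_const_mul, e₁, e₂]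
    field_simp
    ring
  rw [← e]
  refine (ofReal_integral_le_lintegral hi).trans (lintegral_mono fun r => ENNReal.ofReal_le_ofReal ?_)
  have h2 := mul_nonneg (h.3 r) (sq_nonneg (prof n q r / prof n q R - u r))
  have h3 := sq_nonneg (dprof n q r / prof n q R - u' r)
  have h4 : 2 / prof n q R * (dprof n q r * u' r + q r * prof n q r * u r) =
      2 * (dprof n q r / prof n q R) * u' r + 2 * q r * (prof n q r / prof n q R) * u r := by
    field_simp
  simp only [Pi.sub_apply, h4]
  linarith

variable {d : ℕ} {o : Coord d} {R : ℝ} {q : ℝ → ℝ} {M μ : ℝ}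

/-- Along each ray the real part of 1 + ψ is a one-dimensional competitor with value 1 at R, whose
derivative is at most the length of the gradient of ψ and whose modulus is at most that of 1 + ψ.
The ray bound is integrated over the sphere, so no symmetrisation is needed. -/
theorem le_quadE_one_add_test (ho : o ∈ poincareBall d) (hd : 2 ≤ d) (hR : 0 < R)
    (hq : IsBddPotential q M) (hμ : 0 ≤ μ) {ψ : Coord d → ℂ} (hψ : IsTestFunction (hball o R) ψ) :
    (volume : Measure (Coord d)).toSphere univ *
        ENNReal.ofReal (μ * (flux (d - 1) q R / prof (d - 1) q R)) ≤
      quadE μ (fun r => μ * q r) o R (fun x => 1 + ψ x) (gradC ψ) := by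
  obtain ⟨T, hT⟩ := exists_isHypSwap ho
  have hd0 : 0 < d := by omega
  have hF : Measurable fun x => ENNReal.ofReal
      (μ * (‖gradC ψ x‖ ^ 2 / conf x ^ 2) + μ * q (hdist o x) * ‖1 + ψ x‖ ^ 2) := by
    have h1 := hψ.continuous_gradC.norm.measurable
    have h2 := (continuous_const.add hψ.1.continuous).norm.measurable (f := fun x => ‖1 + ψ x‖)
    have h3 := measurable_conf (d := d)
    have h4 := hq.2.comp (measurable_hdist o)
    exact ((((h1.pow_const 2).div (h3.pow_const 2)).const_mul μ).add
      ((h4.const_mul μ).mul (h2.pow_const 2))).ennreal_ofReal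
  obtain ⟨C, hC⟩ := hψ.exists_bound
  rw [quadE, hT.lintegral_polar hd0 R hF]
  calc _ = ∫⁻ _ : Metric.sphere (0 : Coord d) 1,
        ENNReal.ofReal (μ * (flux (d - 1) q R / prof (d - 1) q R))
        ∂(volume : Measure (Coord d)).toSphere := by rw [lintegral_const, mul_comm]
    _ ≤ _ := lintegral_mono fun w => ?_
  set γ : ℝ → Coord d := fun r => T (Real.tanh (r / 2) • (w : Coord d)) with hγ
  have hγc : ContinuousOn γ (Icc 0 R) := by
    refine hT.continuousOn.comp (Continuous.continuousOn ?_) fun r _ => tanh_smul_mem r w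
    have : Continuous Real.tanh := by
      have : Real.tanh = fun x => Real.sinh x / Real.cosh x := by
        ext x
        rw [Real.tanh_eq_sinh_div_cosh]
      rw [this]
      exact Real.continuous_sinh.div Real.continuous_cosh fun x => (Real.cosh_pos x).ne'
    fun_prop
  set u : ℝ → ℝ := fun r => 1 + (ψ (γ r)).re with hu
  set u' : ℝ → ℝ := fun r =>
    (fderiv ℝ ψ (γ r) ((conf (γ r) ^ 2)⁻¹ • distGrad o (γ r))).re with hu'
  have huc : ContinuousOn u (Icc 0 R) :=
    continuousOn_const.add
      (Complex.continuous_re.comp_continuousOn (hψ.1.continuous.comp_continuousOn hγc))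
  have hud : ∀ r ∈ Ioo 0 R, HasDerivAt u (u' r) r := by
    intro r hr
    have h1 := (hψ.1.differentiable (by simp) (γ r)).hasFDerivAt.comp_hasDerivAt r
      (hT.hasDerivAt_polar ho hr.1 w)
    exact (Complex.reCLM.hasFDerivAt.comp_hasDerivAt r h1).const_add 1
  have hub : ∀ r ∈ Ioo 0 R, |u' r| ≤ ‖gradC ψ (γ r)‖ / conf (γ r) := by
    intro r hr
    have hm : γ r ∈ poincareBall d := (hT.polar_mem hr.1.le hr.2 w).1
    have hc := conf_pos hm
    refine (Complex.abs_re_le_norm _).trans ((ContinuousLinearMap.le_opNorm _ _).trans ?_)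
    rw [norm_smul, (hasFDerivAt_hdist ho hm (hT.polar_ne hr.1 w)).2,
      Real.norm_of_nonneg (by positivity)]
    calc ‖fderiv ℝ ψ (γ r)‖ * ((conf (γ r) ^ 2)⁻¹ * conf (γ r)) =
        ‖fderiv ℝ ψ (γ r)‖ / conf (γ r) := by field_simp
      _ ≤ _ := by
        gcongr
        exact norm_fderiv_le_gradC ψ _
  have huR : u R = 1 := by
    have : ψ (γ R) = 0 := by
      refine image_eq_zero_of_notMem_tsupport fun h => ?_
      have := (hψ.2.2 h).2
      rw [hT.hdist_polar hR.le w] at this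
      exact lt_irrefl _ this
    simp [hu, this]
  have key := hq.ofReal_flux_div_le (n := d - 1) hR huc hud (C := C) (fun r hr =>
    (hub r hr).trans ((div_le_self (norm_nonneg _) (by
      have := two_le_conf (hT.polar_mem hr.1.le hr.2 w).1
      simp only [hγ]
      linarith)).trans (hC _).2)) huR
  rw [ENNReal.ofReal_mul hμ]
  refine (mul_le_mul_right key _).trans ?_
  rw [← lintegral_const_mul' _ _ ENNReal.ofReal_ne_top]
  refine lintegral_mono_ae (ae_radMeas_of_forall fun r hr => ?_)
  rw [← ENNReal.ofReal_mul hμ]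
  refine ENNReal.ofReal_le_ofReal ?_
  have h1 := pow_le_pow_left₀ (abs_nonneg _) (hub r hr) 2
  rw [sq_abs, div_pow] at h1
  have h2 : u r ^ 2 ≤ ‖1 + ψ (γ r)‖ ^ 2 := by
    have := pow_le_pow_left₀ (abs_nonneg _) (Complex.abs_re_le_norm (1 + ψ (γ r))) 2
    rw [sq_abs] at this
    simpa [hu] using this
  rw [hT.hdist_polar hr.1.le w]
  have h3 := mul_le_mul_of_nonneg_left h2 (hq.3 r)
  have h4 := mul_le_mul_of_nonneg_left (add_le_add h1 h3) hμ
  refine h4.trans (le_of_eq ?_)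
  ring

/-- The H¹ norm controls the energy because q is bounded. The approximation by test functions uses
this, which is why the lower bound is first proved for bounded potentials. -/
theorem quadE_le_mul (hq : IsBddPotential q M) (hμ : 0 ≤ μ)
    (u : Coord d → ℂ) (G : Coord d → EuclideanSpace ℂ (Fin d)) :
    quadE μ (fun r => μ * q r) o R u G ≤
      ENNReal.ofReal (μ * (1 + M)) * quadE 1 (fun _ => 1) o R u G := by
  have hM := hq.1
  rw [quadE, quadE, ← lintegral_const_mul' _ _ ENNReal.ofReal_ne_top]
  refine lintegral_mono fun x => ?_
  rw [← ENNReal.ofReal_mul (by positivity)]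
  refine ENNReal.ofReal_le_ofReal ?_
  have h1 : 0 ≤ μ * M * (‖G x‖ ^ 2 / conf x ^ 2) := by positivity
  have h2 : 0 ≤ μ * ‖u x‖ ^ 2 := by positivity
  have h3 := mul_le_mul_of_nonneg_left (mul_le_mul_of_nonneg_right (hq.4 (hdist o x))
    (sq_nonneg ‖u x‖)) hμ
  nlinarith

/-- The normalised solution gives a lower bound for the energy of all admissible functions. -/
theorem Admissible.le_quadE (ho : o ∈ poincareBall d) (hd : 2 ≤ d) (hR : 0 < R)
    (hq : IsBddPotential q M) (hμ : 0 ≤ μ) {χ : Coord d → ℂ} (hχ : Admissible o R χ)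
    {G : Coord d → EuclideanSpace ℂ (Fin d)} (hG : IsWeakDifferential (hball o R) χ G) :
    (volume : Measure (Coord d)).toSphere univ *
        ENNReal.ofReal (μ * (flux (d - 1) q R / prof (d - 1) q R)) ≤
      quadE μ (fun r => μ * q r) o R χ G := by
  obtain ⟨-, -, ψ, hψ, ht⟩ := hχ
  have hw : ∀ n, IsWeakDifferential (hball o R) (fun x => χ x - 1 - ψ n x)
      (fun x => G x - gradC (ψ n) x) := by
    intro n
    have := (hG.sub (isWeakDifferential_const 1)).sub (hψ n).isWeakDifferential
    simpa using this
  simp_rw [fun n => h1NormSq_eq ho (hw n)] at ht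
  have hW : Measurable fun r => μ * q r := hq.2.const_mul μ
  have hW0 : ∀ r, 0 ≤ r → 0 ≤ μ * q r := fun r _ => mul_nonneg hμ (hq.3 r)
  set E := quadE μ (fun r => μ * q r) o R χ G with hE
  set e := (volume : Measure (Coord d)).toSphere univ *
        ENNReal.ofReal (μ * (flux (d - 1) q R / prof (d - 1) q R)) with he
  -- The competitor 1 + ψₙ is χ minus the small error χ - 1 - ψₙ. Young's inequality with fixed ε
  -- separates the two; then n → ∞, and only afterwards ε → 0.
  have h1 : ∀ ε : ℝ, 0 < ε → e ≤ ENNReal.ofReal (1 + ε) * E := by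
    intro ε hε
    have h2 : ∀ n, e ≤ ENNReal.ofReal (1 + ε) * E + ENNReal.ofReal (1 + ε⁻¹) *
        (ENNReal.ofReal (μ * (1 + M)) * quadE 1 (fun _ => 1) o R (fun x => χ x - 1 - ψ n x)
          (fun x => G x - gradC (ψ n) x)) := by
      intro n
      have h3 := quadE_add_le hμ hW hW0 (v := fun x => -1 * (χ x - 1 - ψ n x))
        (K := fun x => (-1 : ℂ) • (G x - gradC (ψ n) x)) hG.aestronglyMeasurable.1
        hG.aestronglyMeasurable.2 hε
      rw [quadE_const_mul] at h3
      have h4 := le_quadE_one_add_test ho hd hR hq hμ (hψ n)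
      have e1 : (fun x => χ x + -1 * (χ x - 1 - ψ n x)) = fun x => 1 + ψ n x := by
        ext x
        ring
      have e2 : (fun x => G x + (-1 : ℂ) • (G x - gradC (ψ n) x)) = gradC (ψ n) := by
        ext1 x
        rw [neg_smul, one_smul]
        abel
      rw [e1, e2] at h3
      simp only [norm_neg, norm_one, one_pow, ENNReal.ofReal_one, one_mul] at h3
      refine h4.trans (h3.trans ?_)
      gcongr
      exact quadE_le_mul hq hμ _ _
    refine ge_of_tendsto' (x := atTop) ?_ h2
    have h5 := ENNReal.Tendsto.const_mul (ENNReal.Tendsto.const_mul ht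
      (.inr (ENNReal.ofReal_ne_top (r := μ * (1 + M))))) (.inr (ENNReal.ofReal_ne_top (r := 1 + ε⁻¹)))
    simpa using tendsto_const_nhds.add h5
  rcases eq_or_ne E ⊤ with hT | hT
  · rw [hT]
    exact le_top
  have h6 : Tendsto (fun n : ℕ => ENNReal.ofReal (1 + 1 / ((n : ℝ) + 1)) * E) atTop (𝓝 E) := by
    have h7 := ENNReal.tendsto_ofReal
      ((tendsto_one_div_add_atTop_nhds_zero_nat (𝕜 := ℝ)).const_add 1)
    simpa using ENNReal.Tendsto.mul_const h7 (.inr hT)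
  exact ge_of_tendsto' h6 fun n => h1 _ (by positivity)

end LowerBound

/-! ### Truncated potentials and convergence of their solutions. -/

section Profile

variable {μ : ℝ} {V : ℝ → ℝ} {n : ℕ} {R : ℝ}

/-- The bounded potentials `min(V, k) / (2μ)`. -/
def truncPot (μ : ℝ) (V : ℝ → ℝ) (k : ℕ) (r : ℝ) : ℝ := min (max (V r) 0) k / (2 * μ)

/-- The positive part in the truncation matters only at negative arguments, where V is unconstrained
in the later results. -/
theorem isBddPotential_truncPot (hμ : 0 < μ) (hV : Measurable V) (k : ℕ) :
    IsBddPotential (truncPot μ V k) (k / (2 * μ)) where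
  bound_nonneg := by positivity
  measurable := ((hV.max measurable_const).min measurable_const).div_const _
  nonneg r := by
    have : 0 ≤ min (max (V r) 0) (k : ℝ) := le_min (le_max_right _ _) k.cast_nonneg
    rw [truncPot]
    positivity
  le r := div_le_div_of_nonneg_right (min_le_right _ _) (by positivity)

theorem truncPot_mono (hμ : 0 < μ) (V : ℝ → ℝ) {j k : ℕ} (hjk : j ≤ k) (r : ℝ) :
    truncPot μ V j r ≤ truncPot μ V k r :=
  div_le_div_of_nonneg_right (min_le_min_left _ (Nat.cast_le.2 hjk)) (by positivity)

theorem mul_truncPot_le (hμ : 0 < μ) (k : ℕ) {r : ℝ} (hr : 0 ≤ V r) :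
    μ * truncPot μ V k r ≤ 1 / 2 * V r := by
  have h1 : min (max (V r) 0) (k : ℝ) ≤ V r := (min_le_left _ _).trans (max_eq_left hr).le
  have h2 : μ * truncPot μ V k r = 1 / 2 * min (max (V r) 0) (k : ℝ) := by
    rw [truncPot]
    field_simp
  rw [h2]
  linarith

theorem tendsto_mul_truncPot (hμ : 0 < μ) {r : ℝ} (hr : 0 ≤ V r) :
    Tendsto (fun k => μ * truncPot μ V k r) atTop (𝓝 (1 / 2 * V r)) := by
  refine tendsto_const_nhds.congr' ?_
  filter_upwards [tendsto_natCast_atTop_atTop.eventually_ge_atTop (V r)] with k hk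
  rw [truncPot, max_eq_left hr, min_eq_left hk]
  field_simp

/-- The logarithmic derivative at `R` of the solution, up to the factor `sinhⁿ R`. -/
def fluxRatio (n : ℕ) (R : ℝ) (q : ℝ → ℝ) : ℝ := flux n q R / prof n q R

/-- The normalised solution, with value `1` at `R`. -/
def nprof (n : ℕ) (R : ℝ) (q : ℝ → ℝ) (r : ℝ) : ℝ := prof n q r / prof n q R

/-- The derivative of the normalised solution. -/
def ndprof (n : ℕ) (R : ℝ) (q : ℝ → ℝ) (r : ℝ) : ℝ := dprof n q r / prof n q R

/-- The radial profile of the minimiser. -/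
def minProfile (μ : ℝ) (V : ℝ → ℝ) (n : ℕ) (R r : ℝ) : ℝ := ⨅ k, nprof n R (truncPot μ V k) r

theorem fluxRatio_mono (hμ : 0 < μ) (hV : Measurable V) (n : ℕ) (hR : 0 < R) :
    Monotone fun k => fluxRatio n R (truncPot μ V k) := fun j k hjk => by
  have hj := isBddPotential_truncPot hμ hV j
  have hk := isBddPotential_truncPot hμ hV k
  have := flux_mul_prof_le (n := n) hj hk (truncPot_mono hμ V hjk) hR
  beta_reduce
  rw [fluxRatio, fluxRatio, div_le_div_iff₀ (hj.prof_pos R) (hk.prof_pos R)]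
  exact this

theorem nprof_pos (hμ : 0 < μ) (hV : Measurable V) (n : ℕ) (R : ℝ) (k : ℕ) (r : ℝ) :
    0 < nprof n R (truncPot μ V k) r :=
  have h := isBddPotential_truncPot hμ hV k
  div_pos (h.prof_pos r) (h.prof_pos R)

theorem nprof_antitone (hμ : 0 < μ) (hV : Measurable V) (n : ℕ) {r : ℝ} (hr : 0 ≤ r) (hR : r ≤ R) :
    Antitone fun k => nprof n R (truncPot μ V k) r := fun _ _ hjk =>
  prof_div_le (isBddPotential_truncPot hμ hV _) (isBddPotential_truncPot hμ hV _)
    (truncPot_mono hμ V hjk) hr hR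

theorem nprof_mono (hμ : 0 < μ) (hV : Measurable V) (n : ℕ) (R : ℝ) (k : ℕ) :
    Monotone (nprof n R (truncPot μ V k)) := fun _ _ hrs =>
  have h := isBddPotential_truncPot hμ hV k
  div_le_div_of_nonneg_right (prof_mono h.1 h.4 hrs) (h.prof_pos R).le

theorem nprof_self (hμ : 0 < μ) (hV : Measurable V) (n : ℕ) (R : ℝ) (k : ℕ) :
    nprof n R (truncPot μ V k) R = 1 :=
  div_self ((isBddPotential_truncPot hμ hV k).prof_pos R).ne'

theorem nprof_le_one (hμ : 0 < μ) (hV : Measurable V) (n : ℕ) (k : ℕ) {r : ℝ} (hR : r ≤ R) :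
    nprof n R (truncPot μ V k) r ≤ 1 :=
  (nprof_mono hμ hV n R k hR).trans (nprof_self hμ hV n R k).le

theorem bddBelow_nprof (hμ : 0 < μ) (hV : Measurable V) (n : ℕ) (R r : ℝ) :
    BddBelow (range fun k => nprof n R (truncPot μ V k) r) :=
  ⟨0, forall_mem_range.2 fun k => (nprof_pos hμ hV n R k r).le⟩

theorem tendsto_nprof (hμ : 0 < μ) (hV : Measurable V) (n : ℕ) {r : ℝ} (hr : 0 ≤ r) (hR : r ≤ R) :
    Tendsto (fun k => nprof n R (truncPot μ V k) r) atTop (𝓝 (minProfile μ V n R r)) :=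
  tendsto_atTop_ciInf (nprof_antitone hμ hV n hr hR) (bddBelow_nprof hμ hV n R r)

theorem minProfile_nonneg (hμ : 0 < μ) (hV : Measurable V) (n : ℕ) (R r : ℝ) :
    0 ≤ minProfile μ V n R r := le_ciInf fun k => (nprof_pos hμ hV n R k r).le

theorem minProfile_le_one (hμ : 0 < μ) (hV : Measurable V) (n : ℕ) {r : ℝ} (hR : r ≤ R) :
    minProfile μ V n R r ≤ 1 :=
  (ciInf_le (bddBelow_nprof hμ hV n R r) 0).trans (nprof_le_one hμ hV n 0 hR)

theorem minProfile_mono (hμ : 0 < μ) (hV : Measurable V) (n : ℕ) (R : ℝ) :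
    Monotone (minProfile μ V n R) := fun r _ hrs =>
  ciInf_mono (bddBelow_nprof hμ hV n R r) fun k => nprof_mono hμ hV n R k hrs

/-- The constant is the sum of the three bounds needed: 1 for the values, M R for the derivative and
M for the quadratic estimate at 0. -/
theorem radialProfile_nprof {q : ℝ → ℝ} {M : ℝ} (hq : IsBddPotential q M) (n : ℕ) (hR : 0 < R) :
    RadialProfile R (1 + M * R + M) (nprof n R q) (ndprof n R q) := by
  have hM := hq.1
  have hp := hq.prof_pos (n := n) R
  refine ⟨fun r hr => (hq.hasDerivAt_prof hr.1).div_const _, fun r hr => ?_, fun r hr => ?_, ?_, ?_⟩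
  · rw [nprof, abs_div, abs_of_pos hp, div_le_iff₀ hp]
    refine (hq.abs_prof_le hr.2.le).trans (le_mul_of_one_le_left hp.le ?_)
    have : 0 ≤ M * R := by positivity
    linarith
  · rw [ndprof, abs_div, abs_of_pos hp, div_le_iff₀ hp]
    refine (hq.abs_dprof_le hr.1 hr.2.le).trans (mul_le_mul_of_nonneg_right ?_ hp.le)
    linarith
  · simp [ndprof, dprof, flux_zero]
  · filter_upwards [self_mem_nhdsWithin, mem_nhdsWithin_of_mem_nhds (Iio_mem_nhds hR)] with r h0 h1
    rw [nprof, nprof, ← sub_div, abs_div, abs_of_pos hp, div_le_iff₀ hp]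
    refine (abs_prof_sub_one_le hq.1 hq.2 hq.3 hq.4 h0 (le_of_lt h1)).trans ?_
    have : 0 ≤ (1 + M * R) * prof n q R * r ^ 2 := by positivity
    linarith

/-- The derivatives of the normalised solutions converge in `L²`. -/
theorem exists_tendsto_ndprof (hμ : 0 < μ) (hV : Measurable V) (n : ℕ) (hR : 0 < R) {m : ℝ}
    (hm : Tendsto (fun k => fluxRatio n R (truncPot μ V k)) atTop (𝓝 m)) :
    ∃ h : ℝ → ℝ, MemLp h 2 (radMeas n R) ∧ Tendsto (fun k => ∫⁻ r, ENNReal.ofReal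
      (‖ndprof n R (truncPot μ V k) r - h r‖ ^ 2) ∂(radMeas n R)) atTop (𝓝 0) := by
  have hb := isBddPotential_truncPot hμ hV
  have hmem : ∀ k, MemLp (ndprof n R (truncPot μ V k)) 2 (radMeas n R) := fun k =>
    MemLp.of_bound ((radialProfile_nprof (hb k) n hR).aestronglyMeasurable n).2 _
      (ae_radMeas_of_forall fun r hr =>
        (radialProfile_nprof (hb k) n hR).dbound r ⟨hr.1.le, hr.2⟩)
  -- Increments of a convergent monotone sequence of flux ratios dominate the squared L² distances,
  -- so the derivatives are Cauchy and completeness provides h.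
  have hle : ∀ j k, j ≤ k → ∫⁻ r, ENNReal.ofReal (‖ndprof n R (truncPot μ V j) r -
      ndprof n R (truncPot μ V k) r‖ ^ 2) ∂(radMeas n R) ≤
      ENNReal.ofReal (fluxRatio n R (truncPot μ V k) - fluxRatio n R (truncPot μ V j)) := by
    intro j k hjk
    obtain ⟨h1, h2⟩ := integral_sq_sub_le (n := n) (hb j) (hb k) (truncPot_mono hμ V hjk) hR
    simp only [Real.norm_eq_abs, sq_abs, ndprof]
    rw [← ofReal_integral_eq_lintegral_ofReal h1 (.of_forall fun r => sq_nonneg _)]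
    exact ENNReal.ofReal_le_ofReal h2
  have hle' : ∀ N j k, N ≤ j → j ≤ k → ∫⁻ r, ENNReal.ofReal (‖ndprof n R (truncPot μ V j) r -
      ndprof n R (truncPot μ V k) r‖ ^ 2) ∂(radMeas n R) ≤
      ENNReal.ofReal (m - fluxRatio n R (truncPot μ V N)) := by
    intro N j k hj hk
    refine (hle j k hk).trans (ENNReal.ofReal_le_ofReal ?_)
    have h1 := (fluxRatio_mono hμ hV n hR).ge_of_tendsto hm k
    have h2 := fluxRatio_mono hμ hV n hR hj
    dsimp only at h1 h2
    linarith
  set g : ℕ → Lp ℝ 2 (radMeas n R) := fun k => (hmem k).toLp with hg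
  have hed : ∀ j k, edist (g j) (g k) = (∫⁻ r, ENNReal.ofReal (‖ndprof n R (truncPot μ V j) r -
      ndprof n R (truncPot μ V k) r‖ ^ 2) ∂(radMeas n R)) ^ (1 / 2 : ℝ) := by
    intro j k
    rw [hg, Lp.edist_toLp_toLp, eLpNorm_two_sq]
    rfl
  have hc : CauchySeq g := by
    rw [EMetric.cauchySeq_iff_le_tendsto_0]
    refine ⟨fun N => ENNReal.ofReal (m - fluxRatio n R (truncPot μ V N)) ^ (1 / 2 : ℝ), fun j k N hj hk => ?_, ?_⟩
    · rcases le_total j k with hjk | hjk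
      · rw [hed]
        exact ENNReal.rpow_le_rpow (hle' N j k hj hjk) (by norm_num)
      · rw [edist_comm, hed]
        exact ENNReal.rpow_le_rpow (hle' N k j hk hjk) (by norm_num)
    · have h1 := ENNReal.tendsto_ofReal (hm.const_sub m)
      rw [sub_self, ENNReal.ofReal_zero] at h1
      have h2 := (ENNReal.continuous_rpow_const (y := (1 / 2 : ℝ))).tendsto 0
      rw [ENNReal.zero_rpow_of_pos (by norm_num)] at h2
      exact h2.comp h1
  obtain ⟨h, hh⟩ := cauchySeq_tendsto_of_complete hc
  refine ⟨h, Lp.memLp h, ?_⟩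
  rw [tendsto_iff_edist_tendsto_0] at hh
  have h1 : ∀ k, ∫⁻ r, ENNReal.ofReal (‖ndprof n R (truncPot μ V k) r - h r‖ ^ 2) ∂(radMeas n R) =
      edist (g k) h ^ (2 : ℝ) := by
    intro k
    have : edist (g k) h = eLpNorm (fun r => ndprof n R (truncPot μ V k) r - h r) 2 (radMeas n R) := by
      rw [Lp.edist_def]
      refine eLpNorm_congr_ae ?_
      filter_upwards [(hmem k).coeFn_toLp] with r hr
      simp [hg, hr]
    rw [this, eLpNorm_two_sq, ← ENNReal.rpow_mul]
    norm_num
  simp_rw [h1]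
  have h2 := (ENNReal.continuous_rpow_const (y := (2 : ℝ))).tendsto 0
  rw [ENNReal.zero_rpow_of_pos (by norm_num)] at h2
  exact h2.comp hh

theorem measurable_minProfile (μ : ℝ) (V : ℝ → ℝ) (n : ℕ) (R : ℝ) :
    Measurable (minProfile μ V n R) :=
  Measurable.iInf fun k => (measurable_prof n (truncPot μ V k)).div_const _

/-- The energy density of the normalised solutions. -/
def nenergy (μ : ℝ) (n : ℕ) (R : ℝ) (q : ℝ → ℝ) (r : ℝ) : ℝ≥0∞ :=
  ENNReal.ofReal (μ * ndprof n R q r ^ 2 + μ * q r * nprof n R q r ^ 2)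

theorem aemeasurable_nenergy {q : ℝ → ℝ} {M : ℝ} (hq : IsBddPotential q M) (μ : ℝ) (n : ℕ)
    (hR : 0 < R) : AEMeasurable (nenergy μ n R q) (radMeas n R) := by
  obtain ⟨h1, h2⟩ := (radialProfile_nprof hq n hR).aestronglyMeasurable n
  have h3 := hq.2.aemeasurable (μ := radMeas n R)
  exact (((h2.aemeasurable.pow_const 2).const_mul μ).add
    ((h3.const_mul μ).mul (h1.aemeasurable.pow_const 2))).ennreal_ofReal

theorem lintegral_nenergy {q : ℝ → ℝ} {M : ℝ} (hq : IsBddPotential q M) (hμ : 0 ≤ μ) (n : ℕ)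
    (hR : 0 < R) : ∫⁻ r, nenergy μ n R q r ∂(radMeas n R) = ENNReal.ofReal (μ * fluxRatio n R q) := by
  obtain ⟨i, e⟩ := hq.integral_energy (n := n) hR
  rw [fluxRatio, ← e, ← integral_const_mul, ofReal_integral_eq_lintegral_ofReal (i.const_mul μ)]
  · refine lintegral_congr fun r => ?_
    rw [mul_add, nenergy, mul_assoc, ndprof, nprof]
  · refine .of_forall fun r => mul_nonneg hμ ?_
    have := hq.3 r
    positivity

/-- Lower semicontinuity of the energy along the normalised solutions. -/
theorem lintegral_minProfile_le (hμ : 0 < μ) (hV : Measurable V) (hV0 : ∀ r, 0 ≤ r → 0 ≤ V r) (n : ℕ)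
    (hR : 0 < R) {m : ℝ} (hm : Tendsto (fun k => fluxRatio n R (truncPot μ V k)) atTop (𝓝 m))
    {h : ℝ → ℝ} (hh : MemLp h 2 (radMeas n R)) (ht : Tendsto (fun k => ∫⁻ r, ENNReal.ofReal
      (‖ndprof n R (truncPot μ V k) r - h r‖ ^ 2) ∂(radMeas n R)) atTop (𝓝 0)) :
    ∫⁻ r, ENNReal.ofReal (μ * h r ^ 2 + 1 / 2 * V r * minProfile μ V n R r ^ 2) ∂(radMeas n R) ≤
      ENNReal.ofReal (μ * m) := by
  have hb := isBddPotential_truncPot hμ hV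
  have hmeas : ∀ k, AEStronglyMeasurable (ndprof n R (truncPot μ V k)) (radMeas n R) := fun k =>
    ((radialProfile_nprof (hb k) n hR).aestronglyMeasurable n).2
  have h1 : Tendsto (fun k => eLpNorm (ndprof n R (truncPot μ V k) - h) 2 (radMeas n R)) atTop
      (𝓝 0) := by
    have h2 := (ENNReal.continuous_rpow_const (y := (1 / 2 : ℝ))).tendsto 0
    rw [ENNReal.zero_rpow_of_pos (by norm_num)] at h2
    refine (h2.comp ht).congr fun k => ?_
    rw [eLpNorm_two_sq]
    rfl
  -- A subsequence of the derivatives converges almost everywhere. The truncated potentials and the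
  -- profiles converge at every interior radius, so the energy densities converge almost everywhere
  -- and Fatou applies.
  obtain ⟨s, hs, hsub⟩ := (tendstoInMeasure_of_tendsto_eLpNorm two_ne_zero hmeas hh.1
    h1).exists_seq_tendsto_ae
  calc _ = ∫⁻ r, liminf (fun j => nenergy μ n R (truncPot μ V (s j)) r) atTop ∂(radMeas n R) := by
        refine lintegral_congr_ae ?_
        filter_upwards [hsub, ae_radMeas_of_forall (n := n) (R := R)
          (p := fun r => r ∈ Ioo 0 R) fun r hr => hr] with r h4 hr
        refine (Tendsto.liminf_eq (ENNReal.tendsto_ofReal ?_)).symm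
        exact ((h4.pow 2).const_mul μ).add
          (((tendsto_mul_truncPot hμ (hV0 r hr.1.le)).comp hs.tendsto_atTop).mul
            (((tendsto_nprof hμ hV n hr.1.le hr.2.le).comp hs.tendsto_atTop).pow 2))
    _ ≤ liminf (fun j => ∫⁻ r, nenergy μ n R (truncPot μ V (s j)) r ∂(radMeas n R)) atTop :=
        lintegral_liminf_le' fun j => aemeasurable_nenergy (hb (s j)) μ n hR
    _ = ENNReal.ofReal (μ * m) := by
        simp_rw [lintegral_nenergy (hb _) hμ.le n hR]
        exact (ENNReal.tendsto_ofReal ((hm.comp hs.tendsto_atTop).const_mul μ)).liminf_eq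

end Profile

/-! ### Existence of the minimiser. -/

section Minimizer

variable {d : ℕ} {o : Coord d} {R μ m : ℝ} {V : ℝ → ℝ}

/-- Each truncated potential lies below the full one, so every truncated lower bound is a bound for
the full energy and survives the limit k → ∞. -/
theorem Admissible.le_energy (ho : o ∈ poincareBall d) (hd : 2 ≤ d) (hR : 0 < R) (hμ : 0 < μ)
    (hV : Measurable V) (hV0 : ∀ r, 0 ≤ r → 0 ≤ V r)
    (hm : Tendsto (fun k => fluxRatio (d - 1) R (truncPot μ V k)) atTop (𝓝 m))
    {χ : Coord d → ℂ} (hχ : Admissible o R χ) :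
    (volume : Measure (Coord d)).toSphere univ * ENNReal.ofReal (μ * m) ≤ energy μ V o R χ := by
  obtain ⟨G, hG, -⟩ := (memH1_iff ho).1 hχ.1
  rw [energy_eq ho μ V hG]
  have h1 := ENNReal.Tendsto.const_mul (ENNReal.tendsto_ofReal (hm.const_mul μ))
    (.inr (measure_ne_top (volume : Measure (Coord d)).toSphere univ))
  refine le_of_tendsto' h1 fun k => ?_
  refine (hχ.le_quadE ho hd hR (isBddPotential_truncPot hμ hV k) hμ.le hG).trans ?_
  refine lintegral_mono fun x => ENNReal.ofReal_le_ofReal ?_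
  have := mul_truncPot_le hμ k (hV0 _ (hdist_nonneg o x))
  gcongr

/-- The normalised solutions converge in H¹: the functions by dominated convergence, the derivatives
to an L² limit h, which is then the radial weak derivative of the limit profile. Closedness of H¹₀
preserves the boundary value. The energy is bounded above by Fatou and below by
`Admissible.le_energy`. -/
theorem admissible_minProfile (ho : o ∈ poincareBall d) (hd : 2 ≤ d) (hR : 0 < R) (hμ : 0 < μ)
    (hV : Measurable V) (hV0 : ∀ r, 0 ≤ r → 0 ≤ V r)
    (hm : Tendsto (fun k => fluxRatio (d - 1) R (truncPot μ V k)) atTop (𝓝 m)) :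
    Admissible o R (radial o (minProfile μ V (d - 1) R)) ∧
      energy μ V o R (radial o (minProfile μ V (d - 1) R)) =
        (volume : Measure (Coord d)).toSphere univ * ENNReal.ofReal (μ * m) := by
  set n := d - 1 with hn
  have hd0 : 0 < d := by omega
  set A := (volume : Measure (Coord d)).toSphere univ with hA
  have hAtop : A ≠ ⊤ := measure_ne_top _ _
  set f := minProfile μ V n R with hf
  have hb := isBddPotential_truncPot hμ hV
  have hp := fun k => radialProfile_nprof (hb k) n hR
  obtain ⟨h, hh, ht⟩ := exists_tendsto_ndprof hμ hV n hR hm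
  have hfm : AEStronglyMeasurable f (radMeas n R) :=
    (measurable_minProfile μ V n R).aestronglyMeasurable
  have hf1 : ∀ r ∈ Ioo 0 R, f r ^ 2 ≤ 1 := fun r hr =>
    pow_le_one₀ (minProfile_nonneg hμ hV n R r) (minProfile_le_one hμ hV n hr.2.le)
  have htf : Tendsto (fun k => ∫⁻ r, ENNReal.ofReal ((nprof n R (truncPot μ V k) r - f r) ^ 2)
      ∂(radMeas n R)) atTop (𝓝 0) := by
    have := tendsto_lintegral_of_dominated_convergence' (μ := radMeas n R)
      (F := fun k r => ENNReal.ofReal ((nprof n R (truncPot μ V k) r - f r) ^ 2))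
      (f := fun _ => 0) (fun _ => 1) ?_ ?_ ?_ ?_
    · simpa using this
    · exact fun k => ((((hp k).aestronglyMeasurable n).1.sub hfm).aemeasurable.pow_const
        2).ennreal_ofReal
    · refine fun k => ae_radMeas_of_forall fun r hr => ?_
      rw [← ENNReal.ofReal_one]
      refine ENNReal.ofReal_le_ofReal ((sq_le_one_iff_abs_le_one _).2 (abs_sub_le_iff.2 ⟨?_, ?_⟩))
      · linarith [nprof_le_one hμ hV n k hr.2.le, minProfile_nonneg hμ hV n R r]
      · linarith [nprof_pos hμ hV n R k r, minProfile_le_one hμ hV n hr.2.le]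
    · simp [measure_ne_top]
    · refine ae_radMeas_of_forall fun r hr => ?_
      have h1 := ((tendsto_nprof hμ hV n hr.1.le hr.2.le).sub_const (f r)).pow 2
      rw [sub_self, zero_pow two_ne_zero] at h1
      simpa using ENNReal.tendsto_ofReal h1
  have hq : ∀ k, quadE 1 (fun _ => 1) o R
      (fun x => radial o (nprof n R (truncPot μ V k)) x - radial o f x)
      (fun x => radGrad o (ndprof n R (truncPot μ V k)) x - radGrad o h x) =
      A * (∫⁻ r, ENNReal.ofReal (‖ndprof n R (truncPot μ V k) r - h r‖ ^ 2) ∂(radMeas n R) +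
        ∫⁻ r, ENNReal.ofReal ((nprof n R (truncPot μ V k) r - f r) ^ 2) ∂(radMeas n R)) := by
    intro k
    have h1 : AEStronglyMeasurable (fun r => nprof n R (truncPot μ V k) r - f r) (radMeas n R) :=
      ((hp k).aestronglyMeasurable n).1.sub hfm
    have h2 : AEStronglyMeasurable (fun r => ndprof n R (truncPot μ V k) r - h r) (radMeas n R) :=
      ((hp k).aestronglyMeasurable n).2.sub hh.1
    have e1 : (fun x => radial o (nprof n R (truncPot μ V k)) x - radial o f x) =
        radial o (fun r => nprof n R (truncPot μ V k) r - f r) := by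
      ext x
      simp [radial]
    have e2 : (fun x => radGrad o (ndprof n R (truncPot μ V k)) x - radGrad o h x) =
        radGrad o (fun r => ndprof n R (truncPot μ V k) r - h r) := by
      ext1 x
      simp [radGrad, sub_smul]
    rw [e1, e2, quadE_radial ho hd0 1 measurable_const h1 h2, ← lintegral_add_left'
      (h2.norm.aemeasurable.pow_const 2).ennreal_ofReal]
    congr 1
    refine lintegral_congr fun r => ?_
    rw [Real.norm_eq_abs, sq_abs, one_mul, one_mul, ENNReal.ofReal_add (sq_nonneg _) (sq_nonneg _)]
  have hqt : Tendsto (fun k => quadE 1 (fun _ => 1) o R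
      (fun x => radial o (nprof n R (truncPot μ V k)) x - radial o f x)
      (fun x => radGrad o (ndprof n R (truncPot μ V k)) x - radGrad o h x)) atTop (𝓝 0) := by
    simp_rw [hq]
    simpa using ENNReal.Tendsto.const_mul (ht.add htf) (.inr hAtop)
  have hlt : quadE 1 (fun _ => 1) o R (radial o f) (radGrad o h) < ⊤ := by
    rw [quadE_radial ho hd0 1 measurable_const hfm hh.1]
    refine ENNReal.mul_lt_top hAtop.lt_top ?_
    have h1 : ∫⁻ r, ENNReal.ofReal (1 * h r ^ 2 + 1 * f r ^ 2) ∂(radMeas n R) ≤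
        ∫⁻ r, (ENNReal.ofReal (‖h r‖ ^ 2) + 1) ∂(radMeas n R) := by
      refine lintegral_mono_ae (ae_radMeas_of_forall fun r hr => ?_)
      rw [Real.norm_eq_abs, sq_abs, one_mul, one_mul, ENNReal.ofReal_add (sq_nonneg _) (sq_nonneg _)]
      gcongr
      rw [← ENNReal.ofReal_one]
      exact ENNReal.ofReal_le_ofReal (hf1 r hr)
    refine h1.trans_lt ?_
    rw [lintegral_add_right _ measurable_const]
    refine ENNReal.add_lt_top.2 ⟨?_, by simp [measure_lt_top]⟩
    have h2 := hh.2
    rw [eLpNorm_two_sq] at h2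
    exact (ENNReal.rpow_lt_top_iff_of_pos (by norm_num)).1 h2
  obtain ⟨hl1, hl2⟩ := locallyIntegrableOn_of_quadE hd
    ((aestronglyMeasurable_radial ho hd0 hfm).mono_measure (volume_restrict_le o R))
    ((aestronglyMeasurable_radGrad ho hd0 hh.1).mono_measure (volume_restrict_le o R)) hlt
  have hw : IsWeakDifferential (hball o R) (radial o f) (radGrad o h) :=
    isWeakDifferential_of_tendsto_quadE hd hl1 hl2 (fun k => (hp k).isWeakDifferential ho hd) hqt
  have hmem : MemH1 (hball o R) (radial o f) := (memH1_iff ho).2 ⟨_, hw, hlt⟩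
  have hadm : Admissible o R (radial o f) := by
    have hmem1 : MemH1 (hball o R) (fun x => radial o f x - 1) := by
      simpa [sub_eq_add_neg] using hmem.add ho (memH1_const ho hd0 (-1))
    refine ⟨hmem, MemH1Zero.of_tendsto ho hmem1
      (v := fun k => radial o fun r => nprof n R (truncPot μ V k) r - 1) (fun k => ?_) ?_⟩
    · have h1 := (hp k).sub (radialProfile_const R 1)
      have hc := ((hb k).prof_bounds (n := n) R).1
      refine h1.memH1Zero ho hd hR (ContinuousOn.sub (fun r hr => ?_) continuousOn_const)
        ((hc.div_const _).sub continuousOn_const) ?_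
      · have h2 := (continuousOn_flux (n := n) (hb k).1 (hb k).2 (hb k).3 (hb k).4
          hR.le).continuousAt (Icc_mem_nhds hr.1 hr.2)
        exact ((h2.div (Real.continuous_sinh.pow n).continuousAt
          (sinh_pow_pos n hr.1).ne').div_const _).continuousWithinAt
      · rw [nprof_self hμ hV, sub_self]
    · have h1 : ∀ k, IsWeakDifferential (hball o R)
          (fun x => radial o f x - 1 - radial o (fun r => nprof n R (truncPot μ V k) r - 1) x)
          (fun x => (-1 : ℂ) • (radGrad o (ndprof n R (truncPot μ V k)) x - radGrad o h x)) := by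
        intro k
        convert! (((hp k).isWeakDifferential ho hd).sub hw).const_mul (-1) using 2 with x
        simp [radial]
      simp_rw [fun k => h1NormSq_eq ho (h1 k)]
      refine hqt.congr fun k => ?_
      have h2 := quadE_const_mul (μ := 1) (W := fun _ => 1) (o := o) (R := R)
        (fun x => radial o (nprof n R (truncPot μ V k)) x - radial o f x)
        (fun x => radGrad o (ndprof n R (truncPot μ V k)) x - radGrad o h x) (-1)
      simp only [norm_neg, norm_one, one_pow, ENNReal.ofReal_one, one_mul] at h2
      rw [← h2]
      congr 1
      ext x
      simp [radial]
  refine ⟨hadm, le_antisymm ?_ (hadm.le_energy ho hd hR hμ hV hV0 hm)⟩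
  rw [energy_eq ho μ V hw, quadE_radial ho hd0 μ (hV.const_mul _) hfm hh.1]
  gcongr
  exact lintegral_minProfile_le hμ hV hV0 n hR hm hh ht

end Minimizer

/-! ### Uniqueness and the Euler–Lagrange equation. -/

section Variation

variable {d : ℕ} {o : Coord d} {R μ : ℝ} {V : ℝ → ℝ}

theorem ae_volume_of_ae_hvol {p : Coord d → Prop}
    (h : ∀ᵐ x ∂((hvol d).restrict (hball o R)), p x) : ∀ᵐ x ∂(volume.restrict (hball o R)), p x :=
  (volume_restrict_le o R).absolutelyContinuous h

theorem Admissible.midpoint (ho : o ∈ poincareBall d) {φ χ : Coord d → ℂ} (hφ : Admissible o R φ)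
    (hχ : Admissible o R χ) : Admissible o R (fun x => (1 / 2 : ℂ) * (φ x + χ x)) := by
  refine ⟨(hφ.1.add ho hχ.1).const_mul ho _, ?_⟩
  convert! (hφ.2.add ho hχ.2).const_mul ho (1 / 2 : ℂ) using 2 with x
  ring

theorem Admissible.add_test (ho : o ∈ poincareBall d) (hd : 0 < d) {φ ψ : Coord d → ℂ}
    (hφ : Admissible o R φ) (hψ : IsTestFunction (hball o R) ψ) :
    Admissible o R (fun x => φ x + ψ x) := by
  refine ⟨hφ.1.add ho (hψ.memH1 ho hd), ?_⟩
  convert! hφ.2.add ho (hψ.memH1Zero ho hd) using 2 with x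
  ring

theorem Admissible.sub (ho : o ∈ poincareBall d) {φ χ : Coord d → ℂ} (hφ : Admissible o R φ)
    (hχ : Admissible o R χ) : MemH1Zero (hball o R) (fun x => φ x - χ x) := by
  convert! hφ.2.add ho (hχ.2.const_mul ho (-1)) using 2 with x
  ring

/-- The midpoint of two minimisers is admissible, so the parallelogram identity leaves no energy for
their difference. As μ > 0 the differentials agree, and the difference lies in H¹₀, where a
vanishing differential means zero. Finiteness of the energy is needed to cancel in [0, ∞]. -/
theorem IsMinimizer.ae_eq (ho : o ∈ poincareBall d) (hd : 2 ≤ d) (hμ : 0 < μ) (hV : Measurable V)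
    (hV0 : ∀ r, 0 ≤ r → 0 ≤ V r) {φ χ : Coord d → ℂ} (hφ : IsMinimizer μ V o R φ)
    (hχ : IsMinimizer μ V o R χ) (hfin : energy μ V o R φ < ⊤) :
    χ =ᵐ[(hvol d).restrict (hball o R)] φ := by
  obtain ⟨G, hG, -⟩ := (memH1_iff ho).1 hφ.1.1
  obtain ⟨K, hK, -⟩ := (memH1_iff ho).1 hχ.1.1
  have hW : Measurable fun r => 1 / 2 * V r := hV.const_mul _
  have hW0 : ∀ r, 0 ≤ r → 0 ≤ 1 / 2 * V r := fun r hr => by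
    have := hV0 r hr
    positivity
  have hpar := quadE_parallelogram hμ.le hW hW0 hG.aestronglyMeasurable.1
    hG.aestronglyMeasurable.2 hK.aestronglyMeasurable.1 hK.aestronglyMeasurable.2
  have hmid := hφ.2 _ (hφ.1.midpoint ho hχ.1)
  have heq : energy μ V o R χ = energy μ V o R φ := le_antisymm (hχ.2 _ hφ.1) (hφ.2 _ hχ.1)
  rw [energy_eq ho μ V ((hG.add hK).const_mul (1 / 2)), quadE_const_mul] at hmid
  rw [← energy_eq ho μ V hG, ← energy_eq ho μ V hK, heq] at hpar
  set e := energy μ V o R φ with he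
  set S := quadE μ (fun r => 1 / 2 * V r) o R (fun x => φ x + χ x) (fun x => G x + K x) with hS
  -- The midpoint has energy S / 4, so minimality reads 4 e ≤ S, while the parallelogram identity
  -- says that S plus the energy of the difference is 4 e.
  have h4 : 2 * e + 2 * e ≤ S := by
    have h5 : (4 : ℝ≥0∞) * e ≤ 4 * (ENNReal.ofReal (‖(1 / 2 : ℂ)‖ ^ 2) * S) := by gcongr
    have h6 : (4 : ℝ≥0∞) * ENNReal.ofReal (‖(1 / 2 : ℂ)‖ ^ 2) = 1 := by
      have : (4 : ℝ≥0∞) = ENNReal.ofReal 4 := by simp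
      rw [this, ← ENNReal.ofReal_mul (by norm_num)]
      norm_num
    rw [← mul_assoc, h6, one_mul] at h5
    refine le_trans (le_of_eq ?_) h5
    ring
  have hfin2 : 2 * e + 2 * e ≠ ⊤ := by
    refine ENNReal.add_ne_top.2 ⟨?_, ?_⟩ <;> exact ENNReal.mul_ne_top ENNReal.ofNat_ne_top hfin.ne
  have hz : quadE μ (fun r => 1 / 2 * V r) o R (fun x => φ x - χ x) (fun x => G x - K x) = 0 := by
    have h7 : S + quadE μ (fun r => 1 / 2 * V r) o R (fun x => φ x - χ x) (fun x => G x - K x) ≤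
        S + 0 := by rw [hpar, add_zero]; exact h4
    have hSfin : S ≠ ⊤ := fun h => hfin2 (by rw [← hpar, h, top_add])
    exact nonpos_iff_eq_zero.1 ((ENNReal.add_le_add_iff_left hSfin).1 h7)
  have hGK : (fun x => G x - K x) =ᵐ[volume.restrict (hball o R)] fun _ => 0 := by
    refine ae_volume_of_ae_hvol ?_
    rw [quadE, lintegral_eq_zero_iff' (aemeasurable_density (u := fun x => φ x - χ x)
      (G := fun x => G x - K x) μ hW
      (hG.aestronglyMeasurable.1.sub hK.aestronglyMeasurable.1)
      (hG.aestronglyMeasurable.2.sub hK.aestronglyMeasurable.2))] at hz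
    filter_upwards [hz, ae_hball (by omega) o R] with x hx hxU
    have h8 := conf_pos hxU.1.1
    have h9 := ENNReal.ofReal_eq_zero.1 hx
    have h10 := mul_nonneg (hW0 _ (hdist_nonneg o x)) (sq_nonneg ‖φ x - χ x‖)
    have h11 : μ * (‖G x - K x‖ ^ 2 / conf x ^ 2) ≤ 0 := by linarith
    have h12 : ‖G x - K x‖ ^ 2 / conf x ^ 2 ≤ 0 := nonpos_of_mul_nonpos_right h11 hμ
    rw [div_le_iff₀ (by positivity), zero_mul] at h12
    exact norm_eq_zero.1 (pow_eq_zero_iff two_ne_zero |>.1 (le_antisymm h12 (sq_nonneg _)))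
  have h0 := (hφ.1.sub ho hχ.1).ae_eq_zero ho hd ((hG.sub hK).congr_ae ae_eq_rfl hGK)
  filter_upwards [h0] with x hx
  exact (sub_eq_zero.1 hx).symm

/-- If φ vanished, the constant -1 would lie in H¹₀ with zero differential and would have to vanish
on a non-empty open ball. -/
theorem Admissible.not_ae_zero (ho : o ∈ poincareBall d) (hd : 2 ≤ d) (hR : 0 < R) {φ : Coord d → ℂ}
    (hφ : Admissible o R φ) : ¬ φ =ᵐ[(hvol d).restrict (hball o R)] 0 := by
  intro h
  have hw : IsWeakDifferential (hball o R) (fun x => φ x - 1) (fun _ => 0) :=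
    (isWeakDifferential_const (-1)).congr_ae (by
      filter_upwards [ae_volume_of_ae_hvol h] with x hx
      rw [hx]
      simp) ae_eq_rfl
  have h1 := hφ.2.ae_eq_zero ho hd hw
  have h2 : ∀ᵐ x ∂(volume.restrict (hball o R)), False := by
    refine ae_volume_of_ae_hvol ?_
    filter_upwards [h, h1] with x hx hx1
    simp [hx] at hx1
  have hmem : o ∈ hball o R := ⟨ho, by rwa [hdist_self]⟩
  have h3 := (isOpen_hball ho R).measure_pos volume ⟨o, hmem⟩
  rw [ae_iff] at h2
  simp only [not_false_eq_true, ofPred_true, Measure.restrict_apply_univ] at h2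
  exact h3.ne' h2

theorem norm_add_mul_ofReal_sq (g c : ℂ) (a : ℝ) :
    ‖g + c * a‖ ^ 2 = ‖g‖ ^ 2 + 2 * ((starRingEnd ℂ) c * (g * a)).re + ‖c‖ ^ 2 * a ^ 2 := by
  simp only [← Complex.normSq_eq_norm_sq, Complex.normSq_apply, Complex.add_re, Complex.add_im,
    Complex.mul_re, Complex.mul_im, Complex.conj_re, Complex.conj_im, Complex.ofReal_re,
    Complex.ofReal_im]
  ring

/-- The single choice c = -z / (|q| + 1) suffices: with t = 1 / (|q| + 1) the quadratic term is at
most t ‖z‖², half of what the linear term -2 t ‖z‖² removes. No sign of q and no limit c → 0 are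
involved. -/
theorem eq_zero_of_quadratic_nonneg {z : ℂ} {q : ℝ}
    (h : ∀ c : ℂ, 0 ≤ 2 * ((starRingEnd ℂ) c * z).re + ‖c‖ ^ 2 * q) : z = 0 := by
  have hq : 0 < |q| + 1 := by positivity
  have h1 := h (-((|q| + 1)⁻¹ : ℝ) * z)
  have h2 : ((starRingEnd ℂ) (-((|q| + 1)⁻¹ : ℝ) * z) * z).re = -(|q| + 1)⁻¹ * ‖z‖ ^ 2 := by
    simp only [← Complex.normSq_eq_norm_sq, Complex.normSq_apply, map_mul, map_neg,
      Complex.conj_ofReal, Complex.mul_re, Complex.mul_im, Complex.neg_re, Complex.neg_im,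
      Complex.ofReal_re, Complex.ofReal_im, Complex.conj_re, Complex.conj_im]
    ring
  have h3 : ‖(-((|q| + 1)⁻¹ : ℝ) * z : ℂ)‖ ^ 2 = ((|q| + 1)⁻¹) ^ 2 * ‖z‖ ^ 2 := by
    rw [norm_mul, norm_neg, Complex.norm_real, mul_pow, Real.norm_eq_abs, sq_abs]
  rw [h2, h3] at h1
  set t := (|q| + 1)⁻¹ with ht
  have ht0 : 0 < t := inv_pos.2 hq
  have h4 : t * q ≤ 1 := by
    rw [ht, inv_mul_le_iff₀ hq]
    linarith [le_abs_self q]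
  have h5 : t * ‖z‖ ^ 2 ≤ 0 := by
    have := mul_le_mul_of_nonneg_left h4 (mul_nonneg ht0.le (sq_nonneg ‖z‖))
    nlinarith
  have h6 : ‖z‖ ^ 2 ≤ 0 := nonpos_of_mul_nonpos_right h5 ht0
  exact norm_eq_zero.1 (pow_eq_zero_iff two_ne_zero |>.1 (le_antisymm h6 (sq_nonneg _)))

theorem pderiv_ofReal {U : Set (Coord d)} {ψ : Coord d → ℝ} (hψ : IsTestFunction U ψ) (i : Fin d)
    (x : Coord d) : pderiv i (fun x => (ψ x : ℂ)) x = ((pderiv i ψ x : ℝ) : ℂ) := by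
  have h1 := (hψ.1.differentiable (by simp) x).hasFDerivAt
  have h2 := Complex.ofRealCLM.hasFDerivAt.comp x h1
  have h3 : fderiv ℝ (fun x => (ψ x : ℂ)) x = Complex.ofRealCLM.comp (fderiv ℝ ψ x) := h2.fderiv
  rw [pderiv, h3]
  rfl

theorem IsTestFunction.ofReal {U : Set (Coord d)} {ψ : Coord d → ℝ} (hψ : IsTestFunction U ψ) :
    IsTestFunction U (fun x => (ψ x : ℂ)) := by
  have hs : Function.support (fun x => (ψ x : ℂ)) ⊆ Function.support ψ := fun x hx => by
    rw [Function.mem_support] at hx ⊢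
    exact fun h => hx (by simp [h])
  exact ⟨Complex.ofRealCLM.contDiff.comp hψ.1,
    hψ.2.1.comp_left (g := ((↑) : ℝ → ℂ)) Complex.ofReal_zero, (closure_mono hs).trans hψ.2.2⟩

/-- The cross term of the energy density of `φ + c ψ`. -/
def crossDensity (μ : ℝ) (V : ℝ → ℝ) (o : Coord d) (R : ℝ) (φ : Coord d → ℂ) (ψ : Coord d → ℝ)
    (x : Coord d) : ℂ :=
  μ * gradInner (hball o R) φ ψ x + 1 / 2 * ((V (hdist o x) : ℂ) * φ x * (ψ x : ℂ))

/-- The energy density of a real test function. -/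
def testDensity (μ : ℝ) (V : ℝ → ℝ) (o : Coord d) (ψ : Coord d → ℝ) (x : Coord d) : ℝ :=
  μ * ((∑ i, pderiv i ψ x ^ 2) / conf x ^ 2) + 1 / 2 * (V (hdist o x) * ψ x ^ 2)

theorem density_add_mul {φ : Coord d → ℂ} {ψ : Coord d → ℝ} {U : Set (Coord d)}
    (hψ : IsTestFunction U ψ) (c : ℂ) (x : Coord d) :
    μ * (‖weakDifferential (hball o R) φ x + c • gradC (fun x => (ψ x : ℂ)) x‖ ^ 2 / conf x ^ 2) +
      1 / 2 * V (hdist o x) * ‖φ x + c * ψ x‖ ^ 2 =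
    μ * gradSq (hball o R) φ x + 1 / 2 * V (hdist o x) * ‖φ x‖ ^ 2 +
      2 * ((starRingEnd ℂ) c * crossDensity μ V o R φ ψ x).re + ‖c‖ ^ 2 * testDensity μ V o ψ x := by
  have h1 : ‖weakDifferential (hball o R) φ x + c • gradC (fun x => (ψ x : ℂ)) x‖ ^ 2 =
      ‖weakDifferential (hball o R) φ x‖ ^ 2 + 2 * ((starRingEnd ℂ) c *
        (∑ i, weakDifferential (hball o R) φ x i * ((pderiv i ψ x : ℝ) : ℂ))).re +
        ‖c‖ ^ 2 * ∑ i, pderiv i ψ x ^ 2 := by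
    rw [EuclideanSpace.norm_sq_eq, EuclideanSpace.norm_sq_eq, Finset.mul_sum, Complex.re_sum,
      Finset.mul_sum, Finset.mul_sum, ← Finset.sum_add_distrib, ← Finset.sum_add_distrib]
    refine Finset.sum_congr rfl fun i _ => ?_
    rw [← norm_add_mul_ofReal_sq, ← pderiv_ofReal hψ]
    rfl
  rw [h1, norm_add_mul_ofReal_sq, gradSq, crossDensity, testDensity, gradInner]
  set S := ∑ i, weakDifferential (hball o R) φ x i * ((pderiv i ψ x : ℝ) : ℂ)
  have e : (starRingEnd ℂ) c * (μ * (S / (conf x : ℂ) ^ 2) + 1 / 2 * ((V (hdist o x) : ℂ) * φ x * ψ x)) =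
      ((μ / conf x ^ 2 : ℝ) : ℂ) * ((starRingEnd ℂ) c * S) +
      ((1 / 2 * V (hdist o x) : ℝ) : ℂ) * ((starRingEnd ℂ) c * (φ x * ψ x)) := by
    push_cast
    ring
  rw [e, Complex.add_re, Complex.re_ofReal_mul, Complex.re_ofReal_mul]
  ring

theorem norm_gradInner_le {U : Set (Coord d)} (φ : Coord d → ℂ) (ψ : Coord d → ℝ) (x : Coord d) :
    ‖gradInner U φ ψ x‖ ≤ gradSq U φ x + (∑ i, pderiv i ψ x ^ 2) / conf x ^ 2 := by
  rw [gradInner, norm_div, norm_pow, Complex.norm_real, Real.norm_eq_abs, sq_abs, gradSq, ← add_div]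
  refine div_le_div_of_nonneg_right ((norm_sum_le _ _).trans ?_) (sq_nonneg _)
  rw [EuclideanSpace.norm_sq_eq, ← Finset.sum_add_distrib]
  refine Finset.sum_le_sum fun i _ => ?_
  rw [norm_mul, Complex.norm_real, Real.norm_eq_abs, ← sq_abs (pderiv i ψ x)]
  nlinarith [sq_nonneg (‖weakDifferential U φ x i‖ - |pderiv i ψ x|),
    sq_nonneg ‖weakDifferential U φ x i‖, sq_nonneg |pderiv i ψ x|]

theorem MemH1.isWeakDifferential {U : Set (Coord d)} {φ : Coord d → ℂ} (h : MemH1 U φ) :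
    IsWeakDifferential U φ (weakDifferential U φ) := by
  rw [weakDifferential, dif_pos h.2.1]
  exact Classical.choose_spec h.2.1

/-- The energy of φ + c ψ is a quadratic polynomial in c, minimal at c = 0. Complex c catch both the
real and the imaginary part of the linear coefficient. The cross terms are integrable by the
inequality between a product and the sum of squares, using the finite energy of φ and the finite
potential energy of ψ. -/
theorem IsMinimizer.solvesEulerLagrange (ho : o ∈ poincareBall d) (hd : 2 ≤ d) (hμ : 0 < μ)
    (hV : Measurable V) (hV0 : ∀ r, 0 ≤ r → 0 ≤ V r) {φ : Coord d → ℂ} (hφ : IsMinimizer μ V o R φ)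
    (hfin : energy μ V o R φ < ⊤) : SolvesEulerLagrange μ V o R φ := by
  intro ψ hψ hψV
  have hd0 : 0 < d := by omega
  have hfm := isFiniteMeasure_hvol_restrict ho hd0 (R := R)
  set ν := (hvol d).restrict (hball o R) with hν
  set U := hball o R with hU
  have hG := hφ.1.1.isWeakDifferential
  obtain ⟨hφm, hGm⟩ := hG.aestronglyMeasurable
  have hVm : Measurable fun x : Coord d => V (hdist o x) := hV.comp (measurable_hdist o)
  have hVp : ∀ x, 0 ≤ V (hdist o x) := fun x => hV0 _ (hdist_nonneg o x)
  have hcm := (measurable_conf (d := d))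
  have hD : Integrable (fun x => μ * gradSq U φ x + 1 / 2 * V (hdist o x) * ‖φ x‖ ^ 2) ν := by
    have hm : AEStronglyMeasurable
        (fun x => μ * gradSq U φ x + 1 / 2 * V (hdist o x) * ‖φ x‖ ^ 2) ν := by
      have h1 := hφm.norm.aemeasurable
      have h2 := hGm.norm.aemeasurable
      have h3 := hcm.aemeasurable (μ := ν)
      exact ((((h2.pow_const 2).div (h3.pow_const 2)).const_mul μ).add
        (((hVm.aemeasurable.const_mul _)).mul (h1.pow_const 2))).aestronglyMeasurable
    refine ⟨hm, ?_⟩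
    rw [hasFiniteIntegral_iff_ofReal (.of_forall fun x => ?_)]
    · exact hfin
    · have := hVp x
      have : 0 ≤ gradSq U φ x := div_nonneg (sq_nonneg _) (sq_nonneg _)
      positivity
  have hgs0 : ∀ x, 0 ≤ gradSq U φ x := fun x => div_nonneg (sq_nonneg _) (sq_nonneg _)
  have hgs : Integrable (gradSq U φ) ν := by
    refine (hD.const_mul μ⁻¹).mono' ?_ (.of_forall fun x => ?_)
    · exact ((hGm.norm.aemeasurable.pow_const 2).div
        (hcm.aemeasurable.pow_const 2)).aestronglyMeasurable
    · rw [Real.norm_of_nonneg (hgs0 x), mul_add, inv_mul_cancel_left₀ hμ.ne']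
      have := hVp x
      exact le_add_of_nonneg_right (by positivity)
  have hVφ : Integrable (fun x => V (hdist o x) * ‖φ x‖ ^ 2) ν := by
    refine (hD.const_mul 2).mono' ?_ (.of_forall fun x => ?_)
    · exact (hVm.aemeasurable.mul (hφm.norm.aemeasurable.pow_const 2)).aestronglyMeasurable
    · rw [Real.norm_of_nonneg (mul_nonneg (hVp x) (sq_nonneg _))]
      have := mul_nonneg hμ.le (hgs0 x)
      linarith
  have hpc : ∀ i, Continuous (pderiv i ψ) := fun i => hψ.continuous_pderiv i
  have hT : Integrable (fun x => (∑ i, pderiv i ψ x ^ 2) / conf x ^ 2) ν := by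
    obtain ⟨C, hC⟩ : ∃ C, ∀ x, ‖∑ i, pderiv i ψ x ^ 2‖ ≤ C := by
      have hcont : Continuous fun x => ∑ i, pderiv i ψ x ^ 2 := by fun_prop
      refine HasCompactSupport.exists_bound_of_continuous (HasCompactSupport.intro hψ.2.1
        fun x hx => Finset.sum_eq_zero fun i _ => ?_) hcont
      rw [image_eq_zero_of_notMem_tsupport fun h => hx (tsupport_pderiv_subset ψ i h),
        zero_pow two_ne_zero]
    refine .of_bound ?_ C ?_
    · have hcont : Continuous fun x => ∑ i, pderiv i ψ x ^ 2 := by fun_prop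
      exact (hcont.measurable.div (hcm.pow_const 2)).aestronglyMeasurable
    · filter_upwards [ae_hball hd0 o R] with x hx
      have h2 := two_le_conf hx.1.1
      rw [norm_div]
      refine (div_le_self (norm_nonneg _) ?_).trans (hC x)
      rw [Real.norm_of_nonneg (sq_nonneg _)]
      nlinarith
  have hGI : Integrable (fun x => gradInner U φ ψ x) ν := by
    refine (hgs.add hT).mono' ?_ (.of_forall fun x => norm_gradInner_le φ ψ x)
    have h1 : ∀ i, AEMeasurable (fun x => weakDifferential U φ x i) ν := fun i =>
      ((EuclideanSpace.proj (𝕜 := ℂ) i).continuous.measurable.comp_aemeasurable hGm.aemeasurable)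
    have h2 : ∀ i, Measurable fun x => ((pderiv i ψ x : ℝ) : ℂ) := fun i =>
      (Complex.continuous_ofReal.comp (hpc i)).measurable
    refine AEMeasurable.aestronglyMeasurable (AEMeasurable.div ?_ ?_)
    · exact Finset.aemeasurable_fun_sum _ fun i _ => (h1 i).mul (h2 i).aemeasurable
    · exact ((Complex.measurable_ofReal.comp hcm).pow_const 2).aemeasurable
  have hVI : Integrable (fun x => (V (hdist o x) : ℂ) * φ x * (ψ x : ℂ)) ν := by
    refine (hVφ.add hψV).mono' ?_ (.of_forall fun x => ?_)
    · exact (((Complex.measurable_ofReal.comp hVm).aestronglyMeasurable.mul hφm).mul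
        (Complex.continuous_ofReal.comp hψ.1.continuous).aestronglyMeasurable)
    · rw [norm_mul, norm_mul, Complex.norm_real, Complex.norm_real, Real.norm_of_nonneg (hVp x),
        Real.norm_eq_abs, Pi.add_apply, ← sq_abs (ψ x), mul_assoc, ← mul_add]
      refine mul_le_mul_of_nonneg_left ?_ (hVp x)
      nlinarith [sq_nonneg (‖φ x‖ - |ψ x|), sq_nonneg ‖φ x‖, sq_nonneg |ψ x|]
  have hX : Integrable (crossDensity μ V o R φ ψ) ν := (hGI.const_mul _).add (hVI.const_mul _)
  have hQ : Integrable (testDensity μ V o ψ) ν := (hT.const_mul _).add (hψV.const_mul _)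
  refine ⟨hGI, hVI, ?_⟩
  have hkey : ∫ x, crossDensity μ V o R φ ψ x ∂ν = 0 := by
    refine eq_zero_of_quadratic_nonneg (q := ∫ x, testDensity μ V o ψ x ∂ν) fun c => ?_
    have h1 := hφ.2 _ (hφ.1.add_test ho hd0 (hψ.ofReal.const_mul c))
    have h2 : IsWeakDifferential U (fun x => φ x + c * (ψ x : ℂ)) _ :=
      hG.add (hψ.ofReal.isWeakDifferential.const_mul c)
    rw [energy_eq ho μ V h2, quadE, energy] at h1
    simp only [density_add_mul hψ] at h1
    have hcX := (hX.const_mul ((starRingEnd ℂ) c)).re.const_mul 2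
    have hI := (hD.add hcX).add (hQ.const_mul (‖c‖ ^ 2))
    have hp1 : ∀ x, 0 ≤ μ * gradSq U φ x + 1 / 2 * V (hdist o x) * ‖φ x‖ ^ 2 := fun x => by
      have := hVp x
      have := hgs0 x
      positivity
    have hp2 : ∀ x, 0 ≤ μ * gradSq U φ x + 1 / 2 * V (hdist o x) * ‖φ x‖ ^ 2 +
        2 * ((starRingEnd ℂ) c * crossDensity μ V o R φ ψ x).re +
        ‖c‖ ^ 2 * testDensity μ V o ψ x := fun x => by
      rw [← density_add_mul hψ]
      have := hVp x
      positivity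
    have e1 := ofReal_integral_eq_lintegral_ofReal hD (.of_forall hp1)
    have e2 := ofReal_integral_eq_lintegral_ofReal hI (.of_forall hp2)
    have h3 := (e1.le.trans h1).trans e2.symm.le
    replace h3 := (ENNReal.ofReal_le_ofReal_iff (integral_nonneg hp2)).1 h3
    have e3 : ∫ x, ((fun x => μ * gradSq U φ x + 1 / 2 * V (hdist o x) * ‖φ x‖ ^ 2) +
        (fun x => 2 * RCLike.re ((starRingEnd ℂ) c * crossDensity μ V o R φ ψ x)) +
        (fun x => ‖c‖ ^ 2 * testDensity μ V o ψ x) : Coord d → ℝ) x ∂ν =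
        ∫ x, (μ * gradSq U φ x + 1 / 2 * V (hdist o x) * ‖φ x‖ ^ 2) ∂ν +
        2 * ((starRingEnd ℂ) c * ∫ x, crossDensity μ V o R φ ψ x ∂ν).re +
        ‖c‖ ^ 2 * ∫ x, testDensity μ V o ψ x ∂ν := by
      rw [integral_add' (hD.add hcX) (hQ.const_mul _), integral_add' hD hcX, integral_const_mul,
        integral_const_mul, integral_re (hX.const_mul _), integral_const_mul]
      rfl
    have h4 := h3.trans_eq e3
    linarith
  rw [← hkey, ← integral_const_mul, ← integral_const_mul,
    ← integral_add (hGI.const_mul _) (hVI.const_mul _)]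
  rfl

end Variation

/-! ### The radial Green function and the zero-energy solution. -/

section Green

/-- A primitive of `sinh^{-(d-1)}`, for `d = 2, 3`. -/
def greenFun (d : ℕ) (r : ℝ) : ℝ :=
  if d = 2 then Real.log (Real.tanh (r / 2)) else -(Real.cosh r / Real.sinh r)

variable {d : ℕ} {a b r R R₀ : ℝ}

theorem hasDerivAt_greenFun (hd : d = 2 ∨ d = 3) (hr : 0 < r) :
    HasDerivAt (greenFun d) (1 / Real.sinh r ^ (d - 1)) r := by
  have hs := Real.sinh_pos_iff.2 hr
  rcases hd with rfl | rfl
  · have h1 := (hasDerivAt_tanh_half r).log (tanh_half_pos hr).ne'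
    have e : greenFun 2 = fun r => Real.log (Real.tanh (r / 2)) := by
      ext r
      simp [greenFun]
    rw [e]
    convert! h1 using 1
    have h2 : Real.sinh r = 2 * Real.sinh (r / 2) * Real.cosh (r / 2) := by
      rw [← Real.sinh_two_mul]
      ring_nf
    have h3 := (Real.cosh_pos (r / 2)).ne'
    have h4 := (Real.sinh_pos_iff.2 (half_pos hr)).ne'
    rw [h2, Real.tanh_eq_sinh_div_cosh, show 2 - 1 = 1 from rfl, pow_one]
    field_simp
  · have h1 := ((Real.hasDerivAt_cosh r).div (Real.hasDerivAt_sinh r) hs.ne').neg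
    have e : greenFun 3 = -(Real.cosh / Real.sinh) := by
      ext r
      simp [greenFun]
    rw [e]
    convert! h1 using 1
    rw [← pow_two, ← pow_two, Real.cosh_sq, show 3 - 1 = 2 from rfl]
    ring

theorem greenFun_strictMonoOn (hd : d = 2 ∨ d = 3) : StrictMonoOn (greenFun d) (Ioi 0) := by
  refine strictMonoOn_of_hasDerivWithinAt_pos (convex_Ioi 0)
    (fun r hr => (hasDerivAt_greenFun hd hr).continuousAt.continuousWithinAt)
    (f' := fun r => 1 / Real.sinh r ^ (d - 1)) (fun r hr => ?_) fun r hr => ?_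
  · rw [interior_Ioi] at hr
    exact (hasDerivAt_greenFun hd hr).hasDerivWithinAt
  · rw [interior_Ioi] at hr
    exact one_div_pos.2 (sinh_pow_pos _ hr)

theorem tendsto_greenFun (hd : d = 2 ∨ d = 3) : Tendsto (greenFun d) (𝓝[>] 0) atBot := by
  rcases hd with rfl | rfl
  · have e : greenFun 2 = fun r => Real.log (Real.tanh (r / 2)) := by
      ext r
      simp [greenFun]
    rw [e]
    refine Real.tendsto_log_nhdsGT_zero.comp (tendsto_nhdsWithin_iff.2 ⟨?_, ?_⟩)
    · have h1 := (hasDerivAt_tanh_half 0).continuousAt.tendsto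
      simp only [zero_div, Real.tanh_zero] at h1
      exact h1.mono_left nhdsWithin_le_nhds
    · filter_upwards [self_mem_nhdsWithin] with r hr
      exact tanh_half_pos hr
  · have h1 : Tendsto Real.sinh (𝓝[>] 0) (𝓝[>] 0) := by
      refine tendsto_nhdsWithin_iff.2 ⟨?_, ?_⟩
      · have := Real.continuous_sinh.tendsto 0
        rw [Real.sinh_zero] at this
        exact this.mono_left nhdsWithin_le_nhds
      · filter_upwards [self_mem_nhdsWithin] with r hr
        exact Real.sinh_pos_iff.2 hr
    have h2 := tendsto_neg_atTop_atBot.comp (tendsto_inv_nhdsGT_zero.comp h1)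
    refine tendsto_atBot_mono' _ ?_ h2
    filter_upwards [self_mem_nhdsWithin] with r hr
    have h3 := Real.sinh_pos_iff.2 hr
    simp only [greenFun, Function.comp_apply]
    rw [if_neg (by norm_num), inv_eq_one_div]
    exact neg_le_neg (div_le_div_of_nonneg_right (Real.one_le_cosh r) h3.le)

/-- The Green function tends to -∞ at 0, so by the intermediate value theorem it takes every value
up to the one at R. The scattering length comes from here. -/
theorem exists_greenFun_eq (hd : d = 2 ∨ d = 3) (hR : 0 < R) {y : ℝ} (hy : y ≤ greenFun d R) :
    ∃ a, 0 < a ∧ greenFun d a = y := by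
  obtain ⟨b, hb1, hb2⟩ := (((tendsto_greenFun hd).eventually (eventually_le_atBot y)).and
    (Ioo_mem_nhdsGT hR)).exists
  have hc : ContinuousOn (greenFun d) (Icc b R) := fun r hr =>
    (hasDerivAt_greenFun hd (hb2.1.trans_le hr.1)).continuousAt.continuousWithinAt
  obtain ⟨a, ha, hay⟩ := intermediate_value_Icc hb2.2.le hc ⟨hb1, hy⟩
  exact ⟨a, hb2.1.trans_le ha.1, hay⟩

/-- The normalising factor between `fInf` and `greenFun`. -/
def fInfFactor (d : ℕ) (a : ℝ) : ℝ := if d = 2 then 1 else Real.tanh a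

theorem tanh_pos (ha : 0 < a) : 0 < Real.tanh a := by
  rw [← Real.tanh_zero]
  exact tanh_strictMono ha

theorem fInfFactor_pos (d : ℕ) (ha : 0 < a) : 0 < fInfFactor d a := by
  unfold fInfFactor
  split_ifs
  · exact one_pos
  · exact tanh_pos ha

/-- In both dimensions the zero-energy solution is a positive multiple of G - G(a). The factor
cancels in all quotients, so d = 2 and d = 3 can be treated together. -/
theorem fInf_eq (hd : d = 2 ∨ d = 3) (ha : 0 < a) (hr : 0 < r) :
    fInf d a r = fInfFactor d a * (greenFun d r - greenFun d a) := by
  rcases hd with rfl | rfl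
  · simp only [fInf, fInfFactor, greenFun, if_true, one_mul]
    exact Real.log_div (tanh_half_pos hr).ne' (tanh_half_pos ha).ne'
  · have h1 := (Real.sinh_pos_iff.2 ha).ne'
    have h2 := (Real.sinh_pos_iff.2 hr).ne'
    have h3 := (Real.cosh_pos a).ne'
    have h4 := (Real.cosh_pos r).ne'
    simp only [fInf, fInfFactor, greenFun, Nat.reduceEqDiff, if_false,
      Real.tanh_eq_sinh_div_cosh]
    field_simp
    ring

theorem deriv_fInf (hd : d = 2 ∨ d = 3) (ha : 0 < a) (hr : 0 < r) :
    deriv (fInf d a) r = fInfFactor d a * (1 / Real.sinh r ^ (d - 1)) := by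
  have h1 : fInf d a =ᶠ[𝓝 r] fun r => fInfFactor d a * (greenFun d r - greenFun d a) := by
    filter_upwards [Ioi_mem_nhds hr] with s hs
    exact fInf_eq hd ha hs
  rw [h1.deriv_eq]
  exact (((hasDerivAt_greenFun hd hr).sub_const _).const_mul _).deriv

theorem sphereArea_two : sphereArea 2 = 2 * Real.pi := by
  rw [sphereArea, Measure.toSphere_real_apply_univ, measureReal_def,
    EuclideanSpace.volume_ball_fin_two]
  simp [Real.pi_pos.le]

theorem sphereArea_three : sphereArea 3 = 4 * Real.pi := by
  rw [sphereArea, Measure.toSphere_real_apply_univ, measureReal_def,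
    EuclideanSpace.volume_ball_fin_three]
  simp only [finrank_euclideanSpace, Fintype.card_fin, one_pow, ENNReal.ofReal_one, one_mul]
  rw [ENNReal.toReal_ofReal (by positivity)]
  push_cast
  ring

end Green

/-! ### The profile outside the support of the potential. -/

section Scattering

variable {d : ℕ} {μ r R R' R₀ : ℝ} {V : ℝ → ℝ}

/-- The limit of the flux ratios of the truncated potentials. -/
def limRatio (μ : ℝ) (V : ℝ → ℝ) (n : ℕ) (R : ℝ) : ℝ := ⨆ k, fluxRatio n R (truncPot μ V k)

theorem truncPot_ae_zero (h : EssSupportedIn V R₀) (k : ℕ) :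
    ∀ᵐ t ∂(volume.restrict (Ioi R₀)), truncPot μ V k t = 0 := by
  filter_upwards [h] with t ht
  simp [truncPot, ht]

/-- As a function of G the solution is convex, with slope equal to the flux, so it lies above its
tangent at R. -/
theorem le_nprof (hd : d = 2 ∨ d = 3) (hμ : 0 < μ) (hV : Measurable V) (k : ℕ) (hr : 0 < r)
    (hR : r ≤ R) : 1 - fluxRatio (d - 1) R (truncPot μ V k) * (greenFun d R - greenFun d r) ≤
      nprof (d - 1) R (truncPot μ V k) r := by
  have hb := isBddPotential_truncPot hμ hV k
  have h1 := (prof_sub_bounds hb (fun t ht => hasDerivAt_greenFun hd ht) hr hR).2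
  have hp := hb.prof_pos (n := d - 1) R
  rw [nprof, fluxRatio, le_div_iff₀ hp, sub_mul, one_mul, mul_right_comm, div_mul_cancel₀ _ hp.ne']
  linarith

/-- Beyond R₀ the flux is constant, so the upper and lower convexity bounds coincide. -/
theorem prof_sub_eq (hd : d = 2 ∨ d = 3) (hμ : 0 < μ) (hV : Measurable V) (hR₀ : 0 < R₀)
    (h0 : EssSupportedIn V R₀) (k : ℕ) (hr : R₀ ≤ r) (hR : r ≤ R) :
    prof (d - 1) (truncPot μ V k) R - prof (d - 1) (truncPot μ V k) r =
      flux (d - 1) (truncPot μ V k) R * (greenFun d R - greenFun d r) := by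
  have hb := isBddPotential_truncPot hμ hV k
  have h1 := prof_sub_bounds hb (fun t ht => hasDerivAt_greenFun hd ht) (hR₀.trans_le hr) hR
  have h2 := fun s => flux_eq_of_ae_zero (n := d - 1) (r := s) hb hR₀.le (truncPot_ae_zero h0 k)
  rw [h2 r hr, h2 R (hr.trans hR)] at h1
  rw [h2 R (hr.trans hR)]
  exact le_antisymm h1.2 h1.1

theorem nprof_eq (hd : d = 2 ∨ d = 3) (hμ : 0 < μ) (hV : Measurable V) (hR₀ : 0 < R₀)
    (h0 : EssSupportedIn V R₀) (k : ℕ) (hr : R₀ ≤ r) (hR : r ≤ R) :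
    nprof (d - 1) R (truncPot μ V k) r =
      1 - fluxRatio (d - 1) R (truncPot μ V k) * (greenFun d R - greenFun d r) := by
  have hp := (isBddPotential_truncPot hμ hV k).prof_pos (n := d - 1) R
  have := prof_sub_eq hd hμ hV hR₀ h0 k hr hR
  rw [nprof, fluxRatio, div_eq_iff hp.ne', sub_mul, one_mul, mul_right_comm,
    div_mul_cancel₀ _ hp.ne']
  linarith

/-- The affine formula at R₀ and positivity of the solution there bound the flux ratios by 1 / (G(R)
- G(R₀)), uniformly in k and however large V is. This is where the compact support makes the minimal
energy finite. -/
theorem tendsto_fluxRatio (hd : d = 2 ∨ d = 3) (hμ : 0 < μ) (hV : Measurable V) (hR₀ : 0 < R₀)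
    (h0 : EssSupportedIn V R₀) (hR : R₀ < R) :
    Tendsto (fun k => fluxRatio (d - 1) R (truncPot μ V k)) atTop (𝓝 (limRatio μ V (d - 1) R)) := by
  refine tendsto_atTop_ciSup (fluxRatio_mono hμ hV _ (hR₀.trans hR))
    ⟨1 / (greenFun d R - greenFun d R₀), forall_mem_range.2 fun k => ?_⟩
  have h1 := nprof_eq hd hμ hV hR₀ h0 k le_rfl hR.le
  have h2 := nprof_pos hμ hV (d - 1) R k R₀
  have h3 := greenFun_strictMonoOn hd hR₀ (hR₀.trans hR) hR
  rw [le_div_iff₀ (by linarith)]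
  linarith

theorem minProfile_eq (hd : d = 2 ∨ d = 3) (hμ : 0 < μ) (hV : Measurable V) (hR₀ : 0 < R₀)
    (h0 : EssSupportedIn V R₀) (hr : R₀ ≤ r) (hrR : r ≤ R) (hR : R₀ < R) :
    minProfile μ V (d - 1) R r =
      1 - limRatio μ V (d - 1) R * (greenFun d R - greenFun d r) :=
  tendsto_nhds_unique (tendsto_nprof hμ hV _ (hR₀.le.trans hr) hrR)
    ((((tendsto_fluxRatio hd hμ hV hR₀ h0 hR).mul_const _).const_sub 1).congr fun k =>
      (nprof_eq hd hμ hV hR₀ h0 k hr hrR).symm)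

theorem le_minProfile (hd : d = 2 ∨ d = 3) (hμ : 0 < μ) (hV : Measurable V) (hR₀ : 0 < R₀)
    (h0 : EssSupportedIn V R₀) (hr : 0 < r) (hrR : r ≤ R) (hR : R₀ < R) :
    1 - limRatio μ V (d - 1) R * (greenFun d R - greenFun d r) ≤ minProfile μ V (d - 1) R r :=
  le_of_tendsto_of_tendsto'
    (((tendsto_fluxRatio hd hμ hV hR₀ h0 hR).mul_const _).const_sub 1)
    (tendsto_nprof hμ hV _ hr.le hrR) fun k => le_nprof hd hμ hV k hr hrR

/-- Dividing by both limits gives 1 / m(R') - 1 / m(R) = G(R') - G(R). The product form follows from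
the constant flux beyond R₀ and does not need the limits to be non-zero. -/
theorem limRatio_mul_eq (hd : d = 2 ∨ d = 3) (hμ : 0 < μ) (hV : Measurable V) (hR₀ : 0 < R₀)
    (h0 : EssSupportedIn V R₀) (hR : R₀ < R) (hRR' : R ≤ R') :
    limRatio μ V (d - 1) R' *
      (1 + limRatio μ V (d - 1) R * (greenFun d R' - greenFun d R)) = limRatio μ V (d - 1) R := by
  have h1 := tendsto_fluxRatio hd hμ hV hR₀ h0 hR
  have h2 := tendsto_fluxRatio hd hμ hV hR₀ h0 (hR.trans_le hRR')
  refine tendsto_nhds_unique ((h2.mul ((h1.mul_const _).const_add 1)).congr fun k => ?_) h1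
  have hb := isBddPotential_truncPot hμ hV k
  have h3 := prof_sub_eq hd hμ hV hR₀ h0 k hR.le hRR'
  have h4 := fun s => flux_eq_of_ae_zero (n := d - 1) (r := s) hb hR₀.le (truncPot_ae_zero h0 k)
  have hp := (hb.prof_pos (n := d - 1) R).ne'
  have hp' := (hb.prof_pos (n := d - 1) R').ne'
  rw [h4 R' (hR.le.trans hRR'), ← h4 R hR.le] at h3
  rw [fluxRatio, fluxRatio, h4 R' (hR.le.trans hRR'), ← h4 R hR.le]
  field_simp
  rw [← h3]
  ring

theorem limRatio_pos (hd : d = 2 ∨ d = 3) (hμ : 0 < μ) (hV : Measurable V)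
    (hV0 : ∀ r, 0 ≤ r → 0 ≤ V r) (hne : ¬ (∀ᵐ r ∂(volume.restrict (Ioi (0 : ℝ))), V r = 0))
    (hR₀ : 0 < R₀) (h0 : EssSupportedIn V R₀) (hR : R₀ < R) : 0 < limRatio μ V (d - 1) R := by
  -- Truncation at height 1 is enough to detect V, because min(V, 1) vanishes only where V does;
  -- height 0 would lose everything.
  have hb := isBddPotential_truncPot hμ hV 1
  have hR' := hR₀.trans hR
  have h1 : 0 < flux (d - 1) (truncPot μ V 1) R := by
    refine flux_pos hb hR' fun h => hne ?_
    rw [← Ioc_union_Ioi_eq_Ioi hR'.le, ae_restrict_union_iff]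
    refine ⟨?_, ae_restrict_of_ae_restrict_of_subset (Ioi_subset_Ioi hR.le) h0⟩
    filter_upwards [h, ae_restrict_mem measurableSet_Ioc] with t ht htR
    have h2 := hV0 t htR.1.le
    rw [truncPot, div_eq_zero_iff, max_eq_left h2] at ht
    rcases ht with ht | ht
    · rcases min_choice (V t) ((1 : ℕ) : ℝ) with e | e <;> rw [e] at ht
      · exact ht
      · simp at ht
    · linarith
  have h2 : 0 < fluxRatio (d - 1) R (truncPot μ V 1) := div_pos h1 (hb.prof_pos R)
  exact h2.trans_le ((fluxRatio_mono hμ hV (d - 1) hR').ge_of_tendsto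
    (tendsto_fluxRatio hd hμ hV hR₀ h0 hR) 1)

end Scattering

/-! ### Existence and uniqueness of the scattering length. -/

section ScatteringLength

variable {d : ℕ} {μ r a R R₀ : ℝ} {V : ℝ → ℝ}

/-- The common value is the level of G at which the affine continuation of the profile vanishes,
that is G(a). Its invariance is why the scattering length depends neither on R nor on R₀. -/
theorem limRatio_inv_sub (hd : d = 2 ∨ d = 3) (hμ : 0 < μ) (hV : Measurable V)
    (hV0 : ∀ r, 0 ≤ r → 0 ≤ V r) (hne : ¬ (∀ᵐ r ∂(volume.restrict (Ioi (0 : ℝ))), V r = 0))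
    {R₀' R' : ℝ} (hR₀ : 0 < R₀) (h0 : EssSupportedIn V R₀) (hR : R₀ < R)
    (hR₀' : 0 < R₀') (h0' : EssSupportedIn V R₀') (hR' : R₀' < R') :
    greenFun d R - (limRatio μ V (d - 1) R)⁻¹ = greenFun d R' - (limRatio μ V (d - 1) R')⁻¹ := by
  wlog hRR' : R ≤ R' generalizing R R' R₀ R₀'
  · exact (this hR₀' h0' hR' hR₀ h0 hR (le_of_not_ge hRR')).symm
  have h1 := limRatio_mul_eq hd hμ hV hR₀ h0 hR hRR'
  have h2 := limRatio_pos hd hμ hV hV0 hne hR₀ h0 hR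
  have h3 := limRatio_pos hd hμ hV hV0 hne hR₀' h0' hR'
  field_simp
  linear_combination -h1

theorem greenFun_sub_pos (hd : d = 2 ∨ d = 3) (hr : 0 < r) (hR : r < R) :
    0 < greenFun d R - greenFun d r :=
  sub_pos.2 (greenFun_strictMonoOn hd hr (hr.trans hR) hR)

theorem fInf_div (hd : d = 2 ∨ d = 3) (ha : 0 < a) (hr : 0 < r) (hR : 0 < R) :
    fInf d a r / fInf d a R =
      (greenFun d r - greenFun d a) / (greenFun d R - greenFun d a) := by
  rw [fInf_eq hd ha hr, fInf_eq hd ha hR, mul_div_mul_left _ _ (fInfFactor_pos d ha).ne']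

theorem ofReal_sphereArea (d : ℕ) :
    (volume : Measure (Coord d)).toSphere univ = ENNReal.ofReal (sphereArea d) :=
  (ofReal_measureReal (measure_ne_top _ _)).symm

theorem mul_deriv_fInf_div (hd : d = 2 ∨ d = 3) (ha : 0 < a) (hR : 0 < R) {m : ℝ}
    (hm : greenFun d R - greenFun d a = m⁻¹) :
    μ * deriv (fInf d a) R * Real.sinh R ^ (d - 1) * sphereArea d / fInf d a R =
      sphereArea d * (μ * m) := by
  have h1 := (sinh_pow_pos (d - 1) hR).ne'
  have h2 := (fInfFactor_pos d ha).ne'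
  rw [deriv_fInf hd ha hR, fInf_eq hd ha hR, hm]
  field_simp

/-- The length a is fixed by G(a) = G(R) - 1 / m(R) at the auxiliary radius R = S₀ + 1, and the
invariance extends this to every admissible R. All formulas then express m(R) as 1 / (G(R) - G(a)).
-/
theorem existsUnique_scatteringLength (hd : d = 2 ∨ d = 3) (hμ : 0 < μ) (hV : Measurable V)
    (hV0 : ∀ r, 0 ≤ r → 0 ≤ V r) (hsupp : ∃ R₀ : ℝ, 0 < R₀ ∧ EssSupportedIn V R₀)
    (hne : ¬ (∀ᵐ r ∂(volume.restrict (Ioi (0 : ℝ))), V r = 0)) :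
    ∃! a : ℝ, 0 < a ∧
      ∀ R₀ R : ℝ, 0 < R₀ → EssSupportedIn V R₀ → R₀ < R →
        a ≤ R₀ ∧
        (∀ r ∈ Ioc R₀ R, minProfile μ V (d - 1) R r = fInf d a r / fInf d a R) ∧
        (∀ r ∈ Icc a R, fInf d a r / fInf d a R ≤ minProfile μ V (d - 1) R r) ∧
        ∀ o ∈ poincareBall d,
          energy μ V o R (radial o (minProfile μ V (d - 1) R)) =
            ENNReal.ofReal (μ * deriv (fInf d a) R * Real.sinh R ^ (d - 1) *
              sphereArea d / fInf d a R) ∧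
          (d = 2 → energy μ V o R (radial o (minProfile μ V (d - 1) R)) =
            ENNReal.ofReal (2 * Real.pi * μ /
              Real.log (Real.tanh (R / 2) / Real.tanh (a / 2)))) ∧
          (d = 3 → energy μ V o R (radial o (minProfile μ V (d - 1) R)) =
            ENNReal.ofReal (4 * Real.pi * μ * Real.tanh a /
              (1 - Real.tanh a / Real.tanh R))) := by
  obtain ⟨S₀, hS₀, hS⟩ := hsupp
  have hS1 : S₀ < S₀ + 1 := lt_add_one S₀
  have hd2 : 2 ≤ d := by omega
  have hpos := fun {R₀ R : ℝ} (hR₀ : 0 < R₀) (h0 : EssSupportedIn V R₀) (hR : R₀ < R) =>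
    limRatio_pos hd hμ hV hV0 hne hR₀ h0 hR
  obtain ⟨a, ha, hay⟩ := exists_greenFun_eq hd (hS₀.trans hS1)
    (sub_le_self (greenFun d (S₀ + 1)) (inv_pos.2 (hpos hS₀ hS hS1)).le)
  have hgreen : ∀ {R₀ R : ℝ}, 0 < R₀ → EssSupportedIn V R₀ → R₀ < R →
      greenFun d R - greenFun d a = (limRatio μ V (d - 1) R)⁻¹ := by
    intro R₀ R hR₀ h0 hR
    have := limRatio_inv_sub hd hμ hV hV0 hne hR₀ h0 hR hS₀ hS hS1
    linarith
  have hform : ∀ {R₀ R r : ℝ}, 0 < R₀ → EssSupportedIn V R₀ → R₀ < R → 0 < r →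
      fInf d a r / fInf d a R =
        1 - limRatio μ V (d - 1) R * (greenFun d R - greenFun d r) := by
    intro R₀ R r hR₀ h0 hR hr
    have h1 := hgreen hR₀ h0 hR
    have h2 := (hpos hR₀ h0 hR).ne'
    have h3 : greenFun d r - greenFun d a =
      (limRatio μ V (d - 1) R)⁻¹ - (greenFun d R - greenFun d r) := by linarith
    rw [fInf_div hd ha hr (hR₀.trans hR), h1, h3]
    field_simp
  have hle : ∀ R₀ : ℝ, 0 < R₀ → EssSupportedIn V R₀ → a ≤ R₀ := by
    intro R₀ hR₀ h0
    -- If R₀ < a, the affine function, which vanishes at a and increases, would be negative at R₀,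
    -- where it equals the non-negative profile.
    by_contra! h
    have h1 := hgreen hR₀ h0 (lt_add_one R₀)
    have h2 := hpos hR₀ h0 (lt_add_one R₀)
    have h3 := minProfile_eq hd hμ hV hR₀ h0 le_rfl (lt_add_one R₀).le (lt_add_one R₀)
    have h4 := minProfile_nonneg hμ hV (d - 1) (R₀ + 1) R₀
    have h5 := greenFun_sub_pos hd hR₀ h
    have h6 : limRatio μ V (d - 1) (R₀ + 1) * (greenFun d (R₀ + 1) - greenFun d R₀) ≤ 1 := by
      linarith
    have h7 : limRatio μ V (d - 1) (R₀ + 1) * (greenFun d (R₀ + 1) - greenFun d a) = 1 := by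
      rw [h1, mul_inv_cancel₀ h2.ne']
    nlinarith
  refine ⟨a, ⟨ha, fun R₀ R hR₀ h0 hR => ⟨hle R₀ hR₀ h0, fun r hr => ?_, fun r hr => ?_,
    fun o ho => ?_⟩⟩, fun b ⟨hb, hb'⟩ => ?_⟩
  · rw [hform hR₀ h0 hR (hR₀.trans hr.1), minProfile_eq hd hμ hV hR₀ h0 hr.1.le hr.2 hR]
  · rw [hform hR₀ h0 hR (ha.trans_le hr.1)]
    exact le_minProfile hd hμ hV hR₀ h0 (ha.trans_le hr.1) hr.2 hR
  · have hR0 := hR₀.trans hR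
    have hg := hgreen hR₀ h0 hR
    have he := (admissible_minProfile ho hd2 hR0 hμ hV hV0
      (tendsto_fluxRatio hd hμ hV hR₀ h0 hR)).2
    have hs : 0 ≤ sphereArea d := measureReal_nonneg
    rw [ofReal_sphereArea, ← ENNReal.ofReal_mul hs] at he
    rw [he]
    refine ⟨by rw [mul_deriv_fInf_div hd ha hR0 hg], fun h => ?_, fun h => ?_⟩
    · subst h
      have h1 : Real.log (Real.tanh (R / 2) / Real.tanh (a / 2)) = fInf 2 a R := by simp [fInf]
      rw [h1, fInf_eq hd ha hR0, hg, sphereArea_two]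
      simp only [fInfFactor, if_true, one_mul, div_inv_eq_mul]
      congr 1
      ring
    · subst h
      have h1 : 1 - Real.tanh a / Real.tanh R = fInf 3 a R := by simp [fInf]
      have h2 := (tanh_pos ha).ne'
      rw [h1, fInf_eq hd ha hR0, hg, sphereArea_three]
      simp only [fInfFactor, Nat.reduceEqDiff, if_false]
      congr 1
      field_simp
  · obtain ⟨hbS, hb1, -⟩ := hb' S₀ (S₀ + 1) hS₀ hS hS1
    -- One radius strictly between S₀ and S₀ + 1 determines the length; at the endpoint S₀ + 1 the
    -- quotient is 1 for both lengths and carries no information.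
    have hr : S₀ + 1 / 2 ∈ Ioc S₀ (S₀ + 1) := ⟨by linarith, by linarith⟩
    have hr0 := hS₀.trans hr.1
    have h1 := hb1 _ hr
    rw [minProfile_eq hd hμ hV hS₀ hS hr.1.le hr.2 hS1, ← hform hS₀ hS hS1 hr0,
      fInf_div hd ha hr0 (hS₀.trans hS1), fInf_div hd hb hr0 (hS₀.trans hS1)] at h1
    have h2 := greenFun_sub_pos hd ha ((hle S₀ hS₀ hS).trans_lt hS1)
    have h3 := greenFun_sub_pos hd hb (hbS.trans_lt hS1)
    have h4 := greenFun_sub_pos hd hr0 (show S₀ + 1 / 2 < S₀ + 1 by linarith)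
    rw [div_eq_div_iff h2.ne' h3.ne'] at h1
    have h5 : (greenFun d (S₀ + 1) - greenFun d (S₀ + 1 / 2)) * (greenFun d b - greenFun d a) = 0 := by
      linear_combination h1
    have h6 := (mul_eq_zero.1 h5).resolve_left h4.ne'
    exact (greenFun_strictMonoOn hd).injOn hb ha (sub_eq_zero.1 h6)

end ScatteringLength

end HypScattering

end

/-! ### The main theorem. -/

theorem mainTheorem6 (d : ℕ) (hd : d = 2 ∨ d = 3) (μ : ℝ) (hμ : 0 < μ)
    (V : ℝ → ℝ) (hVmeas : Measurable V) (hVnonneg : ∀ r, 0 ≤ r → 0 ≤ V r)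
    (hVsupp : ∃ R₀ : ℝ, 0 < R₀ ∧ HypScattering.EssSupportedIn V R₀) :
    ∃ f : ℝ → ℝ → ℝ,
      -- the unique minimizer on every ball is radial, with profile `f R`
      (∀ R₀ R : ℝ, 0 < R₀ → HypScattering.EssSupportedIn V R₀ → R₀ < R →
        (∀ r ∈ Set.Icc 0 R, 0 ≤ f R r) ∧
        MonotoneOn (f R) (Set.Icc 0 R) ∧
        ∀ o ∈ HypScattering.poincareBall d,
          HypScattering.IsMinimizer μ V o R (HypScattering.radial o (f R)) ∧
          (∀ χ : HypScattering.Coord d → ℂ, HypScattering.IsMinimizer μ V o R χ →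
            χ =ᵐ[(HypScattering.hvol d).restrict (HypScattering.hball o R)]
              HypScattering.radial o (f R)) ∧
          ¬ (HypScattering.radial o (f R)
              =ᵐ[(HypScattering.hvol d).restrict (HypScattering.hball o R)] 0) ∧
          HypScattering.SolvesEulerLagrange μ V o R (HypScattering.radial o (f R))) ∧
      -- the scattering length, which depends neither on the ball nor on `R₀`
      (¬ (∀ᵐ r ∂(MeasureTheory.volume.restrict (Set.Ioi (0 : ℝ))), V r = 0) →
        ∃! a : ℝ, 0 < a ∧
          ∀ R₀ R : ℝ, 0 < R₀ → HypScattering.EssSupportedIn V R₀ → R₀ < R →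
            a ≤ R₀ ∧
            (∀ r ∈ Set.Ioc R₀ R, f R r = HypScattering.fInf d a r / HypScattering.fInf d a R) ∧
            (∀ r ∈ Set.Icc a R, HypScattering.fInf d a r / HypScattering.fInf d a R ≤ f R r) ∧
            ∀ o ∈ HypScattering.poincareBall d,
              HypScattering.energy μ V o R (HypScattering.radial o (f R)) =
                ENNReal.ofReal (μ * deriv (HypScattering.fInf d a) R * Real.sinh R ^ (d - 1) *
                  HypScattering.sphereArea d / HypScattering.fInf d a R) ∧
              (d = 2 → HypScattering.energy μ V o R (HypScattering.radial o (f R)) =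
                ENNReal.ofReal (2 * Real.pi * μ /
                  Real.log (Real.tanh (R / 2) / Real.tanh (a / 2)))) ∧
              (d = 3 → HypScattering.energy μ V o R (HypScattering.radial o (f R)) =
                ENNReal.ofReal (4 * Real.pi * μ * Real.tanh a /
                  (1 - Real.tanh a / Real.tanh R)))) := by
  have hd2 : 2 ≤ d := by omega
  -- The profile is built from μ, V, d and R alone and is chosen before R₀ and o, which gives its
  -- independence of both.
  refine ⟨HypScattering.minProfile μ V (d - 1), fun R₀ R hR₀ h0 hR => ?_,
    HypScattering.existsUnique_scatteringLength hd hμ hVmeas hVnonneg hVsupp⟩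
  have hR0 := hR₀.trans hR
  have hm := HypScattering.tendsto_fluxRatio hd hμ hVmeas hR₀ h0 hR
  refine ⟨fun r _ => HypScattering.minProfile_nonneg hμ hVmeas _ R r,
    (HypScattering.minProfile_mono hμ hVmeas _ R).monotoneOn _, fun o ho => ?_⟩
  obtain ⟨hadm, hen⟩ :=
    HypScattering.admissible_minProfile ho hd2 hR0 hμ hVmeas hVnonneg hm
  have hmin : HypScattering.IsMinimizer μ V o R
      (HypScattering.radial o (HypScattering.minProfile μ V (d - 1) R)) :=
    ⟨hadm, fun χ hχ => hen.le.trans (hχ.le_energy ho hd2 hR0 hμ hVmeas hVnonneg hm)⟩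
  have hfin : HypScattering.energy μ V o R
      (HypScattering.radial o (HypScattering.minProfile μ V (d - 1) R)) < ⊤ := by
    rw [hen]
    exact ENNReal.mul_lt_top (MeasureTheory.measure_lt_top _ _) ENNReal.ofReal_lt_top
  exact ⟨hmin, fun χ hχ => hmin.ae_eq ho hd2 hμ hVmeas hVnonneg hχ hfin,
    hadm.not_ae_zero ho hd2 hR0,
    hmin.solvesEulerLagrange ho hd2 hμ hVmeas hVnonneg hfin⟩
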